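/- Write $D(t)=\{z\in\mathbb C:|z|<t\}$ and $\overline D(t)=\{z\in\mathbb C:|z|\le t\}$. Let $0<r<R<+\infty$, and let $U\not\equiv\pm\infty$ be a $\delta$-subharmonic function on $\overline D(R)$; that is, on some connected open neighbourhood $O$ of $\overline D(R)$ we have $U=u-v$ with $u,v\colon O\to[-\infty,+\infty)$ subharmonic, $u\not\equiv-\infty$ and $v\not\equiv-\infty$. The value of $U$ at a point $w$ is defined if some representation of $U$ as a difference of two such subharmonic functions on $O$ does not take the form $(-\infty)-(-\infty)$ at $w$ (two differences $u-v$ and $u_1-v_1$ represent the same function if $u+v_1=u_1+v$ on $O$). Let $\varDelta_u=\frac1{2\pi}\bigtriangleup u$ and $\varDelta_v=\frac1{2\pi}\bigtriangleup v$ be the Riesz measures of $u$ and $v$ (Laplacian in the sense of distributions), let $\varDelta_U=\varDelta_u-\varDelta_v$ be the Riesz charge of $U$, let $\varDelta_U^-=\sup\{\varDelta_v,\varDelta_u\}-\varDelta_u$ be its lower variation, and let $$\mathsf C_{U^+}(R)=\frac1{2\pi}\int_0^{2\pi}\max\{U(Re^{i\varphi}),0\}\,d\varphi .$$ Then, for every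 $w\in\overline D(r)$ at which $U$ is defined, $$U(w)\le\frac{R+r}{R-r}\,\mathsf C_{U^+}(R)+\int_{D(R)}\ln\frac{2R}{|w-z|}\,d\varDelta_U^-(z),$$ where the integrand is $+\infty$ at $z=w$ and the integral takes values in $[0,+\infty]$. -/

import Mathlib

open MeasureTheory
open scoped ENNReal ContDiff

noncomputable section

/-- The mean `(1/2π) ∫_0^{2π} v (c + t e^{iθ}) dθ` of an extended-real function over a circle, as the
difference of the means of its positive and negative parts. -/
def circleMean (v : ℂ → EReal) (c : ℂ) (t : ℝ) : EReal :=
  ((ENNReal.ofReal (2 * Real.pi)⁻¹ *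
      ∫⁻ θ in Set.Ioc 0 (2 * Real.pi), (v (circleMap c t θ)).toENNReal : ℝ≥0∞) : EReal) -
  ((ENNReal.ofReal (2 * Real.pi)⁻¹ *
      ∫⁻ θ in Set.Ioc 0 (2 * Real.pi), (-v (circleMap c t θ)).toENNReal : ℝ≥0∞) : EReal)

/-- `u` is subharmonic on `O` and `u ≢ -∞` on `O` (used for connected open `O`). -/
structure IsSubharmonicOn (u : ℂ → EReal) (O : Set ℂ) : Prop where
  lt_top : ∀ z ∈ O, u z < ⊤
  upperSemicontinuousOn : UpperSemicontinuousOn u O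
  le_circleMean : ∀ (c : ℂ) (t : ℝ), 0 < t → Metric.closedBall c t ⊆ O → u c ≤ circleMean u c t
  exists_ne_bot : ∃ z ∈ O, u z ≠ ⊥

/-- `μ = (1/2π) Δu` on the open set `O` in the sense of distributions, where `μ` is a Radon measure
on `O`, regarded as a measure on `ℂ` that is zero outside `O`. The set where `u` is infinite is
Lebesgue-null for the functions `u` in question. -/
structure IsRieszMeasure (u : ℂ → EReal) (O : Set ℂ) (μ : Measure ℂ) : Prop where
  measure_compl : μ Oᶜ = 0
  lt_top_of_isCompact : ∀ K : Set ℂ, IsCompact K → K ⊆ O → μ K < ⊤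
  integral_eq : ∀ φ : ℂ → ℝ, ContDiff ℝ ∞ φ → HasCompactSupport φ → tsupport φ ⊆ O →
    ∫ z, φ z ∂μ = (2 * Real.pi)⁻¹ * ∫ z, (u z).toReal * Laplacian.laplacian φ z

open Classical in
/-- The Riesz measure `Δ_u = (1/2π) Δu` of a subharmonic function `u ≢ -∞` on a domain `O`. -/
def rieszMeasure (u : ℂ → EReal) (O : Set ℂ) : Measure ℂ :=
  if h : ∃ μ : Measure ℂ, IsRieszMeasure u O μ then h.choose else 0

/-- `U` is the δ-subharmonic function `u - v` on `O`. The values of `U` at the points where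
`u = v = -∞` are left free by this representation. -/
structure IsDeltaSubharmonicWith (U u v : ℂ → EReal) (O : Set ℂ) : Prop where
  left : IsSubharmonicOn u O
  right : IsSubharmonicOn v O
  eq_sub : ∀ z ∈ O, (u z ≠ ⊥ ∨ v z ≠ ⊥) → U z = u z - v z

/-- The value of the δ-subharmonic function `U` at `w` is determined: some representation of `U` as
a difference of subharmonic functions does not have the indeterminate form `(-∞) - (-∞)` at `w`. -/
def IsDefinedAt (U : ℂ → EReal) (O : Set ℂ) (w : ℂ) : Prop :=
  ∃ u v : ℂ → EReal, IsDeltaSubharmonicWith U u v O ∧ (u w ≠ ⊥ ∨ v w ≠ ⊥)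

/-- The lower variation `Δ_U⁻ = sup {Δ_v, Δ_u} - Δ_u` of the Riesz charge `Δ_u - Δ_v` of `U = u - v`. -/
def lowerVariation (u v : ℂ → EReal) (O : Set ℂ) : Measure ℂ :=
  (rieszMeasure v O ⊔ rieszMeasure u O) - rieszMeasure u O

/-- The kernel `ln (2R / |w - z|)`, with value `+∞` at `z = w`; it is positive for `w, z ∈ D(R)`,
the only points at which it is used. -/
def logKernel (R : ℝ) (w z : ℂ) : ℝ≥0∞ :=
  (ENNReal.log (ENNReal.ofReal (2 * R) / ENNReal.ofReal ‖w - z‖)).toENNReal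

end

/-! Let `G` be the Green function of the disc `D(R)` with pole `w` and `P` its harmonic measure at
`w`. The Poisson–Jensen formula says `u(w) + ∫ G dΔ_u = ∫ u dP` for subharmonic `u`. Take a
representation `U = u₁ - v₁` that is determinate at `w` and subtract the two formulas: `U(w)` equals
`∫ (u₁ - v₁) dP - ∫ G dΔ_{u₁} + ∫ G dΔ_{v₁}`. Harnack's bound on the Poisson kernel controls the
first term by `(R+r)/(R-r)` times the mean of `U⁺`. On the disc `Δ_{v₁} ≤ Δ_U⁻ + Δ_{u₁}`, so the
other two terms contribute at most `∫ G dΔ_U⁻`. Finally `G ≤ ln (2R/|w-z|)`, because `|R² - z̄w| ≤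
2R²`.

Infinite values fix the order of the argument. If `u₁(w) = -∞`, or if the kernel integral is
infinite, nothing is left to prove. Otherwise `∫ G dΔ_{u₁}` is finite, hence so is `∫ G dΔ_{v₁}`,
and this forces `v₁(w) > -∞`. Accordingly `IsSubharmonicOn.poissonJensen` consists of two
implications, one used for `u₁` and the other for `v₁`.

Poisson–Jensen is proved by testing the distributional definition of the Riesz measure on one
explicit function. Replace `log |z|` by a smooth radial function that agrees with it for `|z| ≥ ε`,
and take its potential against `P` minus its translate to `w`. Outside a slightly larger disc both
terms equal `log |z-w|`, so the result `smoothGreen` is smooth with compact support, and its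
Laplacian is `2π` times the mollification of `P - δ_w`. Hence `∫ smoothGreen dμ = ∫ u_ε dP - u_ε(w)`
exactly, where `u_ε` is the mollified function (`integral_smoothGreen_add_mollified`). As `ε → 0`,
`u_ε → u` by the submean inequality and upper semicontinuity; Fatou's lemma gives one inequality,
and an explicit error term `smoothingError` tending to `0` gives the other.

The Riesz measure exists because `∫ u Δφ ≥ 0` for test functions `φ ≥ 0`
(`integral_mul_laplacian_nonneg`): such a functional extends positively to `C_c(O)` and is
represented by a measure. Two representations satisfy `u + v₁ = u₁ + v` almost everywhere, so their
charges agree on the disc, and the lower variation may be computed from one while `w` is treated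
with the other. -/

/-! ### A smooth radial regularisation of the logarithm -/

/-- A smooth monotone step from `0` (on `s ≤ 1/2`) to `1` (on `s ≥ 1`). -/
noncomputable def logStep (s : ℝ) : ℝ := Real.smoothTransition (2 * s - 1)

/-- The smooth function `logStep s / (2 s)`. -/
noncomputable def logStepDiv (s : ℝ) : ℝ := logStep s / (2 * s)

/-- A smooth function on `ℝ` that equals `(log s) / 2` for `s ≥ 1`. -/
noncomputable def halfLogSmooth (s : ℝ) : ℝ := ∫ σ in (1 : ℝ)..s, logStepDiv σ

/-- The regularised logarithm `log |z|`, smooth on `ℂ` and unchanged for `|z| ≥ ε`. -/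
noncomputable def smoothLog (ε : ℝ) (z : ℂ) : ℝ := halfLogSmooth (‖z‖ ^ 2 / ε ^ 2) + Real.log ε

/-- The radial mollifier `(2π)⁻¹ Δ (smoothLog ε)`. -/
noncomputable def radialMollifier (ε : ℝ) (z : ℂ) : ℝ :=
  deriv logStep (‖z‖ ^ 2 / ε ^ 2) / (Real.pi * ε ^ 2)

theorem contDiff_logStep : ContDiff ℝ ∞ logStep :=
  Real.smoothTransition.contDiff.comp (by fun_prop)

theorem monotone_logStep : Monotone logStep := fun a b h =>
  Real.smoothTransition.monotone (by linarith)

theorem logStep_of_le {s : ℝ} (h : s ≤ 1 / 2) : logStep s = 0 :=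
  Real.smoothTransition.zero_of_nonpos (by linarith)

theorem logStep_of_ge {s : ℝ} (h : 1 ≤ s) : logStep s = 1 :=
  Real.smoothTransition.one_of_one_le (by linarith)

/-- The numerator vanishes for `s ≤ 1/2`, so the singularity of the quotient at `0` is never met. -/
theorem contDiff_logStepDiv : ContDiff ℝ ∞ logStepDiv := by
  rw [contDiff_iff_contDiffAt]
  intro s
  by_cases hs : s < 1 / 2
  · have : logStepDiv =ᶠ[nhds s] fun _ => 0 := by
      filter_upwards [gt_mem_nhds hs] with t ht
      simp [logStepDiv, logStep_of_le ht.le]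
    exact contDiffAt_const.congr_of_eventuallyEq this
  · exact contDiff_logStep.contDiffAt.div (by fun_prop) (by push Not at hs; linarith)

theorem mul_logStepDiv (s : ℝ) : s * logStepDiv s = logStep s / 2 := by
  rcases eq_or_ne s 0 with rfl | hs
  · simp [logStep_of_le (show (0 : ℝ) ≤ 1 / 2 by norm_num)]
  · unfold logStepDiv; field_simp

theorem hasDerivAt_halfLogSmooth (s : ℝ) : HasDerivAt halfLogSmooth (logStepDiv s) s :=
  intervalIntegral.integral_hasDerivAt_right
    (contDiff_logStepDiv.continuous.intervalIntegrable _ _)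
    contDiff_logStepDiv.continuous.aestronglyMeasurable.stronglyMeasurableAtFilter
    contDiff_logStepDiv.continuous.continuousAt

theorem contDiff_halfLogSmooth : ContDiff ℝ ∞ halfLogSmooth := by
  rw [contDiff_infty_iff_deriv]
  refine ⟨fun s => (hasDerivAt_halfLogSmooth s).differentiableAt, ?_⟩
  rw [show deriv halfLogSmooth = logStepDiv from funext fun s => (hasDerivAt_halfLogSmooth s).deriv]
  exact contDiff_logStepDiv

theorem logStepDiv_nonneg {s : ℝ} (hs : 0 ≤ s) : 0 ≤ logStepDiv s :=
  div_nonneg (Real.smoothTransition.nonneg _) (by linarith)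

theorem logStepDiv_le {s : ℝ} (hs : 0 < s) : logStepDiv s ≤ s⁻¹ / 2 := by
  unfold logStepDiv
  rw [div_le_iff₀ (by positivity)]
  have := Real.smoothTransition.le_one (2 * s - 1)
  rw [show s⁻¹ / 2 * (2 * s) = 1 by field_simp]
  exact this

theorem halfLogSmooth_of_ge {s : ℝ} (hs : 1 ≤ s) : halfLogSmooth s = Real.log s / 2 := by
  unfold halfLogSmooth
  rw [intervalIntegral.integral_congr (g := fun σ => σ⁻¹ / 2)]
  · rw [intervalIntegral.integral_div, integral_inv_of_pos one_pos (by linarith)]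
    simp
  · intro σ hσ
    rw [Set.uIcc_of_le hs] at hσ
    simp only [logStepDiv, logStep_of_ge hσ.1]
    field_simp

theorem halfLogSmooth_nonpos {s : ℝ} (h0 : 0 ≤ s) (hs : s ≤ 1) : halfLogSmooth s ≤ 0 := by
  unfold halfLogSmooth
  rw [intervalIntegral.integral_symm, neg_nonpos]
  exact intervalIntegral.integral_nonneg hs fun σ hσ => logStepDiv_nonneg (h0.trans hσ.1)

/-- The integrand is at most `1/(2σ)`, and for `s < 1` the integral over `[s, 1]` enters with a
minus sign, so cutting the integrand down raises the function. -/
theorem log_div_two_le_halfLogSmooth {s : ℝ} (h0 : 0 < s) : Real.log s / 2 ≤ halfLogSmooth s := by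
  rcases le_total 1 s with hs | hs
  · exact (halfLogSmooth_of_ge hs).ge
  · unfold halfLogSmooth
    rw [intervalIntegral.integral_symm]
    have h1 : ∫ σ in s..1, logStepDiv σ ≤ ∫ σ in s..1, σ⁻¹ / 2 := by
      refine intervalIntegral.integral_mono_on hs
        (contDiff_logStepDiv.continuous.intervalIntegrable _ _) ?_
        fun σ hσ => logStepDiv_le (h0.trans_le hσ.1)
      refine ContinuousOn.intervalIntegrable ?_
      rw [Set.uIcc_of_le hs]
      exact (continuousOn_inv₀.mono fun σ hσ => (h0.trans_le hσ.1).ne').div_const 2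
    rw [intervalIntegral.integral_div, integral_inv_of_pos h0 one_pos] at h1
    simp only [one_div, Real.log_inv] at h1
    linarith

theorem contDiff_smoothLog (ε : ℝ) : ContDiff ℝ ∞ (smoothLog ε) :=
  (contDiff_halfLogSmooth.comp ((contDiff_norm_sq ℝ).div_const _)).add contDiff_const

theorem log_sq_div_sq {ε x : ℝ} (hε : 0 < ε) (hx : 0 < x) :
    Real.log (x ^ 2 / ε ^ 2) / 2 + Real.log ε = Real.log x := by
  rw [Real.log_div (by positivity) (by positivity), Real.log_pow, Real.log_pow]
  push_cast; ring

theorem smoothLog_of_le_norm {ε : ℝ} (hε : 0 < ε) {z : ℂ} (hz : ε ≤ ‖z‖) :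
    smoothLog ε z = Real.log ‖z‖ := by
  unfold smoothLog
  rw [halfLogSmooth_of_ge, log_sq_div_sq hε (hε.trans_le hz)]
  rw [one_le_div (by positivity)]
  gcongr

theorem log_norm_le_smoothLog {ε : ℝ} (hε : 0 < ε) {z : ℂ} (hz : z ≠ 0) :
    Real.log ‖z‖ ≤ smoothLog ε z := by
  have hz' : 0 < ‖z‖ := norm_pos_iff.2 hz
  rw [← log_sq_div_sq hε hz', smoothLog]
  gcongr
  exact log_div_two_le_halfLogSmooth (by positivity)

theorem smoothLog_le_log {ε : ℝ} (hε : 0 < ε) {z : ℂ} (hz : ‖z‖ ≤ ε) :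
    smoothLog ε z ≤ Real.log ε := by
  unfold smoothLog
  have := halfLogSmooth_nonpos (s := ‖z‖ ^ 2 / ε ^ 2) (by positivity)
    (by rw [div_le_one (by positivity)]; gcongr)
  linarith

/-- The smoothed logarithm exceeds the logarithm by at most `log⁺ (ε / |z|)`, also at `z = 0` with
the convention `log 0 = 0`, provided `ε ≤ 1`. -/
theorem smoothLog_le {ε : ℝ} (hε : 0 < ε) (hε1 : ε ≤ 1) (z : ℂ) :
    smoothLog ε z ≤ Real.log ‖z‖ + Real.posLog (ε / ‖z‖) := by
  rcases le_total ε ‖z‖ with h | h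
  · rw [smoothLog_of_le_norm hε h]
    linarith [Real.posLog_nonneg (x := ε / ‖z‖)]
  · refine (smoothLog_le_log hε h).trans ?_
    rcases eq_or_ne z 0 with rfl | hz
    · simpa using Real.log_nonpos hε.le hε1
    · have hz' : 0 < ‖z‖ := norm_pos_iff.2 hz
      have : Real.log (ε / ‖z‖) ≤ Real.posLog (ε / ‖z‖) := le_max_right _ _
      rw [Real.log_div hε.ne' hz'.ne'] at this
      linarith

theorem fderiv_smoothLog (ε : ℝ) :
    fderiv ℝ (smoothLog ε) =
      fun z => (logStepDiv (‖z‖ ^ 2 / ε ^ 2) * (2 / ε ^ 2)) • innerSL ℝ z := by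
  funext z
  have h1 : HasFDerivAt (fun z : ℂ => ‖z‖ ^ 2 / ε ^ 2) ((2 / ε ^ 2) • innerSL ℝ z) z := by
    have := ((hasStrictFDerivAt_norm_sq z).hasFDerivAt).mul_const (ε ^ 2)⁻¹
    refine this.congr_fderiv ?_
    ext v
    simp [div_eq_mul_inv]
    ring
  have h2 := ((hasDerivAt_halfLogSmooth (‖z‖ ^ 2 / ε ^ 2)).comp_hasFDerivAt z h1).add_const
    (Real.log ε)
  rw [mul_smul]
  exact h2.fderiv

theorem fderiv_fderiv_smoothLog_apply (ε : ℝ) (z v : ℂ) :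
    fderiv ℝ (fderiv ℝ (smoothLog ε)) z v v =
      deriv logStepDiv (‖z‖ ^ 2 / ε ^ 2) * (2 / ε ^ 2) ^ 2 * inner ℝ z v ^ 2 +
        logStepDiv (‖z‖ ^ 2 / ε ^ 2) * (2 / ε ^ 2) * ‖v‖ ^ 2 := by
  rw [fderiv_smoothLog]
  have h1 : HasFDerivAt (fun z : ℂ => ‖z‖ ^ 2 / ε ^ 2) ((2 / ε ^ 2) • innerSL ℝ z) z := by
    have := ((hasStrictFDerivAt_norm_sq z).hasFDerivAt).mul_const (ε ^ 2)⁻¹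
    refine this.congr_fderiv ?_
    ext v
    simp [div_eq_mul_inv]
    ring
  have hk : HasDerivAt logStepDiv (deriv logStepDiv (‖z‖ ^ 2 / ε ^ 2)) (‖z‖ ^ 2 / ε ^ 2) :=
    (contDiff_logStepDiv.differentiable (by simp)).differentiableAt.hasDerivAt
  have h2 := ((hk.comp_hasFDerivAt z h1).mul_const (2 / ε ^ 2)).smul (innerSL ℝ (E := ℂ)).hasFDerivAt
  rw [show (fun z : ℂ => (logStepDiv (‖z‖ ^ 2 / ε ^ 2) * (2 / ε ^ 2)) • innerSL ℝ z) =
    (fun z => (logStepDiv ∘ fun z : ℂ => ‖z‖ ^ 2 / ε ^ 2) z * (2 / ε ^ 2)) • ⇑(innerSL ℝ) from rfl]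
  rw [HasFDerivAt.fderiv h2]
  have hin : ∀ a b : ℂ, (innerSL ℝ a) b = inner ℝ a b := fun _ _ => rfl
  change (((logStepDiv (‖z‖ ^ 2 / ε ^ 2) * (2 / ε ^ 2)) * (innerSL ℝ v) v) +
    ((2 / ε ^ 2) * (deriv logStepDiv (‖z‖ ^ 2 / ε ^ 2) * ((2 / ε ^ 2) * (innerSL ℝ z) v))) *
      (innerSL ℝ z) v) = _
  rw [hin, hin, real_inner_self_eq_norm_sq]
  ring

/-- Write `s = |z|²/ε²` and `k = logStepDiv`. Summing the second derivatives along `1` and `I` gives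
`(4/ε²)(k + s k') = (4/ε²)(s k)'`, and `s k` is half of `logStep`. -/
theorem laplacian_smoothLog {ε : ℝ} (hε : 0 < ε) (z : ℂ) :
    Laplacian.laplacian (smoothLog ε) z = 2 * Real.pi * radialMollifier ε z := by
  rw [InnerProductSpace.laplacian_eq_iteratedFDeriv_complexPlane]
  simp only [iteratedFDeriv_two_apply, Matrix.cons_val_zero, Matrix.cons_val_one]
  rw [fderiv_fderiv_smoothLog_apply, fderiv_fderiv_smoothLog_apply, radialMollifier]
  set s := ‖z‖ ^ 2 / ε ^ 2 with hs
  have hd : deriv logStep s / 2 = logStepDiv s + s * deriv logStepDiv s := by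
    have h1 : HasDerivAt logStepDiv (deriv logStepDiv s) s :=
      (contDiff_logStepDiv.differentiable (by simp)).differentiableAt.hasDerivAt
    have h2 := (hasDerivAt_id s).mul h1
    have h3 : (id * logStepDiv : ℝ → ℝ) = fun s => logStep s / 2 :=
      funext fun s => mul_logStepDiv s
    rw [h3] at h2
    have h4 := h2.deriv
    rw [deriv_div_const] at h4
    simpa using h4
  have hz : ‖z‖ ^ 2 = s * ε ^ 2 := by rw [hs]; field_simp
  have h5 : (inner ℝ z 1 : ℝ) ^ 2 + (inner ℝ z Complex.I : ℝ) ^ 2 = ‖z‖ ^ 2 := by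
    rw [Complex.sq_norm, Complex.normSq_apply]
    simp [Complex.inner]
    ring
  rw [hz] at h5
  have h6 : deriv logStep s = 2 * (logStepDiv s + s * deriv logStepDiv s) := by linarith
  rw [h6]
  have h7 : (inner ℝ z 1 : ℝ) ^ 2 = s * ε ^ 2 - (inner ℝ z Complex.I : ℝ) ^ 2 := by linarith
  rw [h7]
  have := Real.pi_pos
  simp
  field_simp
  ring

theorem radialMollifier_nonneg (ε : ℝ) (z : ℂ) : 0 ≤ radialMollifier ε z :=
  div_nonneg monotone_logStep.deriv_nonneg (by have := Real.pi_pos; positivity)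

theorem continuous_deriv_logStep : Continuous (deriv logStep) :=
  contDiff_logStep.continuous_deriv (by simp)

theorem continuous_radialMollifier (ε : ℝ) : Continuous (radialMollifier ε) := by
  unfold radialMollifier
  exact (continuous_deriv_logStep.comp (by fun_prop)).div_const _

theorem deriv_logStep_of_ge {s : ℝ} (hs : 1 ≤ s) : deriv logStep s = 0 := by
  have h : Set.EqOn (deriv logStep) (fun _ => 0) (closure (Set.Ioi 1)) := by
    refine Set.EqOn.closure (fun t ht => ?_) continuous_deriv_logStep continuous_const
    have : logStep =ᶠ[nhds t] fun _ => 1 := by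
      filter_upwards [lt_mem_nhds (Set.mem_Ioi.1 ht)] with x hx using logStep_of_ge hx.le
    rw [this.deriv_eq, deriv_const]
  rw [closure_Ioi] at h
  exact h hs

theorem radialMollifier_of_le_norm {ε : ℝ} (hε : 0 < ε) {z : ℂ} (hz : ε ≤ ‖z‖) :
    radialMollifier ε z = 0 := by
  unfold radialMollifier
  rw [deriv_logStep_of_ge, zero_div]
  rw [one_le_div (by positivity)]
  gcongr

theorem hasCompactSupport_radialMollifier {ε : ℝ} (hε : 0 < ε) :
    HasCompactSupport (radialMollifier ε) :=
  HasCompactSupport.intro (isCompact_closedBall 0 ε) fun z hz =>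
    radialMollifier_of_le_norm hε (by simp at hz; exact hz.le)

theorem integrable_radialMollifier {ε : ℝ} (hε : 0 < ε) : Integrable (radialMollifier ε) :=
  (continuous_radialMollifier ε).integrable_of_hasCompactSupport (hasCompactSupport_radialMollifier hε)

/-- In polar coordinates the radial density is an exact derivative, that of `logStep (t²/ε²) /
(2π)`, which rises from `0` to `1/(2π)`. -/
theorem integral_radialMollifier {ε : ℝ} (hε : 0 < ε) : ∫ z, radialMollifier ε z = 1 := by
  have h := integral_fun_norm_addHaar (volume : Measure ℂ)
    (fun t => deriv logStep (t ^ 2 / ε ^ 2) / (Real.pi * ε ^ 2))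
  have hL : ∫ z, radialMollifier ε z =
    ∫ z : ℂ, (fun t => deriv logStep (t ^ 2 / ε ^ 2) / (Real.pi * ε ^ 2)) ‖z‖ := rfl
  rw [hL, h]
  have hd : ∀ t ∈ Set.Ioi (0 : ℝ), HasDerivAt (fun t => logStep (t ^ 2 / ε ^ 2) / (2 * Real.pi))
      (t ^ (Module.finrank ℝ ℂ - 1) • (deriv logStep (t ^ 2 / ε ^ 2) / (Real.pi * ε ^ 2))) t := by
    intro t _
    have h1 : HasDerivAt (fun t : ℝ => t ^ 2 / ε ^ 2) (2 * t / ε ^ 2) t := by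
      simpa using (hasDerivAt_pow 2 t).div_const (ε ^ 2)
    have h2 : HasDerivAt logStep (deriv logStep (t ^ 2 / ε ^ 2)) (t ^ 2 / ε ^ 2) :=
      (contDiff_logStep.differentiable (by simp)).differentiableAt.hasDerivAt
    have h3 := (h2.comp t h1).div_const (2 * Real.pi)
    refine h3.congr_deriv ?_
    have := Real.pi_pos
    simp [Complex.finrank_real_complex]
    field_simp
  have hc : Continuous fun t : ℝ => logStep (t ^ 2 / ε ^ 2) / (2 * Real.pi) := by
    exact (contDiff_logStep.continuous.comp (by fun_prop)).div_const _
  have hlim : Filter.Tendsto (fun t : ℝ => logStep (t ^ 2 / ε ^ 2) / (2 * Real.pi)) Filter.atTop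
      (nhds (1 / (2 * Real.pi))) := by
    refine tendsto_const_nhds.congr' ?_
    filter_upwards [Filter.eventually_ge_atTop ε] with t ht
    rw [logStep_of_ge]
    rw [one_le_div (by positivity)]
    gcongr
  have hint := integral_Ioi_of_hasDerivAt_of_nonneg hc.continuousWithinAt hd (fun t ht => by
    have : (0 : ℝ) < t := ht
    have := Real.pi_pos
    have := monotone_logStep.deriv_nonneg (x := t ^ 2 / ε ^ 2)
    simp only [smul_eq_mul]; positivity) hlim
  rw [hint]
  have h0 : logStep 0 = 0 := logStep_of_le (by norm_num)
  have hπ := Real.pi_pos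
  simp [Measure.real, Complex.volume_ball, h0, Complex.finrank_real_complex]

/-! ### Superpositions of translates of a smooth function -/

section Superposition

variable {P : Measure ℂ} [IsFiniteMeasure P] {R : ℝ}

theorem integrable_comp_sub {E : Type} [NormedAddCommGroup E] {g : ℂ → E} (hg : Continuous g)
    (hP : ∀ᵐ ζ ∂P, ‖ζ‖ ≤ R) (z : ℂ) : Integrable (fun ζ => g (z - ζ)) P := by
  obtain ⟨C, hC⟩ := (isCompact_closedBall z R).exists_bound_of_continuousOn hg.continuousOn
  refine Integrable.of_bound (hg.comp (by fun_prop)).aestronglyMeasurable C ?_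
  filter_upwards [hP] with ζ hζ
  exact hC _ (by simpa [dist_eq_norm] using hζ)

theorem hasFDerivAt_integral_comp_sub {E : Type} [NormedAddCommGroup E] [NormedSpace ℝ E]
    {g : ℂ → E} (hg : ContDiff ℝ 1 g) (hP : ∀ᵐ ζ ∂P, ‖ζ‖ ≤ R) (z : ℂ) :
    HasFDerivAt (fun z => ∫ ζ, g (z - ζ) ∂P) (∫ ζ, fderiv ℝ g (z - ζ) ∂P) z := by
  have hg' : Continuous (fderiv ℝ g) := hg.continuous_fderiv one_ne_zero
  obtain ⟨C, hC⟩ := (isCompact_closedBall z (R + 1)).exists_bound_of_continuousOn hg'.continuousOn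
  refine hasFDerivAt_integral_of_dominated_of_fderiv_le
    (F := fun x ζ => g (x - ζ)) (F' := fun x ζ => fderiv ℝ g (x - ζ)) (bound := fun _ => C)
    (Metric.closedBall_mem_nhds z one_pos)
    (Filter.Eventually.of_forall fun x =>
      (hg.continuous.comp (continuous_const.sub continuous_id)).aestronglyMeasurable)
    (integrable_comp_sub hg.continuous hP z) (hg'.comp (continuous_const.sub continuous_id)).aestronglyMeasurable ?_
    (integrable_const C) ?_
  · filter_upwards [hP] with ζ hζ x hx
    refine hC _ ?_
    rw [Metric.mem_closedBall, dist_eq_norm] at hx ⊢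
    calc ‖x - ζ - z‖ = ‖(x - z) - ζ‖ := by congr 1; ring
      _ ≤ ‖x - z‖ + ‖ζ‖ := norm_sub_le _ _
      _ ≤ R + 1 := by linarith
  · refine Filter.Eventually.of_forall fun ζ x _ => ?_
    have h := ((hg.differentiable one_ne_zero) (x - ζ)).hasFDerivAt
    simpa [Function.comp_def] using h.comp x ((hasFDerivAt_id x).sub_const ζ)

theorem fderiv_integral_comp_sub {E : Type} [NormedAddCommGroup E] [NormedSpace ℝ E]
    {g : ℂ → E} (hg : ContDiff ℝ 1 g) (hP : ∀ᵐ ζ ∂P, ‖ζ‖ ≤ R) :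
    fderiv ℝ (fun z => ∫ ζ, g (z - ζ) ∂P) = fun z => ∫ ζ, fderiv ℝ g (z - ζ) ∂P :=
  funext fun z => (hasFDerivAt_integral_comp_sub hg hP z).fderiv

theorem contDiff_nat_integral_comp_sub (hP : ∀ᵐ ζ ∂P, ‖ζ‖ ≤ R) (n : ℕ) :
    ∀ {E : Type} [NormedAddCommGroup E] [NormedSpace ℝ E] {g : ℂ → E}, ContDiff ℝ ∞ g →
      ContDiff ℝ n (fun z => ∫ ζ, g (z - ζ) ∂P) := by
  induction n with
  -- The induction ranges over all target spaces, since the derivative of an `E`-valued function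
  -- takes values in `ℂ →L[ℝ] E`.
  | zero =>
    intro E _ _ g hg
    rw [Nat.cast_zero, contDiff_zero]
    exact continuous_iff_continuousAt.2 fun z =>
      (hasFDerivAt_integral_comp_sub (hg.of_le (by simp)) hP z).continuousAt
  | succ n ih =>
    intro E _ _ g hg
    have h1 : ContDiff ℝ 1 g := hg.of_le (by simp)
    push_cast
    rw [contDiff_succ_iff_fderiv]
    refine ⟨fun z => (hasFDerivAt_integral_comp_sub h1 hP z).differentiableAt, by simp, ?_⟩
    rw [fderiv_integral_comp_sub h1 hP]
    exact ih (hg.fderiv_right (by simp))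

theorem contDiff_integral_comp_sub (hP : ∀ᵐ ζ ∂P, ‖ζ‖ ≤ R) {g : ℂ → ℝ} (hg : ContDiff ℝ ∞ g) :
    ContDiff ℝ ∞ (fun z => ∫ ζ, g (z - ζ) ∂P) :=
  contDiff_infty.2 fun n => contDiff_nat_integral_comp_sub hP n hg

theorem laplacian_integral_comp_sub (hP : ∀ᵐ ζ ∂P, ‖ζ‖ ≤ R) {g : ℂ → ℝ} (hg : ContDiff ℝ ∞ g)
    (z : ℂ) : Laplacian.laplacian (fun z => ∫ ζ, g (z - ζ) ∂P) z =
      ∫ ζ, Laplacian.laplacian g (z - ζ) ∂P := by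
  have h1 : ContDiff ℝ 1 g := hg.of_le (by simp)
  have h2 : ContDiff ℝ 1 (fderiv ℝ g) := (hg.fderiv_right (m := ∞) (by simp)).of_le (by simp)
  have h3 : Continuous (fderiv ℝ (fderiv ℝ g)) := h2.continuous_fderiv one_ne_zero
  have hi := integrable_comp_sub (E := ℂ →L[ℝ] ℂ →L[ℝ] ℝ) h3 hP z
  simp only [InnerProductSpace.laplacian_eq_iteratedFDeriv_complexPlane, iteratedFDeriv_two_apply,
    Matrix.cons_val_zero, Matrix.cons_val_one]
  rw [fderiv_integral_comp_sub h1 hP, fderiv_integral_comp_sub h2 hP]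
  have happ : ∀ v : ℂ, (∫ ζ, fderiv ℝ (fderiv ℝ g) (z - ζ) ∂P) v v =
      ∫ ζ, fderiv ℝ (fderiv ℝ g) (z - ζ) v v ∂P := by
    intro v
    rw [ContinuousLinearMap.integral_apply hi, ContinuousLinearMap.integral_apply]
    exact hi.apply_continuousLinearMap v
  have hint : ∀ v : ℂ, Integrable (fun ζ => fderiv ℝ (fderiv ℝ g) (z - ζ) v v) P := fun v =>
    (hi.apply_continuousLinearMap v).apply_continuousLinearMap v
  rw [happ, happ, ← integral_add (hint 1) (hint Complex.I)]

end Superposition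

theorem continuous_laplacian {g : ℂ → ℝ} (hg : ContDiff ℝ 2 g) :
    Continuous (Laplacian.laplacian g) := by
  have h2 : ContDiff ℝ 1 (fderiv ℝ g) := hg.fderiv_right (by norm_num)
  have h3 : Continuous (fderiv ℝ (fderiv ℝ g)) := h2.continuous_fderiv one_ne_zero
  rw [InnerProductSpace.laplacian_eq_iteratedFDeriv_complexPlane]
  simp only [iteratedFDeriv_two_apply, Matrix.cons_val_zero, Matrix.cons_val_one]
  fun_prop

theorem laplacian_eq_zero_of_notMem_tsupport {g : ℂ → ℝ} {z : ℂ} (hz : z ∉ tsupport g) :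
    Laplacian.laplacian g z = 0 := by
  have h : g =ᶠ[nhds z] fun _ => 0 := notMem_tsupport_iff_eventuallyEq.1 hz
  rw [(InnerProductSpace.laplacian_congr_nhds h).eq_of_nhds]
  simp

/-! ### Rotation averages -/

theorem measurePreserving_rotation (θ : ℝ) :
    MeasurePreserving (fun y : ℂ => Complex.exp (θ * Complex.I) * y) volume volume := by
  have h := (rotation (Circle.exp θ)).measurePreserving
  refine h

/-- Rotating `y` traverses the circle of radius `‖y‖` from the starting angle `arg y`. Averaging
over rotations, which preserve area, thus replaces polar coordinates below. -/
theorem circleMap_zero_norm (y : ℂ) (θ : ℝ) :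
    circleMap 0 ‖y‖ (θ + Complex.arg y) = Complex.exp (θ * Complex.I) * y := by
  rw [circleMap]
  conv_rhs => rw [← Complex.norm_mul_exp_arg_mul_I y]
  push_cast
  rw [add_mul, Complex.exp_add]
  ring

/-- Both period intervals are fundamental domains for the translations by `2πℤ`; no measurability of
`g` is needed. -/
theorem lintegral_Ioc_add_of_periodic {g : ℝ → ℝ≥0∞} (hg : Function.Periodic g (2 * Real.pi))
    (a : ℝ) : ∫⁻ θ in Set.Ioc 0 (2 * Real.pi), g (θ + a) =
      ∫⁻ θ in Set.Ioc 0 (2 * Real.pi), g θ := by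
  have h1 : ∫⁻ θ in Set.Ioc 0 (2 * Real.pi), g (θ + a) =
      ∫⁻ θ in Set.Ioc a (a + 2 * Real.pi), g θ := by
    have h := (measurePreserving_add_right volume a).setLIntegral_comp_preimage_emb
      (measurableEmbedding_addRight a) g (Set.Ioc a (a + 2 * Real.pi))
    rw [← h]
    congr 2
    ext x
    simp [add_comm]
  rw [h1]
  have h2 := (isAddFundamentalDomain_Ioc Real.two_pi_pos a).setLIntegral_eq
    (isAddFundamentalDomain_Ioc Real.two_pi_pos 0) g ?_
  · simpa using h2
  · rintro ⟨_, n, rfl⟩ x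
    have := hg.int_mul n x
    simpa [AddSubgroup.vadd_def, add_comm] using this

theorem lintegral_exp_mul_eq (F : ℂ → ℝ≥0∞) (y : ℂ) :
    ∫⁻ θ in Set.Ioc 0 (2 * Real.pi), F (Complex.exp ((θ : ℝ) * Complex.I) * y) =
      ∫⁻ θ in Set.Ioc 0 (2 * Real.pi), F (circleMap 0 ‖y‖ θ) := by
  have h := lintegral_Ioc_add_of_periodic (g := fun θ => F (circleMap 0 ‖y‖ θ))
    (fun θ => by simp only [periodic_circleMap 0 ‖y‖ θ]) (Complex.arg y)
  simpa only [circleMap_zero_norm] using h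

theorem volume_Ioc_two_pi : volume (Set.Ioc 0 (2 * Real.pi)) = ENNReal.ofReal (2 * Real.pi) := by
  simp

/-- The integral of a nonnegative function over the plane is that of its circle means. -/
theorem lintegral_eq_lintegral_circle {F : ℂ → ℝ≥0∞} (hF : Measurable F) :
    ENNReal.ofReal (2 * Real.pi) * ∫⁻ y, F y =
      ∫⁻ y : ℂ, ∫⁻ θ in Set.Ioc 0 (2 * Real.pi), F (circleMap 0 ‖y‖ θ) := by
  simp_rw [← lintegral_exp_mul_eq]
  rw [lintegral_lintegral_swap]
  · have : ∀ θ : ℝ, ∫⁻ y : ℂ, F (Complex.exp ((θ : ℝ) * Complex.I) * y) = ∫⁻ y, F y := fun θ =>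
      (measurePreserving_rotation θ).lintegral_comp hF
    simp only [this, lintegral_const, Measure.restrict_apply_univ, volume_Ioc_two_pi]
    rw [mul_comm]
  · refine Measurable.aemeasurable ?_
    exact hF.comp (by fun_prop)

theorem integrable_rotation_prod {F : ℂ → ℝ} (hm : Measurable F) (hF : Integrable F) :
    Integrable (fun p : ℂ × ℝ => F (Complex.exp ((p.2 : ℝ) * Complex.I) * p.1))
      (volume.prod (volume.restrict (Set.Ioc 0 (2 * Real.pi)))) := by
  have hmeas : Measurable fun p : ℂ × ℝ => F (Complex.exp ((p.2 : ℝ) * Complex.I) * p.1) :=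
    hm.comp (by fun_prop)
  rw [integrable_prod_iff' hmeas.aestronglyMeasurable]
  refine ⟨Filter.Eventually.of_forall fun θ =>
    (measurePreserving_rotation θ).integrable_comp_of_integrable hF, ?_⟩
  have : ∀ θ : ℝ, ∫ y : ℂ, ‖F (Complex.exp ((θ : ℝ) * Complex.I) * y)‖ = ∫ y, ‖F y‖ := by
    intro θ
    have hmp := measurePreserving_rotation θ
    have h := integral_map (f := fun y => ‖F y‖) hmp.measurable.aemeasurable
      (μ := volume) (by rw [hmp.map_eq]; exact hm.norm.aestronglyMeasurable)
    rw [hmp.map_eq] at h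
    exact h.symm
  simp only [this]
  exact integrable_const _

/-- An integral over the plane is bounded below through its rotation averages. -/
theorem le_integral_of_rotation {F : ℂ → ℝ} (hm : Measurable F) (hF : Integrable F) {k : ℂ → ℝ}
    (hk : Integrable k)
    (h : ∀ y, 2 * Real.pi * k y ≤
      ∫ θ in Set.Ioc 0 (2 * Real.pi), F (Complex.exp ((θ : ℝ) * Complex.I) * y)) :
    ∫ y, k y ≤ ∫ y, F y := by
  have hi := integrable_rotation_prod hm hF
  have h1 : ∫ y, ∫ θ in Set.Ioc 0 (2 * Real.pi), F (Complex.exp ((θ : ℝ) * Complex.I) * y) =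
      2 * Real.pi * ∫ y, F y := by
    rw [integral_integral_swap hi]
    have : ∀ θ : ℝ, ∫ y : ℂ, F (Complex.exp ((θ : ℝ) * Complex.I) * y) = ∫ y, F y := by
      intro θ
      have hmp := measurePreserving_rotation θ
      have h := integral_map (f := F) hmp.measurable.aemeasurable
        (μ := volume) (by rw [hmp.map_eq]; exact hm.aestronglyMeasurable)
      rw [hmp.map_eq] at h
      exact h.symm
    simp only [this, integral_const]
    simp [Measure.real, Real.pi_pos.le]
  have h2 : ∫ y, 2 * Real.pi * k y ≤
      ∫ y, ∫ θ in Set.Ioc 0 (2 * Real.pi), F (Complex.exp ((θ : ℝ) * Complex.I) * y) :=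
    integral_mono (hk.const_mul _) hi.integral_prod_left h
  rw [h1, integral_const_mul] at h2
  exact le_of_mul_le_mul_left h2 Real.two_pi_pos

/-! ### Basic facts on subharmonic functions -/

theorem EReal.toReal_le_of_le_coe_sub {x : EReal} (hx : x ≠ ⊥) {A B : ℝ≥0∞} (hA : A ≠ ⊤)
    (h : x ≤ (A : EReal) - (B : EReal)) : B ≠ ⊤ ∧ x.toReal ≤ A.toReal - B.toReal := by
  lift A to NNReal using hA
  by_cases hB : B = ⊤
  · subst hB
    simp at h
    exact absurd h hx
  · lift B to NNReal using hB
    refine ⟨ENNReal.coe_ne_top, ?_⟩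
    have h' : x ≤ ((A - B : ℝ) : EReal) := h
    have hxt : x ≠ ⊤ := (h'.trans_lt (EReal.coe_lt_top _)).ne
    lift x to ℝ using ⟨hxt, hx⟩
    exact_mod_cast h'

theorem EReal.toENNReal_neg_of_ne_bot {x : EReal} (hx : x ≠ ⊥) :
    (-x).toENNReal = ENNReal.ofReal (-x.toReal) := by
  rw [EReal.toENNReal_of_ne_top (by simpa using hx)]
  simp

theorem EReal.toReal_le_of_le_coe {x : EReal} (hx : x ≠ ⊥) {M : ℝ} (h : x ≤ M) : x.toReal ≤ M := by
  have hxt : x ≠ ⊤ := fun hh => by simp [hh] at h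
  lift x to ℝ using ⟨hxt, hx⟩
  exact_mod_cast h

theorem circleMap_eq_add (c : ℂ) (t θ : ℝ) : circleMap c t θ = c + circleMap 0 t θ := by
  simp [circleMap]

namespace IsSubharmonicOn

variable {u : ℂ → EReal} {O : Set ℂ}

theorem exists_le_coe (hu : IsSubharmonicOn u O) {K : Set ℂ} (hK : IsCompact K) (hKO : K ⊆ O) :
    ∃ M : ℝ, 0 ≤ M ∧ ∀ z ∈ K, u z ≤ M := by
  rcases K.eq_empty_or_nonempty with rfl | hne
  · exact ⟨0, le_rfl, by simp⟩
  · obtain ⟨a, ha, hmax⟩ :=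
      (hu.upperSemicontinuousOn.mono hKO).exists_isMaxOn hne hK
    refine ⟨max 0 (u a).toReal, le_max_left _ _, fun z hz => (hmax hz).trans ?_⟩
    exact (EReal.le_coe_toReal (hu.lt_top a (hKO ha)).ne).trans (by exact_mod_cast le_max_right _ _)

theorem coe_toReal (hu : IsSubharmonicOn u O) {z : ℂ} (hz : z ∈ O) (h : u z ≠ ⊥) :
    ((u z).toReal : EReal) = u z := EReal.coe_toReal (hu.lt_top z hz).ne h

theorem circleMap_mem {c : ℂ} {t : ℝ} (ht : 0 < t) (hball : Metric.closedBall c t ⊆ O) (θ : ℝ) :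
    circleMap c t θ ∈ O := hball (circleMap_mem_closedBall c ht.le θ)

theorem lintegral_circle_pos_ne_top {c : ℂ} {t M : ℝ} (hM : ∀ θ, u (circleMap c t θ) ≤ M) :
    ENNReal.ofReal (2 * Real.pi)⁻¹ *
      ∫⁻ θ in Set.Ioc 0 (2 * Real.pi), (u (circleMap c t θ)).toENNReal ≤ ENNReal.ofReal M := by
  have h : ∫⁻ θ in Set.Ioc 0 (2 * Real.pi), (u (circleMap c t θ)).toENNReal ≤
      ∫⁻ θ in Set.Ioc 0 (2 * Real.pi), ENNReal.ofReal M :=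
    lintegral_mono fun θ => EReal.toENNReal_le_toENNReal (hM θ)
  rw [lintegral_const, Measure.restrict_apply_univ, volume_Ioc_two_pi] at h
  refine (mul_le_mul_right h _).trans ?_
  rw [mul_comm (ENNReal.ofReal M), ← mul_assoc, ← ENNReal.ofReal_mul (by positivity),
    inv_mul_cancel₀ Real.two_pi_pos.ne']
  simp

/-- The mean of the positive part is at most `M`, so the submean inequality at `c` leaves at most `M
- u(c)` for the mean of the negative part. The bound does not depend on the radius. -/
theorem lintegral_circle_neg_le (hu : IsSubharmonicOn u O) {c : ℂ} {t M : ℝ} (ht : 0 < t)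
    (hball : Metric.closedBall c t ⊆ O) (hM0 : 0 ≤ M) (hM : ∀ z ∈ Metric.closedBall c t, u z ≤ M)
    (hc : u c ≠ ⊥) :
    ∫⁻ θ in Set.Ioc 0 (2 * Real.pi), (-u (circleMap c t θ)).toENNReal ≤
      ENNReal.ofReal (2 * Real.pi) * ENNReal.ofReal (M - (u c).toReal) := by
  have hpos := lintegral_circle_pos_ne_top (u := u) (c := c) (t := t) (M := M)
    fun θ => hM _ (circleMap_mem_closedBall c ht.le θ)
  obtain ⟨hB, hle⟩ := EReal.toReal_le_of_le_coe_sub hc (ne_top_of_le_ne_top ENNReal.ofReal_ne_top hpos)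
    (hu.le_circleMean c t ht hball)
  set B := ENNReal.ofReal (2 * Real.pi)⁻¹ *
    ∫⁻ θ in Set.Ioc 0 (2 * Real.pi), (-u (circleMap c t θ)).toENNReal with hBdef
  have h1 := ENNReal.toReal_mono ENNReal.ofReal_ne_top hpos
  rw [ENNReal.toReal_ofReal hM0] at h1
  have h2 : B ≤ ENNReal.ofReal (M - (u c).toReal) := by
    rw [← ENNReal.ofReal_toReal hB]
    exact ENNReal.ofReal_le_ofReal (by linarith)
  calc _ = ENNReal.ofReal (2 * Real.pi) * B := by
        rw [hBdef, ← mul_assoc, ← ENNReal.ofReal_mul (by positivity),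
          mul_inv_cancel₀ Real.two_pi_pos.ne']
        simp
    _ ≤ _ := by gcongr

/-! ### Integrability over circles and compact sets, finiteness almost everywhere. -/

theorem enorm_toReal_le (x : EReal) : ‖x.toReal‖ₑ ≤ x.toENNReal + (-x).toENNReal := by
  induction x with
  | bot => simp
  | top => simp
  | coe x =>
    rw [← EReal.coe_neg]
    simp only [EReal.toReal_coe, EReal.real_coe_toENNReal]
    rw [Real.enorm_eq_ofReal_abs]
    rcases le_total 0 x with h | h
    · rw [abs_of_nonneg h]; exact le_self_add
    · rw [abs_of_nonpos h]; exact le_add_self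

theorem ae_circle_ne_bot (hu : IsSubharmonicOn u O) (hm : Measurable u) {c : ℂ} {t : ℝ} (ht : 0 < t)
    (hball : Metric.closedBall c t ⊆ O) (hc : u c ≠ ⊥) :
    ∀ᵐ θ ∂(volume.restrict (Set.Ioc 0 (2 * Real.pi))), u (circleMap c t θ) ≠ ⊥ := by
  obtain ⟨M, hM0, hM⟩ := hu.exists_le_coe (isCompact_closedBall c t) hball
  have h := ne_top_of_le_ne_top (by finiteness) (hu.lintegral_circle_neg_le ht hball hM0 hM hc)
  have hm' : Measurable fun θ => (-u (circleMap c t θ)).toENNReal :=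
    (hm.comp (continuous_circleMap c t).measurable).neg.ereal_toENNReal
  filter_upwards [ae_lt_top hm' h] with θ hθ hbot
  rw [hbot] at hθ
  simp at hθ

theorem integrable_circle (hu : IsSubharmonicOn u O) (hm : Measurable u) {c : ℂ} {t : ℝ}
    (ht : 0 < t) (hball : Metric.closedBall c t ⊆ O) (hc : u c ≠ ⊥) :
    IntegrableOn (fun θ => (u (circleMap c t θ)).toReal) (Set.Ioc 0 (2 * Real.pi)) := by
  obtain ⟨M, hM0, hM⟩ := hu.exists_le_coe (isCompact_closedBall c t) hball
  have h := ne_top_of_le_ne_top (by finiteness) (hu.lintegral_circle_neg_le ht hball hM0 hM hc)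
  have hmc : Measurable fun θ => u (circleMap c t θ) :=
    hm.comp (continuous_circleMap c t).measurable
  refine ⟨hmc.ereal_toReal.aestronglyMeasurable, ?_⟩
  refine (lintegral_mono fun θ => enorm_toReal_le _).trans_lt ?_
  rw [lintegral_add_left hmc.ereal_toENNReal]
  refine ENNReal.add_lt_top.2 ⟨?_, h.lt_top⟩
  calc _ ≤ ∫⁻ θ in Set.Ioc 0 (2 * Real.pi), ENNReal.ofReal M := lintegral_mono fun θ =>
        EReal.toENNReal_le_toENNReal (hM _ (circleMap_mem_closedBall c ht.le θ))
    _ < ⊤ := by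
      rw [lintegral_const, Measure.restrict_apply_univ, volume_Ioc_two_pi]
      finiteness

theorem le_integral_circle (hu : IsSubharmonicOn u O) (hm : Measurable u) {c : ℂ} {t : ℝ}
    (ht : 0 < t) (hball : Metric.closedBall c t ⊆ O) (hc : u c ≠ ⊥) :
    2 * Real.pi * (u c).toReal ≤
      ∫ θ in Set.Ioc 0 (2 * Real.pi), (u (circleMap c t θ)).toReal := by
  obtain ⟨M, hM0, hM⟩ := hu.exists_le_coe (isCompact_closedBall c t) hball
  have hpos := lintegral_circle_pos_ne_top (u := u) (c := c) (t := t) (M := M)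
    fun θ => hM _ (circleMap_mem_closedBall c ht.le θ)
  obtain ⟨hB, hle⟩ := EReal.toReal_le_of_le_coe_sub hc (ne_top_of_le_ne_top ENNReal.ofReal_ne_top hpos)
    (hu.le_circleMean c t ht hball)
  rw [integral_eq_lintegral_pos_part_sub_lintegral_neg_part (hu.integrable_circle hm ht hball hc)]
  have h1 : ∫⁻ θ in Set.Ioc 0 (2 * Real.pi), ENNReal.ofReal (u (circleMap c t θ)).toReal =
      ∫⁻ θ in Set.Ioc 0 (2 * Real.pi), (u (circleMap c t θ)).toENNReal :=
    lintegral_congr fun θ =>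
      (EReal.toENNReal_of_ne_top (hu.lt_top _ (circleMap_mem ht hball θ)).ne).symm
  have h2 : ∫⁻ θ in Set.Ioc 0 (2 * Real.pi), ENNReal.ofReal (-(u (circleMap c t θ)).toReal) =
      ∫⁻ θ in Set.Ioc 0 (2 * Real.pi), (-u (circleMap c t θ)).toENNReal := by
    refine lintegral_congr_ae ?_
    filter_upwards [hu.ae_circle_ne_bot hm ht hball hc] with θ hθ
    exact (EReal.toENNReal_neg_of_ne_bot hθ).symm
  rw [h1, h2]
  rw [ENNReal.toReal_mul, ENNReal.toReal_mul, ENNReal.toReal_ofReal (by positivity), ← mul_sub] at hle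
  rwa [← le_inv_mul_iff₀ Real.two_pi_pos]

/-- The circle bound for the negative part holds with one constant for all radii below `t`, so it
can be integrated over the disc through rotation averages. -/
theorem lintegral_ball_neg_lt_top (hu : IsSubharmonicOn u O) (hm : Measurable u) {c : ℂ} {t : ℝ}
    (hball : Metric.closedBall c t ⊆ O) (hc : u c ≠ ⊥) :
    ∫⁻ z in Metric.ball c t, (-u z).toENNReal < ⊤ := by
  obtain ⟨M, hM0, hM⟩ := hu.exists_le_coe (isCompact_closedBall c t) hball
  rcases le_or_gt t 0 with ht0 | ht0
  · simp [Metric.ball_eq_empty.2 ht0]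
  have hucM : (u c).toReal ≤ M :=
    EReal.toReal_le_of_le_coe hc (hM c (Metric.mem_closedBall_self ht0.le))
  set D := ENNReal.ofReal (2 * Real.pi) * ENNReal.ofReal (M - (u c).toReal) with hD
  set F : ℂ → ℝ≥0∞ := (Metric.ball 0 t).indicator fun y => (-u (c + y)).toENNReal with hF
  have hFm : Measurable F :=
    (hm.comp (measurable_const_add c)).neg.ereal_toENNReal.indicator Metric.isOpen_ball.measurableSet
  have h0 : ∫⁻ z in Metric.ball c t, (-u z).toENNReal = ∫⁻ y, F y := by
    rw [hF, lintegral_indicator Metric.isOpen_ball.measurableSet,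
      ← (measurePreserving_add_left volume c).setLIntegral_comp_preimage_emb
      (measurableEmbedding_addLeft c)]
    congr 2
    ext y
    simp [dist_eq_norm]
  rw [h0]
  have h1 := lintegral_eq_lintegral_circle hFm
  have h2 : ∀ y : ℂ, ∫⁻ θ in Set.Ioc 0 (2 * Real.pi), F (circleMap 0 ‖y‖ θ) ≤
      (Metric.ball 0 t).indicator (fun _ => D) y := by
    intro y
    by_cases hy : y ∈ Metric.ball (0 : ℂ) t
    · have hmem : ∀ θ, circleMap 0 ‖y‖ θ ∈ Metric.ball (0 : ℂ) t := fun θ => by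
        simpa using hy
      rw [Set.indicator_of_mem hy]
      simp only [hF, Set.indicator_of_mem (hmem _), ← circleMap_eq_add]
      -- The circle through `y = 0` degenerates to the centre, where the bound is `-u(c) ≤ M -
      -- u(c)`.
      rcases eq_or_ne y 0 with rfl | hy0
      · simp only [norm_zero, circleMap_zero_radius, Function.const_apply, lintegral_const,
          Measure.restrict_apply_univ, volume_Ioc_two_pi]
        rw [hD, mul_comm, EReal.toENNReal_neg_of_ne_bot hc]
        gcongr
        linarith
      · have hyt : ‖y‖ < t := by simpa using hy
        have hsub := Metric.closedBall_subset_closedBall (x := c) hyt.le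
        exact hu.lintegral_circle_neg_le (norm_pos_iff.2 hy0) (hsub.trans hball) hM0
          (fun z hz => hM z (hsub hz)) hc
    · have hmem : ∀ θ, circleMap 0 ‖y‖ θ ∉ Metric.ball (0 : ℂ) t := fun θ => by
        simpa using hy
      simp [hF, Set.indicator_of_notMem (hmem _)]
  have h3 : ENNReal.ofReal (2 * Real.pi) * ∫⁻ y, F y < ⊤ := by
    rw [h1]
    refine (lintegral_mono h2).trans_lt ?_
    rw [lintegral_indicator Metric.isOpen_ball.measurableSet, lintegral_const,
      Measure.restrict_apply_univ]
    exact ENNReal.mul_lt_top (by rw [hD]; finiteness) measure_ball_lt_top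
  have h4 : ENNReal.ofReal (2 * Real.pi) ≠ 0 := by simp [Real.pi_pos]
  rw [lt_top_iff_ne_top] at h3 ⊢
  exact fun h => h3 (by rw [h, ENNReal.mul_top h4])

/-- Connectedness argument: the set `A` of points near which the negative part is integrable is
open, meets `O`, and is relatively closed in `O`. For the last claim, a point of `A` close to `z`
supplies a centre `c` with `u(c) > -∞` whose disc reaches `z`. -/
theorem exists_nhds_lintegral_neg_lt_top (hu : IsSubharmonicOn u O) (hm : Measurable u)
    (hO : IsOpen O) (hOc : IsConnected O) :
    ∀ z ∈ O, ∃ s ∈ nhds z, ∫⁻ x in s, (-u x).toENNReal < ⊤ := by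
  set A := {z : ℂ | ∃ s ∈ nhds z, ∫⁻ x in s, (-u x).toENNReal < ⊤} with hA
  suffices h : O ⊆ A from h
  have key : ∀ c : ℂ, ∀ t : ℝ, Metric.closedBall c t ⊆ O → u c ≠ ⊥ → Metric.ball c t ⊆ A :=
    fun c t hball hc z hz => ⟨Metric.ball c t, Metric.isOpen_ball.mem_nhds hz,
      hu.lintegral_ball_neg_lt_top hm hball hc⟩
  refine hOc.isPreconnected.subset_of_closure_inter_subset ?_ ?_ ?_
  · rw [isOpen_iff_mem_nhds]
    rintro z ⟨s, hs, hlt⟩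
    filter_upwards [eventually_mem_nhds_iff.2 hs] with x hx using ⟨s, hx, hlt⟩
  · obtain ⟨z, hz, hne⟩ := hu.exists_ne_bot
    obtain ⟨t, ht, hsub⟩ := Metric.nhds_basis_closedBall.mem_iff.1 (hO.mem_nhds hz)
    exact ⟨z, hz, key z t hsub hne (Metric.mem_ball_self ht)⟩
  · rintro z ⟨hzA, hzO⟩
    obtain ⟨t, ht, hsub⟩ := Metric.nhds_basis_closedBall.mem_iff.1 (hO.mem_nhds hzO)
    obtain ⟨a, ⟨s, hs, hlt⟩, ha⟩ := Metric.mem_closure_iff.1 hzA (t / 2) (by linarith)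
    have hn : s ∩ Metric.ball z (t / 2) ∈ nhds a :=
      Filter.inter_mem hs (Metric.isOpen_ball.mem_nhds (by rwa [Metric.mem_ball, dist_comm]))
    -- Were `u = -∞` on this whole neighbourhood of `a`, the integral of the negative part over `s`
    -- would be infinite.
    obtain ⟨c, hc, hcne⟩ : ∃ c ∈ s ∩ Metric.ball z (t / 2), u c ≠ ⊥ := by
      by_contra! hcon
      have hvol : volume (interior (s ∩ Metric.ball z (t / 2))) ≠ 0 :=
        (isOpen_interior.measure_pos volume ⟨a, mem_interior_iff_mem_nhds.2 hn⟩).ne'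
      have : ∫⁻ x in interior (s ∩ Metric.ball z (t / 2)), (-u x).toENNReal = ⊤ := by
        rw [setLIntegral_congr_fun (g := fun _ => ⊤) isOpen_interior.measurableSet]
        · rw [lintegral_const, Measure.restrict_apply_univ, ENNReal.top_mul hvol]
        · intro x hx
          simp [hcon x (interior_subset hx)]
      have h2 : ∫⁻ x in interior (s ∩ Metric.ball z (t / 2)), (-u x).toENNReal ≤
          ∫⁻ x in s, (-u x).toENNReal :=
        lintegral_mono_set (interior_subset.trans Set.inter_subset_left)
      rw [this] at h2
      exact absurd (h2.trans_lt hlt) (lt_irrefl _)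
    have hcz : dist c z < t / 2 := hc.2
    refine key c (t / 2) (fun x hx => hsub ?_) hcne (by rwa [Metric.mem_ball, dist_comm])
    rw [Metric.mem_closedBall] at hx ⊢
    linarith [dist_triangle x c z]

theorem ae_ne_bot (hu : IsSubharmonicOn u O) (hm : Measurable u) (hO : IsOpen O)
    (hOc : IsConnected O) : ∀ᵐ z, z ∈ O → u z ≠ ⊥ := by
  have : volume {z | z ∈ O ∧ u z = ⊥} = 0 := by
    refine measure_null_of_locally_null _ fun z hz => ?_
    obtain ⟨s, hs, hlt⟩ := hu.exists_nhds_lintegral_neg_lt_top hm hO hOc z hz.1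
    have hs' := mem_interior_iff_mem_nhds.2 hs
    have hae : ∀ᵐ x ∂(volume.restrict (interior s)), (-u x).toENNReal < ⊤ :=
      ae_lt_top hm.neg.ereal_toENNReal
        ((lintegral_mono_set interior_subset).trans_lt hlt).ne
    refine ⟨interior s ∩ {z | z ∈ O ∧ u z = ⊥}, Filter.inter_mem
      (mem_nhdsWithin_of_mem_nhds (isOpen_interior.mem_nhds hs')) self_mem_nhdsWithin, ?_⟩
    rw [ae_restrict_iff' isOpen_interior.measurableSet] at hae
    refine measure_mono_null ?_ hae
    rintro x ⟨hx1, hx2⟩ hcon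
    have := hcon hx1
    simp [hx2.2] at this
  rw [ae_iff]
  convert this using 2
  ext z
  simp

theorem locallyIntegrableOn (hu : IsSubharmonicOn u O) (hm : Measurable u) (hO : IsOpen O)
    (hOc : IsConnected O) : LocallyIntegrableOn (fun z => (u z).toReal) O := by
  intro z hz
  obtain ⟨s, hs, hlt⟩ := hu.exists_nhds_lintegral_neg_lt_top hm hO hOc z hz
  obtain ⟨t, ht, hsub⟩ := Metric.nhds_basis_closedBall.mem_iff.1 (hO.mem_nhds hz)
  obtain ⟨M, hM0, hM⟩ := hu.exists_le_coe (isCompact_closedBall z t) hsub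
  refine ⟨interior s ∩ Metric.ball z t, mem_nhdsWithin_of_mem_nhds (Filter.inter_mem
    (interior_mem_nhds.2 hs) (Metric.ball_mem_nhds z ht)), hm.ereal_toReal.aestronglyMeasurable, ?_⟩
  refine (lintegral_mono fun θ => enorm_toReal_le _).trans_lt ?_
  rw [lintegral_add_left hm.ereal_toENNReal]
  refine ENNReal.add_lt_top.2 ⟨?_, (lintegral_mono_set
    (Set.inter_subset_left.trans interior_subset)).trans_lt hlt⟩
  calc _ ≤ ∫⁻ x in Metric.ball z t, (u x).toENNReal := lintegral_mono_set Set.inter_subset_right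
    _ ≤ ∫⁻ x in Metric.ball z t, ENNReal.ofReal M :=
        setLIntegral_mono measurable_const fun x hx =>
          EReal.toENNReal_le_toENNReal (hM _ (Metric.ball_subset_closedBall hx))
    _ < ⊤ := by
      rw [lintegral_const, Measure.restrict_apply_univ]
      exact ENNReal.mul_lt_top (by finiteness) measure_ball_lt_top

theorem integrableOn (hu : IsSubharmonicOn u O) (hm : Measurable u) (hO : IsOpen O)
    (hOc : IsConnected O) {K : Set ℂ} (hK : IsCompact K) (hKO : K ⊆ O) :
    IntegrableOn (fun z => (u z).toReal) K :=
  ((hu.locallyIntegrableOn hm hO hOc).mono_set hKO).integrableOn_isCompact hK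

/-- Against a continuous factor that vanishes off a compact subset of `O`, `u` is integrable. -/
theorem integrable_mul (hu : IsSubharmonicOn u O) (hm : Measurable u) (hO : IsOpen O)
    (hOc : IsConnected O) {K : Set ℂ} (hK : IsCompact K) (hKO : K ⊆ O) {g : ℂ → ℝ}
    (hg : Continuous g) (hgK : ∀ z ∉ K, g z = 0) : Integrable fun z => (u z).toReal * g z := by
  have h := (hu.integrableOn hm hO hOc hK hKO).mul_continuousOn hg.continuousOn hK
  refine (integrableOn_iff_integrable_of_support_subset fun z hz => ?_).1 h
  by_contra hzK
  exact hz (by simp [hgK z hzK])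

end IsSubharmonicOn

/-! ### Bounds for the mollification from both sides. -/

/-- The mollification of `u` at radius `ε`. -/
noncomputable def mollified (u : ℂ → EReal) (ε : ℝ) (a : ℂ) : ℝ :=
  ∫ z, (u z).toReal * radialMollifier ε (z - a)

namespace IsSubharmonicOn

variable {u : ℂ → EReal} {O : Set ℂ}

theorem integrable_mul_radialMollifier (hu : IsSubharmonicOn u O) (hm : Measurable u)
    (hO : IsOpen O) (hOc : IsConnected O) {a : ℂ} {ε : ℝ} (hε : 0 < ε)
    (hball : Metric.closedBall a ε ⊆ O) :
    Integrable fun z => (u z).toReal * radialMollifier ε (z - a) :=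
  hu.integrable_mul hm hO hOc (isCompact_closedBall a ε) hball
    ((continuous_radialMollifier ε).comp (by fun_prop)) fun z hz =>
      radialMollifier_of_le_norm hε (by simp [dist_eq_norm] at hz; exact hz.le)

/-- The mollifier is radial with mass `1`, so the mollification is a weighted average of circle
means about `a`, each of which is at least `u(a)`. -/
theorem le_mollified (hu : IsSubharmonicOn u O) (hm : Measurable u) (hO : IsOpen O)
    (hOc : IsConnected O) {a : ℂ} {ε : ℝ} (hε : 0 < ε) (hball : Metric.closedBall a ε ⊆ O)
    (ha : u a ≠ ⊥) : (u a).toReal ≤ mollified u ε a := by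
  have hint := hu.integrable_mul_radialMollifier hm hO hOc hε hball
  have hshift : mollified u ε a = ∫ y, (u (a + y)).toReal * radialMollifier ε y := by
    rw [mollified, ← integral_add_left_eq_self _ a]
    simp
  have hint' : Integrable fun y => (u (a + y)).toReal * radialMollifier ε y := by
    have := hint.comp_add_left a
    simpa using this
  have hk : Integrable fun y => (u a).toReal * radialMollifier ε y :=
    (integrable_radialMollifier hε).const_mul _
  have hkey : ∫ y, (u a).toReal * radialMollifier ε y ≤
      ∫ y, (u (a + y)).toReal * radialMollifier ε y := by
    refine le_integral_of_rotation ?_ hint' hk fun y => ?_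
    · exact (hm.comp (measurable_const_add a)).ereal_toReal.mul
        (continuous_radialMollifier ε).measurable
    · have hrot : ∀ θ : ℝ, radialMollifier ε (Complex.exp (θ * Complex.I) * y) =
          radialMollifier ε y := fun θ => by
        simp [radialMollifier, Complex.norm_exp_ofReal_mul_I]
      simp only [hrot]
      rw [integral_mul_const, ← mul_assoc]
      rcases le_or_gt ε ‖y‖ with hy | hy
      · simp [radialMollifier_of_le_norm hε hy]
      · refine mul_le_mul_of_nonneg_right ?_ (radialMollifier_nonneg _ _)
        have hper : ∫ θ in Set.Ioc 0 (2 * Real.pi),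
            (u (a + Complex.exp ((θ : ℝ) * Complex.I) * y)).toReal =
            ∫ θ in Set.Ioc 0 (2 * Real.pi), (u (circleMap a ‖y‖ θ)).toReal := by
          have hp : Function.Periodic (fun θ => (u (circleMap a ‖y‖ θ)).toReal) (2 * Real.pi) :=
            fun θ => by simp only [periodic_circleMap a ‖y‖ θ]
          rw [← intervalIntegral.integral_of_le Real.two_pi_pos.le,
            ← intervalIntegral.integral_of_le Real.two_pi_pos.le]
          have h1 : ∀ θ : ℝ, (u (a + Complex.exp ((θ : ℝ) * Complex.I) * y)).toReal =
              (fun θ => (u (circleMap a ‖y‖ θ)).toReal) (θ + Complex.arg y) := fun θ => by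
            simp only [circleMap_eq_add a, circleMap_zero_norm]
          simp only [h1]
          rw [intervalIntegral.integral_comp_add_right (fun θ => (u (circleMap a ‖y‖ θ)).toReal),
            zero_add, add_comm (2 * Real.pi), hp.intervalIntegral_add_eq _ 0]
          simp
        rw [hper]
        rcases eq_or_ne y 0 with rfl | hy0
        · simp [Real.pi_pos.le]
        · exact hu.le_integral_circle hm (norm_pos_iff.2 hy0)
            ((Metric.closedBall_subset_closedBall hy.le).trans hball) ha
  rw [integral_const_mul, integral_radialMollifier hε, mul_one] at hkey
  rwa [hshift]

theorem mollified_le (hu : IsSubharmonicOn u O) (hm : Measurable u) (hO : IsOpen O)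
    (hOc : IsConnected O) {a : ℂ} {ε : ℝ} (hε : 0 < ε) (hball : Metric.closedBall a ε ⊆ O)
    {M : ℝ} (hM : ∀ z ∈ Metric.closedBall a ε, u z ≤ M) : mollified u ε a ≤ M := by
  have h1 : ∫ z, M * radialMollifier ε (z - a) = M := by
    rw [integral_const_mul, integral_sub_right_eq_self, integral_radialMollifier hε, mul_one]
  rw [← h1]
  refine integral_mono_ae (hu.integrable_mul_radialMollifier hm hO hOc hε hball)
    (((integrable_radialMollifier hε).comp_sub_right a).const_mul M) ?_
  filter_upwards [hu.ae_ne_bot hm hO hOc] with z hz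
  rcases le_or_gt ε ‖z - a‖ with h | h
  · simp [radialMollifier_of_le_norm hε h]
  · have hza : z ∈ Metric.closedBall a ε := by simp [dist_eq_norm, h.le]
    exact mul_le_mul_of_nonneg_right (EReal.toReal_le_of_le_coe (hz (hball hza)) (hM z hza))
      (radialMollifier_nonneg _ _)

/-- Upper semicontinuity keeps `u < c` on a small disc, and averages inherit the bound. With
`le_mollified` this gives convergence to `u(a)` where it is finite; the form with a real `c` also
covers `u(a) = -∞`. -/
theorem eventually_mollified_le (hu : IsSubharmonicOn u O) (hm : Measurable u) (hO : IsOpen O)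
    (hOc : IsConnected O) {a : ℂ} (ha : a ∈ O) {c : ℝ} (hc : u a < c) :
    ∀ᶠ ε in nhdsWithin (0 : ℝ) (Set.Ioi 0), mollified u ε a ≤ c := by
  have h1 : ∀ᶠ z in nhds a, u z < c := by
    have := hu.upperSemicontinuousOn a ha c hc
    rwa [hO.nhdsWithin_eq ha] at this
  obtain ⟨t, ht, hsub⟩ := Metric.nhds_basis_closedBall.mem_iff.1
    (Filter.inter_mem h1 (hO.mem_nhds ha))
  filter_upwards [Ioo_mem_nhdsGT ht] with ε hε
  have hs := Metric.closedBall_subset_closedBall (x := a) hε.2.le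
  exact hu.mollified_le hm hO hOc hε.1 (fun z hz => (hsub (hs hz)).2)
    fun z hz => le_of_lt (hsub (hs hz)).1

end IsSubharmonicOn

/-! ### The distributional Laplacian of a subharmonic function is positive -/

/-- Compact support makes the second derivative uniformly continuous; the mean value inequality
applied twice along the segment from `z` to `z + v` turns this into an error uniform in `z`. -/
theorem exists_taylor_two_uniform {φ : ℂ → ℝ} (hφ : ContDiff ℝ ∞ φ) (hc : HasCompactSupport φ)
    {η : ℝ} (hη : 0 < η) : ∃ δ > 0, ∀ v : ℂ, ‖v‖ ≤ δ → ∀ z : ℂ,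
      |φ (z + v) - φ z - fderiv ℝ φ z v - fderiv ℝ (fderiv ℝ φ) z v v / 2| ≤ η * ‖v‖ ^ 2 := by
  have hφ1 : ContDiff ℝ ∞ (fderiv ℝ φ) := hφ.fderiv_right (by simp)
  have hφ2 : Continuous (fderiv ℝ (fderiv ℝ φ)) := hφ1.continuous_fderiv (by simp)
  have huc := (((hc.fderiv ℝ).fderiv ℝ)).uniformContinuous_of_continuous hφ2
  obtain ⟨δ, hδ, hδ'⟩ := (Metric.uniformContinuous_iff (β := ℂ →L[ℝ] ℂ →L[ℝ] ℝ)).1 huc η hη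
  refine ⟨δ / 2, by linarith, fun v hv z => ?_⟩
  have hline : ∀ s : ℝ, HasDerivAt (fun s : ℝ => z + s • v) v s := fun s => by
    simpa using ((hasDerivAt_id s).smul_const v).const_add z
  have hd1 : ∀ s : ℝ, HasDerivAt (fun s : ℝ => fderiv ℝ φ (z + s • v) v)
      (fderiv ℝ (fderiv ℝ φ) (z + s • v) v v) s := fun s => by
    have h1 : HasDerivAt (fun s : ℝ => fderiv ℝ φ (z + s • v))
        (fderiv ℝ (fderiv ℝ φ) (z + s • v) v) s :=
      ((hφ1.differentiable (by simp)) (z + s • v)).hasFDerivAt.comp_hasDerivAt s (hline s)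
    simpa using h1.clm_apply (hasDerivAt_const s v)
  have hd0 : ∀ s : ℝ, HasDerivAt (fun s : ℝ => φ (z + s • v)) (fderiv ℝ φ (z + s • v) v) s :=
    fun s => ((hφ.differentiable (by simp)) (z + s • v)).hasFDerivAt.comp_hasDerivAt s (hline s)
  set D := fderiv ℝ (fderiv ℝ φ) z v v with hD
  have hfirst : ∀ s ∈ Set.Icc (0 : ℝ) 1, ‖fderiv ℝ φ (z + s • v) v - fderiv ℝ φ z v - s * D‖ ≤
      η * ‖v‖ ^ 2 := by
    intro s hs
    have hder : ∀ x ∈ Set.Icc (0 : ℝ) 1, HasDerivWithinAt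
        (fun x : ℝ => fderiv ℝ φ (z + (s * x) • v) v - (s * x) * D)
        ((fderiv ℝ (fderiv ℝ φ) (z + (s * x) • v) v v) * s - s * D) (Set.Icc 0 1) x := by
      intro x _
      have hlin : HasDerivAt (fun x : ℝ => s * x) s x := by
        simpa using (hasDerivAt_id x).const_mul s
      exact (((hd1 (s * x)).comp x hlin).sub (hlin.mul_const D)).hasDerivWithinAt
    have hb := norm_image_sub_le_of_norm_deriv_le_segment_01' hder (C := η * ‖v‖ ^ 2) ?_
    · simpa [sub_right_comm] using hb
    · intro x hx
      have h1 : dist (z + (s * x) • v) z < δ := by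
        rw [dist_eq_norm, add_sub_cancel_left, norm_smul, Real.norm_eq_abs,
          abs_of_nonneg (mul_nonneg hs.1 hx.1)]
        have : s * x ≤ 1 := mul_le_one₀ hs.2 hx.1 hx.2.le
        nlinarith [norm_nonneg v, mul_nonneg hs.1 hx.1]
      have h2 := (dist_eq_norm (fderiv ℝ (fderiv ℝ φ) (z + (s * x) • v))
        (fderiv ℝ (fderiv ℝ φ) z)).symm.trans_le (hδ' h1).le
      have h3 : (fderiv ℝ (fderiv ℝ φ) (z + (s * x) • v) v v) * s - s * D =
          s * ((fderiv ℝ (fderiv ℝ φ) (z + (s * x) • v) - fderiv ℝ (fderiv ℝ φ) z) v v) := by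
        simp [hD]; ring
      rw [h3, norm_mul, Real.norm_eq_abs, abs_of_nonneg hs.1]
      have h4 := ((fderiv ℝ (fderiv ℝ φ) (z + (s * x) • v) - fderiv ℝ (fderiv ℝ φ) z)).le_opNorm₂ v v
      calc _ ≤ 1 * (η * ‖v‖ * ‖v‖) := by
            refine mul_le_mul hs.2 (h4.trans ?_) (norm_nonneg _) one_pos.le
            gcongr
        _ = _ := by ring
  have hder : ∀ x ∈ Set.Icc (0 : ℝ) 1, HasDerivWithinAt
      (fun x : ℝ => φ (z + x • v) - x * fderiv ℝ φ z v - x ^ 2 / 2 * D)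
      (fderiv ℝ φ (z + x • v) v - fderiv ℝ φ z v - x * D) (Set.Icc 0 1) x := by
    intro x _
    have h1 : HasDerivAt (fun x : ℝ => x * fderiv ℝ φ z v) (fderiv ℝ φ z v) x := by
      simpa using (hasDerivAt_id x).mul_const (fderiv ℝ φ z v)
    have h2 : HasDerivAt (fun x : ℝ => x ^ 2 / 2 * D) (x * D) x := by
      have := ((hasDerivAt_pow 2 x).div_const 2).mul_const D
      simpa using this
    exact (((hd0 x).sub h1).sub h2).hasDerivWithinAt
  have hb := norm_image_sub_le_of_norm_deriv_le_segment_01' hder (C := η * ‖v‖ ^ 2)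
    fun x hx => hfirst x ⟨hx.1, hx.2.le⟩
  have e : φ (z + v) - φ z - fderiv ℝ φ z v - D / 2 =
      (φ (z + (1 : ℝ) • v) - 1 * fderiv ℝ φ z v - 1 ^ 2 / 2 * D) -
        (φ (z + (0 : ℝ) • v) - 0 * fderiv ℝ φ z v - 0 ^ 2 / 2 * D) := by
    rw [one_smul, zero_smul, add_zero]; ring
  rw [← Real.norm_eq_abs, e]
  exact hb

/-- The linear and mixed terms integrate to zero over a period, while `cos²` and `sin²` each
contribute `π`; only the trace of `B` survives. -/
theorem integral_circle_quadratic (A : ℂ →L[ℝ] ℝ) (B : ℂ →L[ℝ] ℂ →L[ℝ] ℝ) (t : ℝ) :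
    ∫ θ in Set.Ioc 0 (2 * Real.pi), (A (-circleMap 0 t θ) +
      B (-circleMap 0 t θ) (-circleMap 0 t θ) / 2) =
      Real.pi / 2 * t ^ 2 * (B 1 1 + B Complex.I Complex.I) := by
  have hexp : ∀ θ : ℝ, -circleMap 0 t θ = (-t * Real.cos θ) • (1 : ℂ) + (-t * Real.sin θ) • Complex.I := by
    intro θ
    rw [circleMap, Complex.exp_mul_I, ← Complex.ofReal_cos, ← Complex.ofReal_sin]
    simp
    ring
  have hpt : ∀ θ : ℝ, A (-circleMap 0 t θ) + B (-circleMap 0 t θ) (-circleMap 0 t θ) / 2 =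
      (-t * A 1) * Real.cos θ + ((-t * A Complex.I) * Real.sin θ +
      ((t ^ 2 / 2 * B 1 1) * Real.cos θ ^ 2 + ((t ^ 2 / 2 * B Complex.I Complex.I) * Real.sin θ ^ 2 +
      (t ^ 2 / 2 * (B 1 Complex.I + B Complex.I 1)) * (Real.sin θ * Real.cos θ)))) := by
    intro θ
    rw [hexp]
    simp only [map_add, map_smul, add_apply, smul_apply, smul_eq_mul]
    ring
  simp only [hpt]
  rw [← intervalIntegral.integral_of_le Real.two_pi_pos.le]
  have hi : ∀ g : ℝ → ℝ, Continuous g → IntervalIntegrable g volume 0 (2 * Real.pi) :=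
    fun g hg => hg.intervalIntegrable _ _
  rw [intervalIntegral.integral_add (hi _ (by fun_prop)) (hi _ (by fun_prop)),
    intervalIntegral.integral_add (hi _ (by fun_prop)) (hi _ (by fun_prop)),
    intervalIntegral.integral_add (hi _ (by fun_prop)) (hi _ (by fun_prop)),
    intervalIntegral.integral_add (hi _ (by fun_prop)) (hi _ (by fun_prop))]
  simp only [intervalIntegral.integral_const_mul, integral_cos, integral_sin, integral_cos_sq,
    integral_sin_sq, integral_sin_mul_cos₁]
  simp
  ring

theorem exists_circle_mean_expansion {φ : ℂ → ℝ} (hφ : ContDiff ℝ ∞ φ) (hc : HasCompactSupport φ)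
    {η : ℝ} (hη : 0 < η) : ∃ δ > 0, ∀ t : ℝ, 0 ≤ t → t ≤ δ → ∀ z : ℂ,
      |(∫ θ in Set.Ioc 0 (2 * Real.pi), φ (z - circleMap 0 t θ)) - 2 * Real.pi * φ z -
        Real.pi / 2 * t ^ 2 * Laplacian.laplacian φ z| ≤ 2 * Real.pi * (η * t ^ 2) := by
  obtain ⟨δ, hδ, h⟩ := exists_taylor_two_uniform hφ hc hη
  refine ⟨δ, hδ, fun t ht0 ht z => ?_⟩
  have hlap : Laplacian.laplacian φ z = fderiv ℝ (fderiv ℝ φ) z 1 1 +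
      fderiv ℝ (fderiv ℝ φ) z Complex.I Complex.I := by
    simp [InnerProductSpace.laplacian_eq_iteratedFDeriv_complexPlane, iteratedFDeriv_two_apply]
  have hcm : Continuous (circleMap 0 t) := continuous_circleMap 0 t
  have hi : ∀ g : ℝ → ℝ, Continuous g → IntegrableOn g (Set.Ioc 0 (2 * Real.pi)) :=
    fun g hg => hg.integrableOn_Ioc
  have hφc := hφ.continuous
  have h1 : Continuous fun θ => φ (z - circleMap 0 t θ) := by fun_prop
  have h1' : Continuous fun θ => φ (z - circleMap 0 t θ) - φ z := by fun_prop
  have h2 : Continuous fun θ => (fderiv ℝ φ z (-circleMap 0 t θ) +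
      fderiv ℝ (fderiv ℝ φ) z (-circleMap 0 t θ) (-circleMap 0 t θ) / 2) := by fun_prop
  have hconst : ∫ _ in Set.Ioc 0 (2 * Real.pi), φ z = 2 * Real.pi * φ z := by
    simp [Measure.real, Real.pi_pos.le]
  rw [hlap, ← integral_circle_quadratic (fderiv ℝ φ z), ← hconst,
    ← integral_sub (hi _ h1) (hi _ continuous_const), ← integral_sub (hi _ h1') (hi _ h2),
    ← Real.norm_eq_abs]
  have hb := norm_setIntegral_le_of_norm_le_const (μ := volume) (s := Set.Ioc 0 (2 * Real.pi))
    (C := η * t ^ 2) (f := fun θ => φ (z - circleMap 0 t θ) - φ z - (fderiv ℝ φ z (-circleMap 0 t θ) +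
      fderiv ℝ (fderiv ℝ φ) z (-circleMap 0 t θ) (-circleMap 0 t θ) / 2)) measure_Ioc_lt_top ?_
  · refine hb.trans_eq ?_
    simp [Measure.real, Real.pi_pos.le]
    ring
  · intro θ _
    have hn : ‖-circleMap 0 t θ‖ = t := by simp [abs_of_nonneg ht0]
    have := h (-circleMap 0 t θ) (by rw [hn]; exact ht) z
    rw [hn] at this
    rw [Real.norm_eq_abs, ← sub_sub, sub_eq_add_neg z]
    exact this

/-- The shear `(θ, z) ↦ (θ, z + t e^{iθ})` preserves the product measure, so circle averaging passes
from `F` to `φ`, with integrability carried along. -/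
theorem integral_mul_circle_translate {F φ : ℂ → ℝ} (hF : Integrable F) 
    (hφ : Continuous φ) (hc : HasCompactSupport φ) (t : ℝ) :
    Integrable (fun p : ℝ × ℂ => F (p.2 + circleMap 0 t p.1) * φ p.2)
      ((volume.restrict (Set.Ioc 0 (2 * Real.pi))).prod volume) ∧
    Integrable (fun p : ℝ × ℂ => F p.2 * φ (p.2 - circleMap 0 t p.1))
      ((volume.restrict (Set.Ioc 0 (2 * Real.pi))).prod volume) ∧
    ∫ y, ∫ θ in Set.Ioc 0 (2 * Real.pi), F (y + circleMap 0 t θ) * φ y =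
      ∫ z, ∫ θ in Set.Ioc 0 (2 * Real.pi), F z * φ (z - circleMap 0 t θ) := by
  obtain ⟨C, hC⟩ := hc.exists_bound_of_continuous hφ
  have hcm : Continuous (circleMap 0 t) := continuous_circleMap 0 t
  set ν := (volume : Measure ℝ).restrict (Set.Ioc 0 (2 * Real.pi)) with hν
  have h2 : Integrable (fun p : ℝ × ℂ => F p.2 * φ (p.2 - circleMap 0 t p.1)) (ν.prod volume) :=
    (hF.comp_snd ν).mul_bdd (c := C) (by
      refine Continuous.aestronglyMeasurable ?_
      fun_prop) (Filter.Eventually.of_forall fun p => hC _)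
  have hmp : MeasurePreserving (fun p : ℝ × ℂ => (id p.1, p.2 + circleMap 0 t p.1))
      (ν.prod volume) (ν.prod volume) := by
    refine (MeasurePreserving.id ν).skew_product (g := fun θ z => z + circleMap 0 t θ) ?_ ?_
    · refine Continuous.measurable ?_
      fun_prop
    · exact Filter.Eventually.of_forall fun θ => map_add_right_eq_self volume _
  have h1 : Integrable (fun p : ℝ × ℂ => F (p.2 + circleMap 0 t p.1) * φ p.2) (ν.prod volume) := by
    have := hmp.integrable_comp_of_integrable h2
    simpa [Function.comp_def] using this
  refine ⟨h1, h2, ?_⟩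
  rw [integral_integral_swap (f := fun y θ => F (y + circleMap 0 t θ) * φ y) h1.swap,
    integral_integral_swap (f := fun z θ => F z * φ (z - circleMap 0 t θ)) h2.swap]
  refine integral_congr_ae (Filter.Eventually.of_forall fun θ => ?_)
  have := integral_add_right_eq_self (μ := volume) (fun z => F z * φ (z - circleMap 0 t θ)) (circleMap 0 t θ)
  simpa using this

namespace IsSubharmonicOn

variable {u : ℂ → EReal} {O : Set ℂ}

/-- The submean inequality says that the circle integral of `u` minus `2πu` is nonnegative against
`φ ≥ 0`. Moved onto `φ`, the same difference is `(π/2) t² Δφ` up to an error `2πηt²`, so dividing by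
`(π/2) t²` leaves `∫ u Δφ` up to `4η ∫ |u|`, with `η` arbitrary. -/
theorem integral_mul_laplacian_nonneg (hu : IsSubharmonicOn u O) (hm : Measurable u)
    (hO : IsOpen O) (hOc : IsConnected O) {φ : ℂ → ℝ} (hφ : ContDiff ℝ ∞ φ)
    (hc : HasCompactSupport φ) (hs : tsupport φ ⊆ O) (hpos : ∀ z, 0 ≤ φ z) :
    0 ≤ ∫ z, (u z).toReal * Laplacian.laplacian φ z := by
  obtain ⟨d, hd, hdO⟩ := hc.isCompact.exists_cthickening_subset_open hO hs
  set K := Metric.cthickening d (tsupport φ) with hK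
  have hKc : IsCompact K := hc.isCompact.cthickening
  have hsK : tsupport φ ⊆ K := Metric.self_subset_cthickening _
  set F : ℂ → ℝ := K.indicator fun z => (u z).toReal with hF
  have hFi : Integrable F := (hu.integrableOn hm hO hOc hKc hdO).integrable_indicator hKc.measurableSet
  have hFm : Measurable F := hm.ereal_toReal.indicator hKc.measurableSet
  have hFφ : ∀ z g, (z ∉ K → g = 0) → F z * g = (u z).toReal * g := by
    intro z g hg
    by_cases hz : z ∈ K
    · simp [hF, hz]
    · simp [hg hz]
  have hlapK : ∀ z ∉ K, Laplacian.laplacian φ z = 0 := fun z hz =>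
    laplacian_eq_zero_of_notMem_tsupport fun h => hz (hsK h)
  have hφK : ∀ z ∉ K, φ z = 0 := fun z hz => image_eq_zero_of_notMem_tsupport fun h => hz (hsK h)
  have hlc := continuous_laplacian (by exact_mod_cast contDiff_infty.1 hφ 2)
  have hI1 : ∫ z, (u z).toReal * Laplacian.laplacian φ z = ∫ z, F z * Laplacian.laplacian φ z :=
    integral_congr_ae (Filter.Eventually.of_forall fun z => (hFφ z _ (hlapK z)).symm)
  rw [hI1]
  have hJ : ∀ g : ℂ → ℝ, Continuous g → (∃ C, ∀ z, ‖g z‖ ≤ C) → Integrable fun z => F z * g z :=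
    fun g hg ⟨C, hC⟩ => hFi.mul_bdd hg.aestronglyMeasurable (Filter.Eventually.of_forall hC)
  have hφb : ∃ C, ∀ z, ‖φ z‖ ≤ C := hc.exists_bound_of_continuous hφ.continuous
  have hlb : ∃ C, ∀ z, ‖Laplacian.laplacian φ z‖ ≤ C :=
    (HasCompactSupport.intro hKc hlapK).exists_bound_of_continuous hlc
  have hiφ := hJ φ hφ.continuous hφb
  have hil := hJ _ hlc hlb
  set N := ∫ z, |F z| with hN
  have hN0 : 0 ≤ N := integral_nonneg fun z => abs_nonneg _
  have hmain : ∀ η > 0, -(4 * η * N) ≤ ∫ z, F z * Laplacian.laplacian φ z := by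
    intro η hη
    obtain ⟨δ, hδ, hexp⟩ := exists_circle_mean_expansion hφ hc hη
    -- The bound `δ` makes the expansion valid, and `d` keeps circles about points of the support
    -- inside `K`.
    set t := min δ d with ht
    have ht0 : 0 < t := lt_min hδ hd
    obtain ⟨h1, h2, h3⟩ := integral_mul_circle_translate hFi hφ.continuous hc t
    set A : ℂ → ℝ := fun z => ∫ θ in Set.Ioc 0 (2 * Real.pi), φ (z - circleMap 0 t θ) with hA
    have h3' : ∫ y, ∫ θ in Set.Ioc 0 (2 * Real.pi), F (y + circleMap 0 t θ) * φ y =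
        ∫ z, F z * A z := by
      rw [h3]
      simp only [integral_const_mul, hA]
    have hiA : Integrable fun z => F z * A z := by
      have := h2.integral_prod_right
      simpa only [integral_const_mul, hA] using this
    have hlow : ∫ y, 2 * Real.pi * (F y * φ y) ≤
        ∫ y, ∫ θ in Set.Ioc 0 (2 * Real.pi), F (y + circleMap 0 t θ) * φ y := by
      refine integral_mono_ae (hiφ.const_mul _) h1.integral_prod_right ?_
      filter_upwards [hu.ae_ne_bot hm hO hOc] with y hy
      by_cases hyφ : y ∈ tsupport φ
      · rw [integral_mul_const]
        rw [← mul_assoc]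
        refine mul_le_mul_of_nonneg_right ?_ (hpos y)
        have hball : Metric.closedBall y t ⊆ K :=
          (Metric.closedBall_subset_closedBall (min_le_right _ _)).trans
            (Metric.closedBall_subset_cthickening hyφ d)
        have hmem : ∀ θ, y + circleMap 0 t θ ∈ K := fun θ => by
          rw [← circleMap_eq_add]
          exact hball (circleMap_mem_closedBall y ht0.le θ)
        simp only [hF, Set.indicator_of_mem (hmem _), Set.indicator_of_mem (hsK hyφ)]
        simp only [← circleMap_eq_add]
        exact hu.le_integral_circle hm ht0 (hball.trans hdO) (hy (hs hyφ))
      · simp [image_eq_zero_of_notMem_tsupport hyφ]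
    rw [h3', integral_const_mul] at hlow
    have hiE : Integrable fun z => F z * (A z - 2 * Real.pi * φ z -
        Real.pi / 2 * t ^ 2 * Laplacian.laplacian φ z) := by
      have := (hiA.sub (hiφ.const_mul (2 * Real.pi))).sub (hil.const_mul (Real.pi / 2 * t ^ 2))
      refine this.congr (Filter.Eventually.of_forall fun z => ?_)
      simp only [Pi.sub_apply]
      ring
    have hE : ∫ z, F z * (A z - 2 * Real.pi * φ z - Real.pi / 2 * t ^ 2 * Laplacian.laplacian φ z) ≤
        2 * Real.pi * (η * t ^ 2) * N := by
      rw [hN, ← integral_const_mul]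
      refine integral_mono hiE (hFi.abs.const_mul _) fun z => ?_
      calc _ ≤ |F z * (A z - 2 * Real.pi * φ z - Real.pi / 2 * t ^ 2 * Laplacian.laplacian φ z)| :=
            le_abs_self _
        _ = |A z - 2 * Real.pi * φ z - Real.pi / 2 * t ^ 2 * Laplacian.laplacian φ z| * |F z| := by
            rw [abs_mul, mul_comm]
        _ ≤ _ := mul_le_mul_of_nonneg_right (hexp t ht0.le (min_le_left _ _) z) (abs_nonneg _)
    have hE' : ∫ z, F z * (A z - 2 * Real.pi * φ z - Real.pi / 2 * t ^ 2 * Laplacian.laplacian φ z) =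
        (∫ z, F z * A z) - 2 * Real.pi * (∫ z, F z * φ z) -
          Real.pi / 2 * t ^ 2 * ∫ z, F z * Laplacian.laplacian φ z := by
      have hs1 : Integrable fun z => F z * A z - 2 * Real.pi * (F z * φ z) :=
        hiA.sub (hiφ.const_mul _)
      rw [← integral_const_mul, ← integral_const_mul, ← integral_sub hiA (hiφ.const_mul _),
        ← integral_sub hs1 (hil.const_mul _)]
      refine integral_congr_ae (Filter.Eventually.of_forall fun z => ?_)
      simp only
      ring
    rw [hE'] at hE
    have hp : 0 < Real.pi / 2 * t ^ 2 := by positivity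
    have : Real.pi / 2 * t ^ 2 * -(4 * η * N) ≤
        Real.pi / 2 * t ^ 2 * ∫ z, F z * Laplacian.laplacian φ z := by
      nlinarith
    exact le_of_mul_le_mul_left this hp
  by_contra! hneg
  -- With this `η` the error `4ηN` is at most half of `-∫ F Δφ`, which contradicts negativity; the
  -- `N + 1` covers `N = 0`.
  have h := hmain (-(∫ z, F z * Laplacian.laplacian φ z) / (8 * (N + 1))) (by
    apply div_pos <;> linarith)
  rw [← sub_nonneg] at h
  have h8 : 4 * (-(∫ z, F z * Laplacian.laplacian φ z) / (8 * (N + 1))) * N =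
      -(∫ z, F z * Laplacian.laplacian φ z) * (N / (2 * (N + 1))) := by
    field_simp; ring
  rw [h8] at h
  have h9 : N / (2 * (N + 1)) ≤ 1 / 2 := by
    rw [div_le_div_iff₀ (by positivity) (by norm_num)]
    linarith
  nlinarith

end IsSubharmonicOn

/-! ### Existence of the Riesz measure -/

/-- Extension by zero of a function on a subset. -/
noncomputable def zeroExtend {O : Set ℂ} (g : O → ℝ) : ℂ → ℝ := Function.extend Subtype.val g 0

section ZeroExtend

variable {O : Set ℂ}

theorem zeroExtend_of_mem (g : O → ℝ) {z : ℂ} (hz : z ∈ O) : zeroExtend g z = g ⟨z, hz⟩ :=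
  Subtype.val_injective.extend_apply g 0 ⟨z, hz⟩

theorem zeroExtend_of_notMem (g : O → ℝ) {z : ℂ} (hz : z ∉ O) : zeroExtend g z = 0 :=
  Function.extend_apply' g (0 : ℂ → ℝ) z (by rintro ⟨x, rfl⟩; exact hz x.2)

theorem zeroExtend_add (g h : O → ℝ) : zeroExtend (g + h) = zeroExtend g + zeroExtend h := by
  funext z
  by_cases hz : z ∈ O
  · simp [zeroExtend_of_mem _ hz]
  · simp [zeroExtend_of_notMem _ hz]

theorem zeroExtend_smul (c : ℝ) (g : O → ℝ) : zeroExtend (c • g) = c • zeroExtend g := by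
  funext z
  by_cases hz : z ∈ O
  · simp [zeroExtend_of_mem _ hz]
  · simp [zeroExtend_of_notMem _ hz]

theorem zeroExtend_restrict {φ : ℂ → ℝ} (h : ∀ z ∉ O, φ z = 0) :
    zeroExtend (fun x : O => φ x) = φ := by
  funext z
  by_cases hz : z ∈ O
  · rw [zeroExtend_of_mem _ hz]
  · rw [zeroExtend_of_notMem _ hz, h z hz]

theorem isCompact_image_tsupport {g : O → ℝ} (hg : HasCompactSupport g) :
    IsCompact (Subtype.val '' tsupport g) := hg.isCompact.image continuous_subtype_val

theorem zeroExtend_eq_zero {g : O → ℝ} {z : ℂ} (hz : z ∉ Subtype.val '' tsupport g) :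
    zeroExtend g z = 0 := by
  by_cases hzO : z ∈ O
  · rw [zeroExtend_of_mem _ hzO]
    exact image_eq_zero_of_notMem_tsupport fun h => hz ⟨⟨z, hzO⟩, h, rfl⟩
  · exact zeroExtend_of_notMem _ hzO

theorem tsupport_zeroExtend_subset {g : O → ℝ} (hg : HasCompactSupport g) :
    tsupport (zeroExtend g) ⊆ Subtype.val '' tsupport g :=
  closure_minimal (fun z hz => by
    by_contra hcon
    exact hz (zeroExtend_eq_zero hcon)) (isCompact_image_tsupport hg).isClosed

theorem hasCompactSupport_zeroExtend {g : O → ℝ} (hg : HasCompactSupport g) :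
    HasCompactSupport (zeroExtend g) :=
  HasCompactSupport.intro (isCompact_image_tsupport hg) fun _ hz => zeroExtend_eq_zero hz

theorem tsupport_zeroExtend_subset_self {g : O → ℝ} (hg : HasCompactSupport g) :
    tsupport (zeroExtend g) ⊆ O :=
  (tsupport_zeroExtend_subset hg).trans (by rintro _ ⟨x, _, rfl⟩; exact x.2)

theorem hasCompactSupport_restrict {φ : ℂ → ℝ} (hc : HasCompactSupport φ) (hs : tsupport φ ⊆ O) :
    HasCompactSupport (fun x : O => φ x) := by
  refine HasCompactSupport.intro (K := Subtype.val ⁻¹' tsupport φ) ?_ fun x hx =>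
    image_eq_zero_of_notMem_tsupport hx
  refine Topology.IsInducing.subtypeVal.isCompact_preimage' hc.isCompact ?_
  simpa using hs

end ZeroExtend

/-- A smooth function equal to `1` on a compact set and supported in a given neighbourhood. -/
theorem exists_smooth_cutoff {K O : Set ℂ} (hK : IsCompact K) (hO : IsOpen O) (hKO : K ⊆ O) :
    ∃ χ : ℂ → ℝ, ContDiff ℝ ∞ χ ∧ HasCompactSupport χ ∧ tsupport χ ⊆ O ∧ (∀ z, 0 ≤ χ z) ∧
      ∀ z ∈ K, χ z = 1 := by
  obtain ⟨d, hd, hdO⟩ := hK.exists_cthickening_subset_open hO hKO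
  obtain ⟨χ, hχ, hr, hsupp, h1⟩ := exists_contMDiff_support_eq_eq_one_iff (n := ⊤)
    (modelWithCornersSelf ℝ ℂ) (Metric.isOpen_thickening (δ := d) (E := K)) hK.isClosed
    (Metric.self_subset_thickening hd K)
  have hts : tsupport χ ⊆ Metric.cthickening d K := by
    rw [tsupport, hsupp]
    exact Metric.closure_thickening_subset_cthickening d K
  exact ⟨χ, hχ.contDiff, hK.cthickening.of_isClosed_subset (isClosed_tsupport _) hts,
    hts.trans hdO, fun z => (hr ⟨z, rfl⟩).1, fun z hz => (h1 z).1 hz⟩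

namespace IsSubharmonicOn

variable {u : ℂ → EReal} {O : Set ℂ}

theorem integrable_mul_laplacian (hu : IsSubharmonicOn u O) (hm : Measurable u)
    (hO : IsOpen O) (hOc : IsConnected O) {φ : ℂ → ℝ} (hφ : ContDiff ℝ ∞ φ)
    (hc : HasCompactSupport φ) (hs : tsupport φ ⊆ O) :
    Integrable fun z => (u z).toReal * Laplacian.laplacian φ z :=
  hu.integrable_mul hm hO hOc hc.isCompact hs
    (continuous_laplacian (by exact_mod_cast contDiff_infty.1 hφ 2))
    fun _ hz => laplacian_eq_zero_of_notMem_tsupport hz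

open CompactlySupported in
theorem exists_isRieszMeasure (hu : IsSubharmonicOn u O) (hm : Measurable u)
    (hO : IsOpen O) (hOc : IsConnected O) : ∃ μ : Measure ℂ, IsRieszMeasure u O μ := by
  have : LocallyCompactSpace O := hO.locallyCompactSpace
  let D : Submodule ℝ C_c(O, ℝ) :=
    { carrier := {g | ContDiff ℝ ∞ (zeroExtend g)}
      add_mem' := fun {a b} ha hb => by
        change ContDiff ℝ ∞ (zeroExtend (a + b : O → ℝ))
        rw [zeroExtend_add]
        exact ContDiff.add ha hb
      zero_mem' := by
        change ContDiff ℝ ∞ (zeroExtend (fun _ : O => (fun _ : ℂ => (0 : ℝ)) 0))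
        rw [zeroExtend_restrict (φ := fun _ => 0) fun _ _ => rfl]
        exact contDiff_const
      smul_mem' := fun c a ha => by
        change ContDiff ℝ ∞ (zeroExtend (c • a : O → ℝ))
        rw [zeroExtend_smul]
        exact contDiff_const.smul ha }
  have h2 : ∀ g : D, ContDiff ℝ 2 (zeroExtend (g : C_c(O, ℝ))) := fun g => by
    exact_mod_cast contDiff_infty.1 g.2 2
  have hint : ∀ g : D, Integrable fun z =>
      (u z).toReal * Laplacian.laplacian (zeroExtend (g : C_c(O, ℝ))) z := fun g =>
    hu.integrable_mul_laplacian hm hO hOc g.2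
      (hasCompactSupport_zeroExtend (g : C_c(O, ℝ)).hasCompactSupport)
      (tsupport_zeroExtend_subset_self (g : C_c(O, ℝ)).hasCompactSupport)
  let f : C_c(O, ℝ) →ₗ.[ℝ] ℝ :=
    { domain := D
      toFun :=
        { toFun := fun g => (2 * Real.pi)⁻¹ *
            ∫ z, (u z).toReal * Laplacian.laplacian (zeroExtend (g : C_c(O, ℝ))) z
          map_add' := fun a b => by
            rw [← mul_add, ← integral_add (hint a) (hint b)]
            congr 2
            funext z
            have : zeroExtend ((a + b : D) : C_c(O, ℝ)) =
                zeroExtend (a : C_c(O, ℝ)) + zeroExtend (b : C_c(O, ℝ)) := zeroExtend_add _ _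
            rw [this, (h2 a).contDiffAt.laplacian_add (h2 b).contDiffAt]
            ring
          map_smul' := fun c a => by
            simp only [RingHom.id_apply, smul_eq_mul]
            rw [mul_left_comm, ← integral_const_mul c]
            congr 2
            funext z
            have : zeroExtend ((c • a : D) : C_c(O, ℝ)) = c • zeroExtend (a : C_c(O, ℝ)) :=
              zeroExtend_smul _ _
            rw [this, InnerProductSpace.laplacian_smul c (h2 a).contDiffAt]
            simp only [smul_eq_mul]
            ring } }
  let S : PointedCone ℝ C_c(O, ℝ) :=
    { carrier := {g | 0 ≤ g}
      add_mem' := fun {a b} (ha : 0 ≤ a) (hb : 0 ≤ b) =>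
        show (0 : C_c(O, ℝ)) ≤ a + b from add_nonneg ha hb
      zero_mem' := le_refl (0 : C_c(O, ℝ))
      smul_mem' := fun c a ha x => mul_nonneg c.2 (ha x) }
  -- M. Riesz extension of the positive functional from smooth functions to `C_c(O)`. It requires
  -- each `y` to be made nonnegative by adding a smooth function; a large multiple of a cutoff equal
  -- to `1` on the support of `y` does this.
  obtain ⟨Λ, hΛ, hΛpos⟩ := riesz_extension S f
    (fun g hg => mul_nonneg (by positivity) (hu.integral_mul_laplacian_nonneg hm hO hOc g.2
      (hasCompactSupport_zeroExtend (g : C_c(O, ℝ)).hasCompactSupport)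
      (tsupport_zeroExtend_subset_self (g : C_c(O, ℝ)).hasCompactSupport) fun z => by
        by_cases hz : z ∈ O
        · rw [zeroExtend_of_mem _ hz]; exact hg _
        · rw [zeroExtend_of_notMem _ hz]))
    (fun y => by
      obtain ⟨χ, hχ, hχc, hχO, hχ0, hχ1⟩ := exists_smooth_cutoff
        (isCompact_image_tsupport y.hasCompactSupport) hO (by rintro _ ⟨x, _, rfl⟩; exact x.2)
      obtain ⟨C, hC⟩ := y.hasCompactSupport.exists_bound_of_continuous y.continuous
      have hC' : ∀ x, -y x ≤ |C| := fun x =>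
        (neg_le_abs _).trans ((hC x).trans (le_abs_self C))
      have hφ0 : ∀ z ∉ O, |C| * χ z = 0 := fun z hz => by
        rw [image_eq_zero_of_notMem_tsupport fun h => hz (hχO h), mul_zero]
      refine ⟨⟨⟨⟨fun x : O => |C| * χ x, ?_⟩, ?_⟩, ?_⟩, ?_⟩
      · have := hχ.continuous
        fun_prop
      · exact (hasCompactSupport_restrict hχc hχO).mul_left
      · change ContDiff ℝ ∞ (zeroExtend fun x : O => (fun z => |C| * χ z) x)
        rw [zeroExtend_restrict (φ := fun z => |C| * χ z) hφ0]
        exact contDiff_const.mul hχ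
      · intro x
        change 0 ≤ |C| * χ x + y x
        by_cases hx : x ∈ tsupport y
        · rw [hχ1 x ⟨x, hx, rfl⟩]
          linarith [hC' x]
        · rw [image_eq_zero_of_notMem_tsupport hx, add_zero]
          exact mul_nonneg (abs_nonneg _) (hχ0 _))
  let Λ' : C_c(O, ℝ) →ₚ[ℝ] ℝ := PositiveLinearMap.mk₀ Λ fun x hx => hΛpos x hx
  have hemb : MeasurableEmbedding (Subtype.val : O → ℂ) := .subtype_coe hO.measurableSet
  refine ⟨(RealRMK.rieszMeasure Λ').map Subtype.val, ?_, fun K hK hKO => ?_, fun φ hφ hc hs => ?_⟩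
  · rw [hemb.map_apply]
    simp
  · rw [hemb.map_apply]
    have : IsCompact ((Subtype.val : O → ℂ) ⁻¹' K) :=
      Topology.IsInducing.subtypeVal.isCompact_preimage' hK (by simpa using hKO)
    exact this.measure_lt_top
  · have hφ0 : ∀ z ∉ O, φ z = 0 := fun z hz =>
      image_eq_zero_of_notMem_tsupport fun h => hz (hs h)
    let g : C_c(O, ℝ) := ⟨⟨fun x : O => φ x, hφ.continuous.comp continuous_subtype_val⟩,
      hasCompactSupport_restrict hc hs⟩
    have hg : zeroExtend g = φ := zeroExtend_restrict hφ0
    have hgD : g ∈ D := by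
      change ContDiff ℝ ∞ (zeroExtend g)
      rwa [hg]
    rw [hemb.integral_map]
    have h1 := RealRMK.integral_rieszMeasure Λ' g
    have h3 : Λ' g = f ⟨g, hgD⟩ := hΛ ⟨g, hgD⟩
    rw [h3] at h1
    have h4 : f ⟨g, hgD⟩ = (2 * Real.pi)⁻¹ *
      ∫ z, (u z).toReal * Laplacian.laplacian (zeroExtend g) z := rfl
    rw [h4, hg] at h1
    exact h1

end IsSubharmonicOn

/-! ### Measures are determined by smooth test functions -/

/-- An open `V` in the disc is the support of some smooth `ψ ≥ 0`, and the test functions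
`smoothTransition (n ψ)` converge to its indicator while staying below it. Open sets form a π-system
generating the Borel sets. -/
theorem restrict_ball_eq_of_integral_eq {μ ν : Measure ℂ} {R : ℝ}
    (hμ : μ (Metric.closedBall 0 R) < ⊤) (hν : ν (Metric.closedBall 0 R) < ⊤)
    (h : ∀ φ : ℂ → ℝ, ContDiff ℝ ∞ φ → HasCompactSupport φ → tsupport φ ⊆ Metric.closedBall 0 R →
      ∫ z, φ z ∂μ = ∫ z, φ z ∂ν) :
    μ.restrict (Metric.ball 0 R) = ν.restrict (Metric.ball 0 R) := by
  have hlim : ∀ (κ : Measure ℂ), κ (Metric.closedBall 0 R) < ⊤ → ∀ (V : Set ℂ) (ψ : ℂ → ℝ),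
      V ⊆ Metric.ball 0 R → IsOpen V → ContDiff ℝ ∞ ψ → Function.support ψ = V → (∀ z, 0 ≤ ψ z) →
      Filter.Tendsto (fun n : ℕ => ∫ z, Real.smoothTransition (n * ψ z) ∂κ) Filter.atTop
        (nhds (κ.real V)) := by
    intro κ hκ V ψ hVR hV hψ hsupp hψ0
    rw [← integral_indicator_one hV.measurableSet]
    have hVfin : κ V < ⊤ := (measure_mono (hVR.trans Metric.ball_subset_closedBall)).trans_lt hκ
    refine tendsto_integral_of_dominated_convergence (V.indicator 1)
      (fun n => (Real.smoothTransition.continuous.comp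
        (continuous_const.mul hψ.continuous)).aestronglyMeasurable) ?_ ?_ ?_
    · exact (integrable_indicator_iff hV.measurableSet).2
        (integrableOn_const (hs := hVfin.ne))
    · intro n
      refine Filter.Eventually.of_forall fun z => ?_
      rw [Real.norm_eq_abs, abs_of_nonneg (Real.smoothTransition.nonneg _)]
      by_cases hz : z ∈ V
      · simpa [hz] using Real.smoothTransition.le_one _
      · have : ψ z = 0 := by
          rw [← hsupp] at hz
          simpa using hz
        simp [hz, this]
    · refine Filter.Eventually.of_forall fun z => ?_
      by_cases hz : z ∈ V
      · have hpos : 0 < ψ z := lt_of_le_of_ne (hψ0 z) (by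
          rw [← hsupp] at hz
          exact Ne.symm hz)
        refine tendsto_const_nhds.congr' ?_
        have ht : Filter.Tendsto (fun n : ℕ => (n : ℝ) * ψ z) Filter.atTop Filter.atTop :=
          tendsto_natCast_atTop_atTop.atTop_mul_const hpos
        filter_upwards [ht.eventually_ge_atTop 1] with n hn
        rw [Real.smoothTransition.one_of_one_le hn]
        simp [hz]
      · have : ψ z = 0 := by
          rw [← hsupp] at hz
          simpa using hz
        simp [hz, this]
  have hfin : ∀ κ : Measure ℂ, κ (Metric.closedBall 0 R) < ⊤ →
      κ (Metric.ball 0 R) < ⊤ := fun κ hκ =>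
    (measure_mono Metric.ball_subset_closedBall).trans_lt hκ
  have key : ∀ V ⊆ Metric.ball (0 : ℂ) R, IsOpen V → μ V = ν V := by
    intro V hVR hV
    obtain ⟨ψ, hsupp, hψ, hr⟩ := hV.exists_contDiff_support_eq (n := ⊤)
    have hψ0 : ∀ z, 0 ≤ ψ z := fun z => (hr ⟨z, rfl⟩).1
    have heq : ∀ n : ℕ, ∫ z, Real.smoothTransition (n * ψ z) ∂μ =
        ∫ z, Real.smoothTransition (n * ψ z) ∂ν := by
      intro n
      have hsub : Function.support (fun z => Real.smoothTransition (n * ψ z)) ⊆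
          Metric.closedBall 0 R := by
        intro z hz
        have : z ∈ V := by
          rw [← hsupp]
          intro h0
          exact hz (by simp [h0])
        exact Metric.ball_subset_closedBall (hVR this)
      have hts := closure_minimal hsub Metric.isClosed_closedBall
      exact h _ (Real.smoothTransition.contDiff.comp (contDiff_const.mul hψ))
        ((isCompact_closedBall 0 R).of_isClosed_subset (isClosed_tsupport _) hts) hts
    have h1 := hlim μ hμ V ψ hVR hV hψ hsupp hψ0
    have h2 := hlim ν hν V ψ hVR hV hψ hsupp hψ0
    simp only [heq] at h1
    have h3 := tendsto_nhds_unique h1 h2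
    exact (ENNReal.toReal_eq_toReal_iff' ((measure_mono hVR).trans_lt (hfin μ hμ)).ne
      ((measure_mono hVR).trans_lt (hfin ν hν)).ne).1 h3
  have : IsFiniteMeasure (μ.restrict (Metric.ball 0 R)) := ⟨by simpa using hfin μ hμ⟩
  refine ext_of_generate_finite {s : Set ℂ | IsOpen s} 
    BorelSpace.measurable_eq isPiSystem_isOpen (fun s (hs : IsOpen s) => ?_) ?_
  · rw [Measure.restrict_apply (IsOpen.measurableSet hs), Measure.restrict_apply (IsOpen.measurableSet hs)]
    exact key _ Set.inter_subset_right (IsOpen.inter hs Metric.isOpen_ball)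
  · rw [Measure.restrict_apply_univ, Measure.restrict_apply_univ]
    exact key _ subset_rfl Metric.isOpen_ball

/-! ### The Poisson measure of a disc and its logarithmic potential -/

/-- Normalised arc length on the circle of radius `R` about `0`. -/
noncomputable def circleProb (R : ℝ) : Measure ℂ :=
  ENNReal.ofReal (2 * Real.pi)⁻¹ •
    (volume.restrict (Set.Ioc 0 (2 * Real.pi))).map (circleMap 0 R)

/-- Harmonic measure of the disc of radius `R` about `0` at the point `w`. -/
noncomputable def poissonMeasure (R : ℝ) (w : ℂ) : Measure ℂ :=
  (circleProb R).withDensity fun ζ => ENNReal.ofReal (poissonKernel 0 w ζ)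

theorem lintegral_circleProb {g : ℂ → ℝ≥0∞} (hg : Measurable g) (R : ℝ) :
    ∫⁻ ζ, g ζ ∂(circleProb R) = ENNReal.ofReal (2 * Real.pi)⁻¹ *
      ∫⁻ θ in Set.Ioc 0 (2 * Real.pi), g (circleMap 0 R θ) := by
  rw [circleProb, lintegral_smul_measure, lintegral_map hg (continuous_circleMap 0 R).measurable,
    smul_eq_mul]

theorem integral_circleProb {g : ℂ → ℝ} (hg : Measurable g) (R : ℝ) :
    ∫ ζ, g ζ ∂(circleProb R) = Real.circleAverage g 0 R := by
  rw [circleProb, integral_smul_measure,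
    integral_map (continuous_circleMap 0 R).measurable.aemeasurable hg.aestronglyMeasurable,
    Real.circleAverage, intervalIntegral.integral_of_le Real.two_pi_pos.le,
    ENNReal.toReal_ofReal (by positivity)]

theorem integrable_circleProb_iff {g : ℂ → ℝ} (hg : Measurable g) (R : ℝ) :
    Integrable g (circleProb R) ↔
      IntegrableOn (fun θ => g (circleMap 0 R θ)) (Set.Ioc 0 (2 * Real.pi)) := by
  rw [circleProb, integrable_smul_measure (by simp [Real.pi_pos]) ENNReal.ofReal_ne_top,
    integrable_map_measure hg.aestronglyMeasurable (continuous_circleMap 0 R).measurable.aemeasurable]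
  rfl

instance (R : ℝ) : IsProbabilityMeasure (circleProb R) := ⟨by
  rw [circleProb, Measure.smul_apply, Measure.map_apply (continuous_circleMap 0 R).measurable .univ,
    Set.preimage_univ, Measure.restrict_apply_univ, volume_Ioc_two_pi, smul_eq_mul,
    ← ENNReal.ofReal_mul (by positivity), inv_mul_cancel₀ Real.two_pi_pos.ne', ENNReal.ofReal_one]⟩

theorem ae_circleProb_norm_eq {R : ℝ} (hR : 0 < R) : ∀ᵐ ζ ∂(circleProb R), ‖ζ‖ = R := by
  refine Measure.ae_smul_measure ?_ _
  rw [ae_map_iff (continuous_circleMap 0 R).measurable.aemeasurable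
    (measurableSet_eq_fun measurable_norm measurable_const)]
  exact Filter.Eventually.of_forall fun θ => by simp [abs_of_pos hR]

theorem ae_circleProb_ne {R : ℝ} (hR : 0 < R) (z : ℂ) : ∀ᵐ ζ ∂(circleProb R), ζ ≠ z := by
  refine Measure.ae_smul_measure ?_ _
  refine (ae_map_iff (p := fun ζ => ζ ≠ z) (continuous_circleMap 0 R).measurable.aemeasurable
    (measurableSet_singleton z).compl).2 ?_
  refine ae_restrict_of_ae ?_
  have h := ((Set.countable_singleton z).preimage_circleMap 0 hR.ne').measure_zero volume
  rw [ae_iff]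
  simp only [ne_eq, not_not]
  exact h

theorem measurable_poissonKernel (w : ℂ) : Measurable (poissonKernel 0 w) := by
  unfold poissonKernel
  fun_prop

theorem poissonKernel_le {R : ℝ} {w ζ : ℂ} (hw : ‖w‖ < R) (hζ : ‖ζ‖ = R) :
    poissonKernel 0 w ζ ≤ (R + ‖w‖) / (R - ‖w‖) := by
  have := re_herglotzRieszKernel_le (c := 0) (z := ζ) (w := w) (R := R) (by simpa using hζ)
    (by simpa using hw)
  rw [poissonKernel_eq_re_herglotzRieszKernel]
  simpa [herglotzRieszKernel] using this

theorem le_poissonKernel {R : ℝ} {w ζ : ℂ} (hw : ‖w‖ < R) (hζ : ‖ζ‖ = R) :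
    (R - ‖w‖) / (R + ‖w‖) ≤ poissonKernel 0 w ζ := by
  have := le_re_herglotzRieszKernel (c := 0) (z := ζ) (w := w) (R := R) (by simpa using hζ)
    (by simpa using hw)
  rw [poissonKernel_eq_re_herglotzRieszKernel]
  simpa [herglotzRieszKernel] using this

theorem poissonKernel_nonneg {R : ℝ} {w ζ : ℂ} (hw : ‖w‖ < R) (hζ : ‖ζ‖ = R) :
    0 ≤ poissonKernel 0 w ζ :=
  (div_nonneg (by linarith) (by linarith [norm_nonneg w])).trans (le_poissonKernel hw hζ)

theorem poissonMeasure_le {R : ℝ} {w : ℂ} (hw : ‖w‖ < R) :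
    poissonMeasure R w ≤ ENNReal.ofReal ((R + ‖w‖) / (R - ‖w‖)) • circleProb R := by
  rw [poissonMeasure, ← withDensity_const]
  refine withDensity_mono ?_
  filter_upwards [ae_circleProb_norm_eq ((norm_nonneg w).trans_lt hw)] with ζ hζ
  exact ENNReal.ofReal_le_ofReal (poissonKernel_le hw hζ)

/-- The lower Harnack bound carries null sets and integrability from harmonic measure back to arc
length, and so from one pole to every other. -/
theorem le_poissonMeasure {R : ℝ} {w : ℂ} (hw : ‖w‖ < R) :
    ENNReal.ofReal ((R - ‖w‖) / (R + ‖w‖)) • circleProb R ≤ poissonMeasure R w := by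
  rw [poissonMeasure, ← withDensity_const]
  refine withDensity_mono ?_
  filter_upwards [ae_circleProb_norm_eq ((norm_nonneg w).trans_lt hw)] with ζ hζ
  exact ENNReal.ofReal_le_ofReal (le_poissonKernel hw hζ)

theorem poissonMeasure_absolutelyContinuous (R : ℝ) (w : ℂ) :
    poissonMeasure R w ≪ circleProb R := withDensity_absolutelyContinuous _ _

theorem circleProb_absolutelyContinuous {R : ℝ} {w : ℂ} (hw : ‖w‖ < R) :
    circleProb R ≪ poissonMeasure R w := by
  refine Measure.AbsolutelyContinuous.trans ?_ (le_poissonMeasure hw).absolutelyContinuous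
  refine Measure.absolutelyContinuous_smul ?_
  have : 0 < (R - ‖w‖) / (R + ‖w‖) :=
    div_pos (by linarith) (by linarith [norm_nonneg w])
  simpa using this

theorem isFiniteMeasure_poissonMeasure {R : ℝ} {w : ℂ} (hw : ‖w‖ < R) :
    IsFiniteMeasure (poissonMeasure R w) :=
  ⟨((poissonMeasure_le hw) Set.univ).trans_lt (by
    rw [Measure.smul_apply, measure_univ, smul_eq_mul, mul_one]
    exact ENNReal.ofReal_lt_top)⟩

theorem ae_poissonMeasure_norm_eq {R : ℝ} {w : ℂ} (hw : ‖w‖ < R) :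
    ∀ᵐ ζ ∂(poissonMeasure R w), ‖ζ‖ = R :=
  (poissonMeasure_absolutelyContinuous R w).ae_le
    (ae_circleProb_norm_eq ((norm_nonneg w).trans_lt hw))

theorem integrable_poissonMeasure {R : ℝ} {w : ℂ} (hw : ‖w‖ < R) {g : ℂ → ℝ}
    (hg : Integrable g (circleProb R)) : Integrable g (poissonMeasure R w) :=
  (hg.smul_measure ENNReal.ofReal_ne_top).mono_measure (poissonMeasure_le hw)

theorem integrable_circleProb_of_poissonMeasure {R : ℝ} {w : ℂ} (hw : ‖w‖ < R) {g : ℂ → ℝ}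
    (hg : Integrable g (poissonMeasure R w)) : Integrable g (circleProb R) := by
  have h := hg.mono_measure (le_poissonMeasure hw)
  have : 0 < (R - ‖w‖) / (R + ‖w‖) :=
    div_pos (by linarith) (by linarith [norm_nonneg w])
  rwa [integrable_smul_measure (by simpa using this) ENNReal.ofReal_ne_top] at h

theorem integral_poissonMeasure {R : ℝ} {w : ℂ} (hw : ‖w‖ < R) {g : ℂ → ℝ} (hg : Measurable g) :
    ∫ ζ, g ζ ∂(poissonMeasure R w) = Real.circleAverage (poissonKernel 0 w • g) 0 R := by
  rw [show poissonKernel 0 w • g = poissonKernel 0 w * g from rfl,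
    ← integral_circleProb ((measurable_poissonKernel w).mul hg), poissonMeasure,
    integral_withDensity_eq_integral_toReal_smul (measurable_poissonKernel w).ennreal_ofReal
      (Filter.Eventually.of_forall fun _ => ENNReal.ofReal_lt_top)]
  refine integral_congr_ae ?_
  filter_upwards [ae_circleProb_norm_eq ((norm_nonneg w).trans_lt hw)] with ζ hζ
  rw [ENNReal.toReal_ofReal (poissonKernel_nonneg hw hζ)]
  rfl

theorem integral_poissonMeasure_of_harmonic {R : ℝ} {w : ℂ} (hw : ‖w‖ < R) {g : ℂ → ℝ}
    (hg : Measurable g)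
    (hh : InnerProductSpace.HarmonicOnNhd g (Metric.closedBall 0 R)) :
    ∫ ζ, g ζ ∂(poissonMeasure R w) = g w := by
  rw [integral_poissonMeasure hw hg]
  exact hh.circleAverage_poissonKernel_smul (by simpa using hw)

theorem isProbabilityMeasure_poissonMeasure {R : ℝ} {w : ℂ} (hw : ‖w‖ < R) :
    IsProbabilityMeasure (poissonMeasure R w) := by
  have := isFiniteMeasure_poissonMeasure hw
  have h := integral_poissonMeasure_of_harmonic hw (g := fun _ => (1 : ℝ)) measurable_const
    (fun z _ => InnerProductSpace.harmonicAt_const _)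
  refine ⟨?_⟩
  rw [integral_const, smul_eq_mul, mul_one] at h
  rw [← ENNReal.toReal_eq_one_iff]
  exact h

theorem measurable_log_norm_sub (z : ℂ) : Measurable fun ζ : ℂ => Real.log ‖z - ζ‖ := by
  fun_prop

theorem integrable_log_norm_sub_circleProb (R : ℝ) (z : ℂ) :
    Integrable (fun ζ => Real.log ‖z - ζ‖) (circleProb R) := by
  rw [integrable_circleProb_iff (measurable_log_norm_sub z)]
  have h := circleIntegrable_log_norm_sub_const (a := z) (c := 0) R
  rw [CircleIntegrable, intervalIntegrable_iff_integrableOn_Ioc_of_le Real.two_pi_pos.le] at h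
  simpa only [norm_sub_rev z] using h

theorem integral_log_norm_sub_circleProb {R : ℝ} (hR : 0 < R) (z : ℂ) :
    ∫ ζ, Real.log ‖z - ζ‖ ∂(circleProb R) = Real.log R + Real.posLog (R⁻¹ * ‖z‖) := by
  rw [integral_circleProb (measurable_log_norm_sub z)]
  have h := circleAverage_log_norm_sub_const_eq_log_radius_add_posLog (a := z) (c := 0) hR.ne'
  simpa only [norm_sub_rev z, zero_sub, norm_neg, sub_zero] using h

theorem integral_log_norm_sub_poissonMeasure_of_gt {R : ℝ} {w z : ℂ} (hw : ‖w‖ < R)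
    (hz : R < ‖z‖) : ∫ ζ, Real.log ‖z - ζ‖ ∂(poissonMeasure R w) = Real.log ‖z - w‖ := by
  refine integral_poissonMeasure_of_harmonic hw (measurable_log_norm_sub z) fun ζ hζ => ?_
  refine AnalyticAt.harmonicAt_log_norm (by fun_prop) ?_
  rw [sub_ne_zero]
  rintro rfl
  simp at hζ
  linarith

/-- This identity serves twice: on the circle the last term vanishes, which gives the reflection
formula, and inside the disc it is positive, which gives the sign of the Green function. -/
theorem norm_sq_sub_conj_mul (R : ℝ) (z w : ℂ) :
    ‖(R : ℂ) ^ 2 - (starRingEnd ℂ) z * w‖ ^ 2 =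
      R ^ 2 * ‖z - w‖ ^ 2 + (R ^ 2 - ‖z‖ ^ 2) * (R ^ 2 - ‖w‖ ^ 2) := by
  simp only [Complex.sq_norm, Complex.normSq_apply]
  simp [pow_two]
  ring

theorem norm_sq_sub_conj_mul_of_norm_eq {R : ℝ} (hR : 0 < R) {z ζ : ℂ} (hζ : ‖ζ‖ = R) :
    ‖(R : ℂ) ^ 2 - (starRingEnd ℂ) z * ζ‖ = R * ‖z - ζ‖ := by
  have h := norm_sq_sub_conj_mul R z ζ
  rw [hζ, sub_self, mul_zero, add_zero, ← mul_pow] at h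
  exact (pow_left_inj₀ (norm_nonneg _) (by positivity) two_ne_zero).1 h

theorem norm_sq_sub_conj_mul_pos {R : ℝ} {z w : ℂ} (hz : ‖z‖ < R) (hw : ‖w‖ ≤ R) :
    0 < ‖(R : ℂ) ^ 2 - (starRingEnd ℂ) z * w‖ := by
  have hR : 0 < R := (norm_nonneg z).trans_lt hz
  have h1 : ‖(starRingEnd ℂ) z * w‖ < R ^ 2 := by
    rw [norm_mul, RCLike.norm_conj]
    nlinarith [norm_nonneg z, norm_nonneg w]
  have h2 := norm_sub_norm_le ((R : ℂ) ^ 2) ((starRingEnd ℂ) z * w)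
  rw [norm_pow, Complex.norm_real, Real.norm_eq_abs, sq_abs] at h2
  linarith

/-- On the circle `log |z - ζ|` equals `log |R² - z̄ζ| - log R`, and the latter is harmonic near the
closed disc because its zero is the reflection of `z`. -/
theorem integral_log_norm_sub_poissonMeasure_of_lt {R : ℝ} {w z : ℂ} (hw : ‖w‖ < R)
    (hz : ‖z‖ < R) : ∫ ζ, Real.log ‖z - ζ‖ ∂(poissonMeasure R w) =
      Real.log ‖(R : ℂ) ^ 2 - (starRingEnd ℂ) z * w‖ - Real.log R := by
  have hR : 0 < R := (norm_nonneg z).trans_lt hz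
  have := isProbabilityMeasure_poissonMeasure hw
  have hm : Measurable fun ζ : ℂ => Real.log ‖(R : ℂ) ^ 2 - (starRingEnd ℂ) z * ζ‖ := by fun_prop
  have h := integral_poissonMeasure_of_harmonic hw hm fun ζ hζ => by
    refine AnalyticAt.harmonicAt_log_norm (by fun_prop) ?_
    rw [← norm_pos_iff]
    exact norm_sq_sub_conj_mul_pos hz (by simpa using hζ)
  have hi : Integrable (fun ζ => Real.log ‖z - ζ‖) (poissonMeasure R w) :=
    integrable_poissonMeasure hw (integrable_log_norm_sub_circleProb R z)
  have h2 : ∫ ζ, Real.log ‖(R : ℂ) ^ 2 - (starRingEnd ℂ) z * ζ‖ ∂(poissonMeasure R w) =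
      ∫ ζ, (Real.log R + Real.log ‖z - ζ‖) ∂(poissonMeasure R w) := by
    refine integral_congr_ae ?_
    filter_upwards [ae_poissonMeasure_norm_eq hw] with ζ hζ
    have hne : ‖z - ζ‖ ≠ 0 := by
      rw [norm_ne_zero_iff, sub_ne_zero]
      rintro rfl
      linarith
    rw [norm_sq_sub_conj_mul_of_norm_eq hR hζ, Real.log_mul hR.ne' hne]
  rw [h, integral_add (integrable_const _) hi] at h2
  simp at h2
  linarith

/-- Push `z` radially outwards to `(1+s)z`: its distance to every point of the circle does not
decrease, the formula for exterior points applies, and `s → 0`. -/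
theorem integral_log_norm_sub_poissonMeasure_le_of_eq {R : ℝ} {w z : ℂ} (hw : ‖w‖ < R)
    (hz : ‖z‖ = R) : ∫ ζ, Real.log ‖z - ζ‖ ∂(poissonMeasure R w) ≤ Real.log ‖z - w‖ := by
  have hR : 0 < R := (norm_nonneg w).trans_lt hw
  have := isProbabilityMeasure_poissonMeasure hw
  have hzw : z - w ≠ 0 := by
    rw [sub_ne_zero]
    rintro rfl
    linarith
  have hcont : Filter.Tendsto (fun s : ℝ => Real.log ‖(1 + s) • z - w‖)
      (nhdsWithin 0 (Set.Ioi 0)) (nhds (Real.log ‖z - w‖)) := by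
    have h1 : ContinuousAt (fun s : ℝ => Real.log ‖(1 + s) • z - w‖) 0 := by
      refine ContinuousAt.log (by fun_prop) ?_
      simpa using hzw
    have := h1.tendsto
    simp only [add_zero, one_smul] at this
    exact this.mono_left nhdsWithin_le_nhds
  refine ge_of_tendsto hcont ?_
  filter_upwards [self_mem_nhdsWithin] with s (hs : 0 < s)
  have hn : ‖(1 + s) • z‖ = (1 + s) * R := by
    rw [norm_smul, hz, Real.norm_eq_abs, abs_of_pos (by linarith)]
  have hgt : R < ‖(1 + s) • z‖ := by
    rw [hn]; nlinarith
  rw [← integral_log_norm_sub_poissonMeasure_of_gt hw hgt]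
  refine integral_mono_ae
    (integrable_poissonMeasure hw (integrable_log_norm_sub_circleProb R z))
    (integrable_poissonMeasure hw (integrable_log_norm_sub_circleProb R _)) ?_
  filter_upwards [ae_poissonMeasure_norm_eq hw,
    (poissonMeasure_absolutelyContinuous R w).ae_le (ae_circleProb_ne hR z)] with ζ hζ hζz
  have hle : ‖z - ζ‖ ≤ ‖(1 + s) • z - ζ‖ := by
    refine le_of_sq_le_sq ?_ (norm_nonneg _)
    rw [norm_sub_sq_real, norm_sub_sq_real, hn, hz, hζ, real_inner_smul_left]
    have := real_inner_le_norm z ζ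
    rw [hz, hζ] at this
    nlinarith
  exact Real.log_le_log (norm_pos_iff.2 (sub_ne_zero.2 hζz.symm)) hle

/-! ### The regularised Green function of a disc -/

/-- The Green function of the disc of radius `R` about `0` with pole `w`, smoothed at scale `ε`. -/
noncomputable def smoothGreen (R ε : ℝ) (w z : ℂ) : ℝ :=
  (∫ ζ, smoothLog ε (z - ζ) ∂(poissonMeasure R w)) - smoothLog ε (z - w)

/-- The Green function of the disc of radius `R` about `0` with pole `w`, on that disc. -/
noncomputable def greenFn (R : ℝ) (w z : ℂ) : ℝ :=
  Real.log ‖(R : ℂ) ^ 2 - (starRingEnd ℂ) z * w‖ - Real.log R - Real.log ‖z - w‖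

/-- The Green function with values in `[0, ∞]`, infinite at the pole. -/
noncomputable def greenENN (R : ℝ) (w z : ℂ) : ℝ≥0∞ :=
  if z = w then ⊤ else ENNReal.ofReal (greenFn R w z)

/-- The loss of the smoothing at scale `ε` in the logarithmic potential of harmonic measure. -/
noncomputable def smoothingError (R ε : ℝ) (w z : ℂ) : ℝ :=
  ∫ ζ, Real.posLog (ε / ‖z - ζ‖) ∂(poissonMeasure R w)

section Green

variable {R : ℝ} {w : ℂ}

theorem ae_poissonMeasure_norm_le (hw : ‖w‖ < R) : ∀ᵐ ζ ∂(poissonMeasure R w), ‖ζ‖ ≤ R := by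
  filter_upwards [ae_poissonMeasure_norm_eq hw] with ζ hζ using hζ.le

theorem contDiff_smoothGreen (hw : ‖w‖ < R) (ε : ℝ) : ContDiff ℝ ∞ (smoothGreen R ε w) := by
  have := isFiniteMeasure_poissonMeasure hw
  exact (contDiff_integral_comp_sub (ae_poissonMeasure_norm_le hw) (contDiff_smoothLog ε)).sub
    ((contDiff_smoothLog ε).comp (contDiff_id.sub contDiff_const))

theorem laplacian_comp_sub (g : ℂ → ℝ) (a z : ℂ) :
    Laplacian.laplacian (fun z => g (z - a)) z = Laplacian.laplacian g (z - a) := by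
  simp only [InnerProductSpace.laplacian_eq_iteratedFDeriv_complexPlane]
  rw [iteratedFDeriv_comp_sub]

theorem laplacian_smoothGreen (hw : ‖w‖ < R) {ε : ℝ} (hε : 0 < ε) (z : ℂ) :
    Laplacian.laplacian (smoothGreen R ε w) z =
      2 * Real.pi * ((∫ ζ, radialMollifier ε (z - ζ) ∂(poissonMeasure R w)) -
        radialMollifier ε (z - w)) := by
  have := isFiniteMeasure_poissonMeasure hw
  have h1 : ContDiff ℝ ∞ (fun z => ∫ ζ, smoothLog ε (z - ζ) ∂(poissonMeasure R w)) :=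
    contDiff_integral_comp_sub (ae_poissonMeasure_norm_le hw) (contDiff_smoothLog ε)
  have h2 : ContDiff ℝ ∞ (fun z => smoothLog ε (z - w)) :=
    (contDiff_smoothLog ε).comp (contDiff_id.sub contDiff_const)
  have h1' : ContDiff ℝ 2 (fun z => ∫ ζ, smoothLog ε (z - ζ) ∂(poissonMeasure R w)) := by
    exact_mod_cast contDiff_infty.1 h1 2
  have h2' : ContDiff ℝ 2 (fun z => smoothLog ε (z - w)) := by
    exact_mod_cast contDiff_infty.1 h2 2
  rw [show smoothGreen R ε w = (fun z => ∫ ζ, smoothLog ε (z - ζ) ∂(poissonMeasure R w)) -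
    fun z => smoothLog ε (z - w) from rfl, h1'.contDiffAt.laplacian_sub h2'.contDiffAt,
    laplacian_integral_comp_sub (ae_poissonMeasure_norm_le hw) (contDiff_smoothLog ε),
    laplacian_comp_sub]
  simp only [laplacian_smoothLog hε, integral_const_mul]
  ring

theorem smoothGreen_eq_of_le (hw : ‖w‖ < R) {ε : ℝ} (hε : 0 < ε) {z : ℂ}
    (h1 : ∀ ζ : ℂ, ‖ζ‖ = R → ε ≤ ‖z - ζ‖) (h2 : ε ≤ ‖z - w‖) :
    smoothGreen R ε w z =
      (∫ ζ, Real.log ‖z - ζ‖ ∂(poissonMeasure R w)) - Real.log ‖z - w‖ := by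
  rw [smoothGreen, smoothLog_of_le_norm hε h2]
  congr 1
  refine integral_congr_ae ?_
  filter_upwards [ae_poissonMeasure_norm_eq hw] with ζ hζ
  exact smoothLog_of_le_norm hε (h1 ζ hζ)

/-- Harmonic measure has the same exterior logarithmic potential as the point mass at `w`, and out
here the smoothing is inactive. This is what makes the smoothed Green function a test function. -/
theorem smoothGreen_eq_zero (hw : ‖w‖ < R) {ε : ℝ} (hε : 0 < ε) {z : ℂ} (hz : R + ε < ‖z‖) :
    smoothGreen R ε w z = 0 := by
  rw [smoothGreen_eq_of_le hw hε, integral_log_norm_sub_poissonMeasure_of_gt hw (by linarith),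
    sub_self]
  · intro ζ hζ
    linarith [norm_sub_norm_le z ζ]
  · linarith [norm_sub_norm_le z w]

theorem tsupport_smoothGreen_subset (hw : ‖w‖ < R) {ε : ℝ} (hε : 0 < ε) :
    tsupport (smoothGreen R ε w) ⊆ Metric.closedBall 0 (R + ε) :=
  closure_minimal (fun z hz => by
    by_contra hcon
    exact hz (smoothGreen_eq_zero hw hε (by simpa using hcon))) Metric.isClosed_closedBall

theorem hasCompactSupport_smoothGreen (hw : ‖w‖ < R) {ε : ℝ} (hε : 0 < ε) :
    HasCompactSupport (smoothGreen R ε w) :=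
  (isCompact_closedBall 0 (R + ε)).of_isClosed_subset (isClosed_tsupport _)
    (tsupport_smoothGreen_subset hw hε)

theorem smoothGreen_eq_greenFn (hw : ‖w‖ < R) {ε : ℝ} (hε : 0 < ε) {z : ℂ}
    (hz : ‖z‖ + ε ≤ R) (hzw : ε ≤ ‖z - w‖) : smoothGreen R ε w z = greenFn R w z := by
  rw [smoothGreen_eq_of_le hw hε _ hzw, integral_log_norm_sub_poissonMeasure_of_lt hw (by linarith),
    greenFn]
  intro ζ hζ
  have := norm_sub_norm_le ζ z
  rw [norm_sub_rev] at this
  linarith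

theorem greenFn_nonneg (hw : ‖w‖ < R) {z : ℂ} (hz : ‖z‖ < R) (hzw : z ≠ w) :
    0 ≤ greenFn R w z := by
  have hR : 0 < R := (norm_nonneg w).trans_lt hw
  have hpos : 0 < ‖z - w‖ := norm_pos_iff.2 (sub_ne_zero.2 hzw)
  have h1 : R * ‖z - w‖ ≤ ‖(R : ℂ) ^ 2 - (starRingEnd ℂ) z * w‖ := by
    refine le_of_sq_le_sq ?_ (norm_nonneg _)
    rw [norm_sq_sub_conj_mul, mul_pow]
    have h2 : 0 ≤ R ^ 2 - ‖z‖ ^ 2 := by nlinarith [norm_nonneg z]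
    have h3 : 0 ≤ R ^ 2 - ‖w‖ ^ 2 := by nlinarith [norm_nonneg w]
    nlinarith [mul_nonneg h2 h3]
  have h4 := Real.log_le_log (by positivity) h1
  rw [Real.log_mul hR.ne' hpos.ne'] at h4
  rw [greenFn]
  linarith

theorem integrable_smoothLog_poissonMeasure (hw : ‖w‖ < R) (ε : ℝ) (z : ℂ) :
    Integrable (fun ζ => smoothLog ε (z - ζ)) (poissonMeasure R w) := by
  have := isFiniteMeasure_poissonMeasure hw
  exact integrable_comp_sub (contDiff_smoothLog ε).continuous (ae_poissonMeasure_norm_le hw) z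

theorem integrable_log_poissonMeasure (hw : ‖w‖ < R) (z : ℂ) :
    Integrable (fun ζ => Real.log ‖z - ζ‖) (poissonMeasure R w) :=
  integrable_poissonMeasure hw (integrable_log_norm_sub_circleProb R z)

/-- For `c = ε` this gives nonnegativity near the pole; for fixed `c` the bound tends to `+∞` as `ε
→ 0`, as the pole of the Green function demands. -/
theorem log_sub_le_smoothGreen (hw : ‖w‖ < R) {ε : ℝ} (hε : 0 < ε) {z : ℂ} {c : ℝ} (hc : ε ≤ c)
    (h1 : ∀ ζ : ℂ, ‖ζ‖ = R → c ≤ ‖z - ζ‖) (h2 : ‖z - w‖ ≤ ε) :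
    Real.log c - Real.log ε ≤ smoothGreen R ε w z := by
  have := isProbabilityMeasure_poissonMeasure hw
  have h3 : Real.log c ≤ ∫ ζ, smoothLog ε (z - ζ) ∂(poissonMeasure R w) := by
    have h4 : ∫ _, Real.log c ∂(poissonMeasure R w) = Real.log c := by simp
    rw [← h4]
    refine integral_mono_ae (integrable_const _) (integrable_smoothLog_poissonMeasure hw ε z) ?_
    filter_upwards [ae_poissonMeasure_norm_eq hw] with ζ hζ
    rw [smoothLog_of_le_norm hε (hc.trans (h1 ζ hζ))]
    exact Real.log_le_log (hε.trans_le hc) (h1 ζ hζ)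
  have h5 := smoothLog_le_log hε h2
  rw [smoothGreen]
  linarith

theorem smoothGreen_nonneg (hw : ‖w‖ < R) {ε : ℝ} (hε : 0 < ε) (hεw : 2 * ε ≤ R - ‖w‖) (z : ℂ) :
    0 ≤ smoothGreen R ε w z := by
  have hR : 0 < R := (norm_nonneg w).trans_lt hw
  have hoff : ∀ z : ℂ, z ∈ (Metric.sphere (0 : ℂ) R)ᶜ → 0 ≤ smoothGreen R ε w z := by
    intro z hz
    have hzR : ‖z‖ ≠ R := by simpa using hz
    rcases le_or_gt ‖z - w‖ ε with h | h
    · have := log_sub_le_smoothGreen hw hε (z := z) (c := ε) le_rfl (fun ζ hζ => ?_) h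
      · simpa using this
      · have h1 := norm_sub_norm_le ζ z
        rw [norm_sub_rev ζ z] at h1
        linarith [norm_sub_norm_le z w]
    · have hzw : z ≠ w := by
        rintro rfl
        simp at h
        linarith
      have h1 : Real.log ‖z - w‖ ≤ ∫ ζ, Real.log ‖z - ζ‖ ∂(poissonMeasure R w) := by
        rcases hzR.lt_or_gt with h2 | h2
        · have := greenFn_nonneg hw h2 hzw
          rw [greenFn] at this
          rw [integral_log_norm_sub_poissonMeasure_of_lt hw h2]
          linarith
        · rw [integral_log_norm_sub_poissonMeasure_of_gt hw h2]
      have h3 : ∫ ζ, Real.log ‖z - ζ‖ ∂(poissonMeasure R w) ≤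
          ∫ ζ, smoothLog ε (z - ζ) ∂(poissonMeasure R w) := by
        refine integral_mono_ae (integrable_log_poissonMeasure hw z)
          (integrable_smoothLog_poissonMeasure hw ε z) ?_
        filter_upwards [ae_poissonMeasure_norm_eq hw] with ζ hζ
        refine log_norm_le_smoothLog hε (sub_ne_zero.2 ?_)
        rintro rfl
        exact hzR hζ
      rw [smoothGreen, smoothLog_of_le_norm hε h.le]
      linarith
  -- For `z` on the circle the comparison of logarithms fails at `ζ = z`, where `log 0 = 0`.
  -- Continuity extends the inequality from the dense complement.
  have hdense : Dense (Metric.sphere (0 : ℂ) R)ᶜ := by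
    rw [← interior_eq_empty_iff_dense_compl]
    exact interior_sphere 0 hR.ne'
  have hcl : IsClosed {z | 0 ≤ smoothGreen R ε w z} :=
    isClosed_le continuous_const (contDiff_smoothGreen hw ε).continuous
  exact hcl.closure_subset_iff.2 hoff (hdense z)

theorem measurable_posLog_div (ε : ℝ) (z : ℂ) :
    Measurable fun ζ : ℂ => Real.posLog (ε / ‖z - ζ‖) := by
  unfold Real.posLog
  fun_prop

/-- The right side is `log⁺ (1/x)`: a majorant independent of `ε`, for dominated convergence. -/
theorem posLog_div_le {ε x : ℝ} (hε : 0 ≤ ε) (hε1 : ε ≤ 1) (hx : 0 ≤ x) :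
    Real.posLog (ε / x) ≤ Real.posLog x - Real.log x := by
  rw [← Real.posLog_sub_posLog_inv, sub_sub_cancel]
  refine Real.monotoneOn_posLog (by simp; positivity) (by simp; positivity) ?_
  rw [div_eq_mul_inv]
  exact mul_le_of_le_one_left (by positivity) hε1

theorem posLog_norm_sub_le {z ζ : ℂ} {M : ℝ} (hM : ‖z‖ + ‖ζ‖ ≤ M) :
    Real.posLog ‖z - ζ‖ ≤ Real.posLog M :=
  Real.monotoneOn_posLog (norm_nonneg _) ((norm_nonneg (z - ζ)).trans ((norm_sub_le z ζ).trans hM))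
    ((norm_sub_le z ζ).trans hM)

theorem integrable_posLog_sub_log (hR : 0 < R) (z : ℂ) :
    Integrable (fun ζ => Real.posLog ‖z - ζ‖ - Real.log ‖z - ζ‖) (circleProb R) := by
  refine Integrable.sub ?_ (integrable_log_norm_sub_circleProb R z)
  refine Integrable.of_bound ?_ (Real.posLog (‖z‖ + R)) ?_
  · refine Measurable.aestronglyMeasurable ?_
    unfold Real.posLog
    fun_prop
  · filter_upwards [ae_circleProb_norm_eq hR] with ζ hζ
    rw [Real.norm_eq_abs, abs_of_nonneg Real.posLog_nonneg]
    exact posLog_norm_sub_le (by rw [hζ])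

theorem integrable_posLog_div (hw : ‖w‖ < R) {ε : ℝ} (hε : 0 ≤ ε) (hε1 : ε ≤ 1) (z : ℂ) :
    Integrable (fun ζ => Real.posLog (ε / ‖z - ζ‖)) (poissonMeasure R w) := by
  refine (integrable_poissonMeasure hw (integrable_posLog_sub_log
    ((norm_nonneg w).trans_lt hw) z)).mono' (measurable_posLog_div ε z).aestronglyMeasurable ?_
  refine Filter.Eventually.of_forall fun ζ => ?_
  rw [Real.norm_eq_abs, abs_of_nonneg Real.posLog_nonneg]
  exact posLog_div_le hε hε1 (norm_nonneg _)

theorem smoothingError_nonneg (R ε : ℝ) (w z : ℂ) : 0 ≤ smoothingError R ε w z :=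
  integral_nonneg fun _ => Real.posLog_nonneg

/-- Harnack reduces to arc length, whose logarithmic potential is explicit and at least `log R`. The
bound is uniform in `z`, even across the circle, so it can be integrated against the Riesz measure.
-/
theorem smoothingError_le (hw : ‖w‖ < R) {ε : ℝ} (hε : 0 ≤ ε) (hε1 : ε ≤ 1) {z : ℂ}
    (hz : ‖z‖ ≤ R + 1) : smoothingError R ε w z ≤
      (R + ‖w‖) / (R - ‖w‖) * (Real.posLog (2 * R + 1) - Real.log R) := by
  have hR : 0 < R := (norm_nonneg w).trans_lt hw
  have hc : 0 ≤ (R + ‖w‖) / (R - ‖w‖) :=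
    div_nonneg (by linarith [norm_nonneg w]) (by linarith)
  have hi := integrable_posLog_sub_log hR z
  have hnn : ∀ ζ : ℂ, 0 ≤ Real.posLog ‖z - ζ‖ - Real.log ‖z - ζ‖ := fun ζ =>
    Real.posLog_nonneg.trans (posLog_div_le hε hε1 (norm_nonneg _))
  have h1 : smoothingError R ε w z ≤
      ∫ ζ, (Real.posLog ‖z - ζ‖ - Real.log ‖z - ζ‖) ∂(poissonMeasure R w) :=
    integral_mono (integrable_posLog_div hw hε hε1 z) (integrable_poissonMeasure hw hi)
      fun ζ => posLog_div_le hε hε1 (norm_nonneg _)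
  have h2 : ∫ ζ, (Real.posLog ‖z - ζ‖ - Real.log ‖z - ζ‖) ∂(poissonMeasure R w) ≤
      (R + ‖w‖) / (R - ‖w‖) * ∫ ζ, (Real.posLog ‖z - ζ‖ - Real.log ‖z - ζ‖) ∂(circleProb R) := by
    have h := integral_mono_measure (poissonMeasure_le hw)
      (Filter.Eventually.of_forall hnn) (hi.smul_measure ENNReal.ofReal_ne_top)
    rwa [integral_smul_measure, ENNReal.toReal_ofReal hc, smul_eq_mul] at h
  refine h1.trans (h2.trans (mul_le_mul_of_nonneg_left ?_ hc))
  have h3 : Integrable (fun ζ => Real.posLog ‖z - ζ‖) (circleProb R) := by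
    have := hi.add (integrable_log_norm_sub_circleProb R z)
    refine this.congr (Filter.Eventually.of_forall fun ζ => ?_)
    simp
  rw [integral_sub h3 (integrable_log_norm_sub_circleProb R z),
    integral_log_norm_sub_circleProb hR]
  have h4 : ∫ ζ, Real.posLog ‖z - ζ‖ ∂(circleProb R) ≤ Real.posLog (2 * R + 1) := by
    have h5 : ∫ _, Real.posLog (2 * R + 1) ∂(circleProb R) = Real.posLog (2 * R + 1) := by simp
    rw [← h5]
    refine integral_mono_ae h3 (integrable_const _) ?_
    filter_upwards [ae_circleProb_norm_eq hR] with ζ hζ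
    exact posLog_norm_sub_le (by rw [hζ]; linarith)
  linarith [Real.posLog_nonneg (x := R⁻¹ * ‖z‖)]

theorem measurable_smoothingError (hw : ‖w‖ < R) (ε : ℝ) : Measurable (smoothingError R ε w) := by
  have := isFiniteMeasure_poissonMeasure hw
  have h : Measurable fun p : ℂ × ℂ => Real.posLog (ε / ‖p.1 - p.2‖) := by
    unfold Real.posLog
    fun_prop
  exact (h.stronglyMeasurable.integral_prod_right (ν := poissonMeasure R w)).measurable

theorem tendsto_smoothingError (hw : ‖w‖ < R) {e : ℕ → ℝ} (he0 : ∀ n, 0 < e n)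
    (he1 : ∀ n, e n ≤ 1) (he : Filter.Tendsto e Filter.atTop (nhds 0)) (z : ℂ) :
    Filter.Tendsto (fun n => smoothingError R (e n) w z) Filter.atTop (nhds 0) := by
  have h0 : ∫ _, (0 : ℝ) ∂(poissonMeasure R w) = 0 := by simp
  rw [← h0]
  refine tendsto_integral_of_dominated_convergence
    (fun ζ => Real.posLog ‖z - ζ‖ - Real.log ‖z - ζ‖)
    (fun n => (measurable_posLog_div (e n) z).aestronglyMeasurable)
    (integrable_poissonMeasure hw (integrable_posLog_sub_log ((norm_nonneg w).trans_lt hw) z))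
    (fun n => Filter.Eventually.of_forall fun ζ => ?_) (Filter.Eventually.of_forall fun ζ => ?_)
  · rw [Real.norm_eq_abs, abs_of_nonneg Real.posLog_nonneg]
    exact posLog_div_le (he0 n).le (he1 n) (norm_nonneg _)
  · refine tendsto_const_nhds.congr' ?_
    have ht : Filter.Tendsto (fun n => e n / ‖z - ζ‖) Filter.atTop (nhds 0) := by
      simpa using he.div_const ‖z - ζ‖
    filter_upwards [ht.eventually_le_const one_pos] with n hn
    refine ((Real.posLog_eq_zero_iff _).2 ?_).symm
    rwa [abs_of_nonneg (div_nonneg (he0 n).le (norm_nonneg _))]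

theorem smoothGreen_le_add (hw : ‖w‖ < R) {ε : ℝ} (hε : 0 < ε) (hε1 : ε ≤ 1) {z : ℂ}
    (hzw : z ≠ w) : smoothGreen R ε w z ≤ smoothingError R ε w z +
      ((∫ ζ, Real.log ‖z - ζ‖ ∂(poissonMeasure R w)) - Real.log ‖z - w‖) := by
  have h1 : ∫ ζ, smoothLog ε (z - ζ) ∂(poissonMeasure R w) ≤
      ∫ ζ, (Real.log ‖z - ζ‖ + Real.posLog (ε / ‖z - ζ‖)) ∂(poissonMeasure R w) :=
    integral_mono (integrable_smoothLog_poissonMeasure hw ε z)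
      ((integrable_log_poissonMeasure hw z).add (integrable_posLog_div hw hε.le hε1 z))
      fun ζ => smoothLog_le hε hε1 _
  rw [integral_add (integrable_log_poissonMeasure hw z) (integrable_posLog_div hw hε.le hε1 z)] at h1
  have h2 := log_norm_le_smoothLog hε (sub_ne_zero.2 hzw)
  rw [smoothGreen, smoothingError]
  linarith

theorem smoothGreen_le_of_norm_lt (hw : ‖w‖ < R) {ε : ℝ} (hε : 0 < ε) (hε1 : ε ≤ 1) {z : ℂ}
    (hz : ‖z‖ < R) (hzw : z ≠ w) :
    smoothGreen R ε w z ≤ smoothingError R ε w z + greenFn R w z := by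
  have := smoothGreen_le_add hw hε hε1 hzw
  rwa [integral_log_norm_sub_poissonMeasure_of_lt hw hz] at this

/-- On and outside the circle the unsmoothed difference of potentials is at most `0`, so any mass of
the Riesz measure on the circle meets only the error term. -/
theorem smoothGreen_le_of_le_norm (hw : ‖w‖ < R) {ε : ℝ} (hε : 0 < ε) (hε1 : ε ≤ 1) {z : ℂ}
    (hz : R ≤ ‖z‖) : smoothGreen R ε w z ≤ smoothingError R ε w z := by
  have hzw : z ≠ w := by rintro rfl; linarith
  have h1 := smoothGreen_le_add hw hε hε1 hzw
  have h2 : ∫ ζ, Real.log ‖z - ζ‖ ∂(poissonMeasure R w) ≤ Real.log ‖z - w‖ := by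
    rcases hz.eq_or_lt with h | h
    · exact integral_log_norm_sub_poissonMeasure_le_of_eq hw h.symm
    · exact (integral_log_norm_sub_poissonMeasure_of_gt hw h).le
  linarith

end Green

/-! ### The Poisson–Jensen formula -/

namespace IsSubharmonicOn

variable {u : ℂ → EReal} {O : Set ℂ} {μ : Measure ℂ} {R : ℝ} {w : ℂ}

theorem closedBall_subset_of_norm_le {ε : ℝ} {a : ℂ} (ha : ‖a‖ ≤ R) :
    Metric.closedBall a ε ⊆ Metric.closedBall 0 (R + ε) := by
  intro z hz
  rw [Metric.mem_closedBall, dist_eq_norm] at hz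
  have : ‖z‖ ≤ ‖a‖ + ‖z - a‖ := by simpa using norm_add_le a (z - a)
  simpa using by linarith

/-- The Poisson–Jensen formula for the mollified function. -/
theorem integral_smoothGreen_add_mollified (hu : IsSubharmonicOn u O) (hm : Measurable u)
    (hO : IsOpen O) (hOc : IsConnected O) (hμ : IsRieszMeasure u O μ) (hw : ‖w‖ < R)
    {ε : ℝ} (hε : 0 < ε) (hball : Metric.closedBall 0 (R + ε) ⊆ O) :
    Integrable (mollified u ε) (poissonMeasure R w) ∧
    (∫ z, smoothGreen R ε w z ∂μ) + mollified u ε w =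
      ∫ ζ, mollified u ε ζ ∂(poissonMeasure R w) := by
  have := isFiniteMeasure_poissonMeasure hw
  set P := poissonMeasure R w with hP
  set K := Metric.closedBall (0 : ℂ) (R + ε) with hK
  have hKc : IsCompact K := isCompact_closedBall _ _
  -- Truncation to a compact set makes the integrand of Fubini globally integrable; neither the
  -- mollifier centred in the disc nor the test function sees the change.
  set F : ℂ → ℝ := K.indicator fun z => (u z).toReal with hF
  have hFi : Integrable F :=
    (hu.integrableOn hm hO hOc hKc hball).integrable_indicator hKc.measurableSet
  obtain ⟨C, hC⟩ := (hasCompactSupport_radialMollifier hε).exists_bound_of_continuous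
    (continuous_radialMollifier ε)
  have hcont := continuous_radialMollifier ε
  have hH : Integrable (fun p : ℂ × ℂ => F p.2 * radialMollifier ε (p.2 - p.1)) (P.prod volume) :=
    (hFi.comp_snd P).mul_bdd (c := C)
      ((hcont.comp (continuous_snd.sub continuous_fst)).aestronglyMeasurable)
      (Filter.Eventually.of_forall fun p => hC _)
  have hmol : ∀ a : ℂ, ‖a‖ ≤ R → mollified u ε a = ∫ z, F z * radialMollifier ε (z - a) := by
    intro a ha
    refine integral_congr_ae (Filter.Eventually.of_forall fun z => ?_)
    by_cases hz : z ∈ K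
    · simp [hF, hz]
    · have : ε ≤ ‖z - a‖ := by
        by_contra! hlt
        exact hz (closedBall_subset_of_norm_le ha (by simpa [dist_eq_norm] using hlt.le))
      simp [radialMollifier_of_le_norm hε this]
  have hmolP : (fun ζ => ∫ z, F z * radialMollifier ε (z - ζ)) =ᵐ[P] mollified u ε := by
    filter_upwards [ae_poissonMeasure_norm_eq hw] with ζ hζ
    exact (hmol ζ hζ.le).symm
  have hint : Integrable (mollified u ε) P := (hH.integral_prod_left).congr hmolP
  refine ⟨hint, ?_⟩
  have hs := tsupport_smoothGreen_subset hw hε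
  rw [hμ.integral_eq _ (contDiff_smoothGreen hw ε) (hasCompactSupport_smoothGreen hw hε)
    (hs.trans hball)]
  have hlap : ∀ z, (u z).toReal * Laplacian.laplacian (smoothGreen R ε w) z =
      2 * Real.pi * ((∫ ζ, F z * radialMollifier ε (z - ζ) ∂P) - F z * radialMollifier ε (z - w)) := by
    intro z
    have h1 := laplacian_smoothGreen hw hε z
    rw [integral_const_mul, ← mul_sub]
    by_cases hz : z ∈ K
    · rw [h1, hF, Set.indicator_of_mem hz]
      ring
    · rw [laplacian_eq_zero_of_notMem_tsupport fun h => hz (hs h), hF, Set.indicator_of_notMem hz]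
      ring
  simp only [hlap]
  have hi1 : Integrable fun z => ∫ ζ, F z * radialMollifier ε (z - ζ) ∂P := hH.integral_prod_right
  have hi2 : Integrable fun z => F z * radialMollifier ε (z - w) :=
    hFi.mul_bdd (c := C) ((hcont.comp (continuous_id.sub continuous_const)).aestronglyMeasurable)
      (Filter.Eventually.of_forall fun p => hC _)
  rw [integral_const_mul, inv_mul_cancel_left₀ Real.two_pi_pos.ne', integral_sub hi1 hi2,
    ← hmol w hw.le, sub_add_cancel, ← integral_congr_ae hmolP]
  exact (integral_integral_swap (f := fun ζ z => F z * radialMollifier ε (z - ζ)) hH).symm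

/-- Since the smoothed Green function is nonnegative, the mollified formula gives `∫ (M - u_ε) dP ≤
M - u(w)` for every small `ε`. Fatou's lemma passes this to `M - u`, upper semicontinuity supplying
the pointwise bound on the lower limit. -/
theorem ae_poissonMeasure_ne_bot_and_integrable (hu : IsSubharmonicOn u O) (hm : Measurable u)
    (hO : IsOpen O) (hOc : IsConnected O) (hμ : IsRieszMeasure u O μ) (hw : ‖w‖ < R)
    (hball : Metric.closedBall 0 R ⊆ O) (huw : u w ≠ ⊥) :
    (∀ᵐ ζ ∂(poissonMeasure R w), u ζ ≠ ⊥) ∧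
      Integrable (fun ζ => (u ζ).toReal) (poissonMeasure R w) := by
  have := isProbabilityMeasure_poissonMeasure hw
  set P := poissonMeasure R w with hP
  obtain ⟨d, hd, hdO⟩ := (isCompact_closedBall (0 : ℂ) R).exists_cthickening_subset_open hO hball
  have hR : 0 ≤ R := (norm_nonneg w).trans hw.le
  rw [cthickening_closedBall hd.le hR, add_comm] at hdO
  set δ := min d ((R - ‖w‖) / 2) with hδ
  have hδ0 : 0 < δ := lt_min hd (by linarith)
  have hδO : Metric.closedBall 0 (R + δ) ⊆ O :=
    (Metric.closedBall_subset_closedBall (by linarith [min_le_left d ((R - ‖w‖) / 2)])).trans hdO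
  obtain ⟨M, hM0, hM⟩ := hu.exists_le_coe (isCompact_closedBall 0 (R + δ)) hδO
  have he := tendsto_const_div_atTop_nhds_zero_nat δ
  set e : ℕ → ℝ := fun n => δ / ((n : ℝ) + 1) with he_def
  have he0 : ∀ n, 0 < e n := fun n => by positivity
  have heδ : ∀ n, e n ≤ δ := fun n => div_le_self hδ0.le (by linarith [Nat.cast_nonneg (α := ℝ) n])
  have het : Filter.Tendsto e Filter.atTop (nhdsWithin 0 (Set.Ioi 0)) := by
    refine tendsto_nhdsWithin_iff.2 ⟨?_, Filter.Eventually.of_forall he0⟩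
    simpa [he_def] using (Filter.tendsto_add_atTop_iff_nat 1).2 he
  have heO : ∀ n, Metric.closedBall 0 (R + e n) ⊆ O := fun n =>
    (Metric.closedBall_subset_closedBall (by linarith [heδ n])).trans hδO
  have hbM : ∀ n, ∀ a : ℂ, ‖a‖ ≤ R → mollified u (e n) a ≤ M := fun n a ha =>
    hu.mollified_le hm hO hOc (he0 n) ((closedBall_subset_of_norm_le ha).trans (heO n))
      fun z hz => hM z (Metric.closedBall_subset_closedBall (by linarith [heδ n])
        (closedBall_subset_of_norm_le ha hz))
  have hbound : ∀ n, ∫⁻ ζ, ENNReal.ofReal (M - mollified u (e n) ζ) ∂P ≤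
      ENNReal.ofReal (M - (u w).toReal) := by
    intro n
    obtain ⟨hint, heq⟩ := hu.integral_smoothGreen_add_mollified hm hO hOc hμ hw (he0 n) (heO n)
    have h1 : 0 ≤ ∫ z, smoothGreen R (e n) w z ∂μ :=
      integral_nonneg fun z => smoothGreen_nonneg hw (he0 n)
        (by linarith [heδ n, min_le_right d ((R - ‖w‖) / 2)]) z
    have h2 := hu.le_mollified hm hO hOc (he0 n)
      ((closedBall_subset_of_norm_le hw.le).trans (heO n)) huw
    have hsub : Integrable (fun ζ => M - mollified u (e n) ζ) P := (integrable_const M).sub hint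
    rw [← ofReal_integral_eq_lintegral_ofReal hsub]
    · refine ENNReal.ofReal_le_ofReal ?_
      rw [integral_sub (integrable_const M) hint]
      simp
      linarith
    · filter_upwards [ae_poissonMeasure_norm_eq hw] with ζ hζ
      simpa using hbM n ζ hζ.le
  have hmeas : ∀ n, AEMeasurable (fun ζ => ENNReal.ofReal (M - mollified u (e n) ζ)) P := fun n =>
    ((hu.integral_smoothGreen_add_mollified hm hO hOc hμ hw (he0 n)
      (heO n)).1.aestronglyMeasurable.aemeasurable.const_sub M).ennreal_ofReal
  have hfatou : ∫⁻ ζ, Filter.liminf (fun n => ENNReal.ofReal (M - mollified u (e n) ζ))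
      Filter.atTop ∂P ≤ ENNReal.ofReal (M - (u w).toReal) := by
    refine (lintegral_liminf_le' hmeas).trans ?_
    exact Filter.liminf_le_of_le (by isBoundedDefault) fun b hb => by
      obtain ⟨n, hn⟩ := hb.exists
      exact hn.trans (hbound n)
  have hle : ∀ᵐ ζ ∂P, ((M : EReal) - u ζ).toENNReal ≤
      Filter.liminf (fun n => ENNReal.ofReal (M - mollified u (e n) ζ)) Filter.atTop := by
    filter_upwards [ae_poissonMeasure_norm_eq hw] with ζ hζ
    have hζO : ζ ∈ O := hball (by simp [hζ])
    have hkey : ∀ c : ℝ, u ζ < c → ENNReal.ofReal (M - c) ≤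
        Filter.liminf (fun n => ENNReal.ofReal (M - mollified u (e n) ζ)) Filter.atTop := by
      intro c hc
      refine Filter.le_liminf_of_le (by isBoundedDefault) ?_
      filter_upwards [het.eventually (hu.eventually_mollified_le hm hO hOc hζO hc)] with n hn
      exact ENNReal.ofReal_le_ofReal (by linarith)
    refine le_of_forall_lt fun b hb => ?_
    by_cases hbot : u ζ = ⊥
    · have hbt : b ≠ ⊤ := (hb.trans_le le_top).ne
      have h1 := hkey (M - (b.toReal + 1)) (by rw [hbot]; exact EReal.bot_lt_coe _)
      rw [sub_sub_cancel] at h1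
      refine lt_of_lt_of_le ?_ h1
      rw [ENNReal.lt_ofReal_iff_toReal_lt hbt]
      linarith
    · have hx := hu.coe_toReal hζO hbot
      rw [← hx, ← EReal.coe_sub, EReal.real_coe_toENNReal] at hb
      have hbt : b ≠ ⊤ := (hb.trans_le le_top).ne
      rw [ENNReal.lt_ofReal_iff_toReal_lt hbt] at hb
      set x := (u ζ).toReal
      have h1 := hkey ((x + (M - b.toReal)) / 2) (by
        rw [← hx]
        exact_mod_cast (by linarith))
      refine lt_of_lt_of_le ?_ h1
      rw [ENNReal.lt_ofReal_iff_toReal_lt hbt]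
      linarith
  have hfin : ∫⁻ ζ, ((M : EReal) - u ζ).toENNReal ∂P < ⊤ :=
    ((lintegral_mono_ae hle).trans hfatou).trans_lt ENNReal.ofReal_lt_top
  have hm' : Measurable fun ζ => ((M : EReal) - u ζ).toENNReal := by
    have : Measurable fun ζ => (M : EReal) - u ζ := measurable_const.sub hm
    exact this.ereal_toENNReal
  have hne : ∀ᵐ ζ ∂P, u ζ ≠ ⊥ := by
    filter_upwards [ae_lt_top hm' hfin.ne] with ζ hζ hbot
    rw [hbot] at hζ
    simp at hζ
  refine ⟨hne, ?_⟩
  have hsub : Integrable (fun ζ => M - (u ζ).toReal) P := by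
    refine ⟨(measurable_const.sub hm.ereal_toReal).aestronglyMeasurable, ?_⟩
    refine lt_of_le_of_lt (lintegral_mono_ae ?_) hfin
    filter_upwards [hne, ae_poissonMeasure_norm_eq hw] with ζ hζ hζR
    have hζO : ζ ∈ O := hball (by simp [hζR])
    have hle : (u ζ).toReal ≤ M :=
      EReal.toReal_le_of_le_coe hζ (hM ζ (by simp [hζR, hδ0.le]))
    rw [← hu.coe_toReal hζO hζ, ← EReal.coe_sub, EReal.real_coe_toENNReal, EReal.toReal_coe,
      Real.enorm_eq_ofReal (by linarith)]
  have := (integrable_const M).sub hsub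
  refine this.congr (Filter.Eventually.of_forall fun ζ => ?_)
  simp

/-- Some pole in the disc has a finite value of `u`, and Harnack transfers the conclusion to arc
length. The pole of interest may therefore have `u = -∞`. -/
theorem ae_circleProb_ne_bot_and_integrable (hu : IsSubharmonicOn u O) (hm : Measurable u)
    (hO : IsOpen O) (hOc : IsConnected O) (hμ : IsRieszMeasure u O μ) (hR : 0 < R)
    (hball : Metric.closedBall 0 R ⊆ O) :
    (∀ᵐ ζ ∂(circleProb R), u ζ ≠ ⊥) ∧ Integrable (fun ζ => (u ζ).toReal) (circleProb R) := by
  obtain ⟨w, hwb, hw⟩ : ∃ w ∈ Metric.ball (0 : ℂ) R, u w ≠ ⊥ := by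
    by_contra! hcon
    have h := hu.ae_ne_bot hm hO hOc
    have hsub : Metric.ball (0 : ℂ) R ⊆ {z | ¬(z ∈ O → u z ≠ ⊥)} := fun z hz hcon' =>
      hcon' (hball (Metric.ball_subset_closedBall hz)) (hcon z hz)
    have h0 : volume (Metric.ball (0 : ℂ) R) = 0 := measure_mono_null hsub (ae_iff.1 h)
    exact (Metric.measure_ball_pos volume (0 : ℂ) hR).ne' h0
  have hwR : ‖w‖ < R := by simpa using hwb
  obtain ⟨h1, h2⟩ := hu.ae_poissonMeasure_ne_bot_and_integrable hm hO hOc hμ hwR hball hw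
  exact ⟨(circleProb_absolutelyContinuous hwR).ae_le h1,
    integrable_circleProb_of_poissonMeasure hwR h2⟩

theorem measurable_greenENN (R : ℝ) (w : ℂ) : Measurable (greenENN R w) := by
  unfold greenENN greenFn
  refine Measurable.ite (measurableSet_singleton w) measurable_const ?_
  fun_prop

/-- The two inequalities of the Poisson–Jensen formula in a disc. -/
theorem poissonJensen (hu : IsSubharmonicOn u O) (hm : Measurable u)
    (hO : IsOpen O) (hOc : IsConnected O) (hμ : IsRieszMeasure u O μ) (hw : ‖w‖ < R)
    (hball : Metric.closedBall 0 R ⊆ O) :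
    (u w ≠ ⊥ → ∫⁻ z in Metric.ball 0 R, greenENN R w z ∂μ < ⊤ ∧
      (u w).toReal + (∫⁻ z in Metric.ball 0 R, greenENN R w z ∂μ).toReal ≤
        ∫ ζ, (u ζ).toReal ∂(poissonMeasure R w)) ∧
    (∫⁻ z in Metric.ball 0 R, greenENN R w z ∂μ < ⊤ → u w ≠ ⊥ ∧
      ∫ ζ, (u ζ).toReal ∂(poissonMeasure R w) ≤
        (u w).toReal + (∫⁻ z in Metric.ball 0 R, greenENN R w z ∂μ).toReal) := by
  have := isProbabilityMeasure_poissonMeasure hw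
  have hR : 0 < R := (norm_nonneg w).trans_lt hw
  have hwO : w ∈ O := hball (by simp [hw.le])
  obtain ⟨hne, hfint⟩ := hu.ae_circleProb_ne_bot_and_integrable hm hO hOc hμ hR hball
  replace hne := (poissonMeasure_absolutelyContinuous R w).ae_le hne
  replace hfint := integrable_poissonMeasure hw hfint
  set P := poissonMeasure R w with hP
  obtain ⟨d, hd, hdO⟩ := (isCompact_closedBall (0 : ℂ) R).exists_cthickening_subset_open hO hball
  rw [cthickening_closedBall hd.le hR.le, add_comm] at hdO
  set δ := min (min d ((R - ‖w‖) / 2)) 1 with hδ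
  have hδ0 : 0 < δ := lt_min (lt_min hd (by linarith)) one_pos
  have hδd : δ ≤ d := (min_le_left _ _).trans (min_le_left _ _)
  have hδw : δ ≤ (R - ‖w‖) / 2 := (min_le_left _ _).trans (min_le_right _ _)
  have hδ1 : δ ≤ 1 := min_le_right _ _
  have hδO : Metric.closedBall 0 (R + δ) ⊆ O :=
    (Metric.closedBall_subset_closedBall (by linarith)).trans hdO
  set K := Metric.closedBall (0 : ℂ) (R + δ) with hK
  obtain ⟨M, hM0, hM⟩ := hu.exists_le_coe (isCompact_closedBall 0 (R + δ)) hδO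
  have he := tendsto_const_div_atTop_nhds_zero_nat δ
  set e : ℕ → ℝ := fun n => δ / ((n : ℝ) + 1) with he_def
  have he0 : ∀ n, 0 < e n := fun n => by positivity
  have heδ : ∀ n, e n ≤ δ := fun n => div_le_self hδ0.le (by linarith [Nat.cast_nonneg (α := ℝ) n])
  have het' : Filter.Tendsto e Filter.atTop (nhds 0) := by
    simpa [he_def] using (Filter.tendsto_add_atTop_iff_nat 1).2 he
  have het : Filter.Tendsto e Filter.atTop (nhdsWithin 0 (Set.Ioi 0)) :=
    tendsto_nhdsWithin_iff.2 ⟨het', Filter.Eventually.of_forall he0⟩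
  have heK : ∀ n, Metric.closedBall 0 (R + e n) ⊆ K := fun n =>
    Metric.closedBall_subset_closedBall (by linarith [heδ n])
  have heO : ∀ n, Metric.closedBall 0 (R + e n) ⊆ O := fun n => (heK n).trans hδO
  have hcore := fun n => hu.integral_smoothGreen_add_mollified hm hO hOc hμ hw (he0 n) (heO n)
  have hlow : ∀ n, ∀ a : ℂ, ‖a‖ ≤ R → u a ≠ ⊥ → (u a).toReal ≤ mollified u (e n) a :=
    fun n a ha hua => hu.le_mollified hm hO hOc (he0 n)
      ((closedBall_subset_of_norm_le ha).trans (heO n)) hua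
  have hbM : ∀ n, ∀ a : ℂ, ‖a‖ ≤ R → mollified u (e n) a ≤ M := fun n a ha =>
    hu.mollified_le hm hO hOc (he0 n) ((closedBall_subset_of_norm_le ha).trans (heO n))
      fun z hz => hM z (heK n (closedBall_subset_of_norm_le ha hz))
  -- Dominated convergence, from `u ≤ u_ε ≤ M` on the circle.
  have hlim : Filter.Tendsto (fun n => ∫ ζ, mollified u (e n) ζ ∂P) Filter.atTop
      (nhds (∫ ζ, (u ζ).toReal ∂P)) := by
    refine tendsto_integral_of_dominated_convergence (fun ζ => |(u ζ).toReal| + M)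
      (fun n => (hcore n).1.aestronglyMeasurable) (hfint.abs.add (integrable_const M)) ?_ ?_
    · intro n
      filter_upwards [hne, ae_poissonMeasure_norm_eq hw] with ζ hζ hζR
      have h1 := hlow n ζ hζR.le hζ
      have h2 := hbM n ζ hζR.le
      rw [Real.norm_eq_abs, abs_le]
      constructor
      · linarith [neg_abs_le (u ζ).toReal]
      · linarith [abs_nonneg (u ζ).toReal]
    · filter_upwards [hne, ae_poissonMeasure_norm_eq hw] with ζ hζ hζR
      have hζO : ζ ∈ O := hball (by simp [hζR])
      refine tendsto_order.2 ⟨fun a ha => Filter.Eventually.of_forall fun n =>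
        ha.trans_le (hlow n ζ hζR.le hζ), fun a ha => ?_⟩
      have hlt : u ζ < (((u ζ).toReal + a) / 2 : ℝ) := by
        conv_lhs => rw [← hu.coe_toReal hζO hζ]
        exact_mod_cast (by linarith)
      filter_upwards [het.eventually (hu.eventually_mollified_le hm hO hOc hζO hlt)] with n hn
      linarith
  have hGn : ∀ n z, 0 ≤ smoothGreen R (e n) w z := fun n z =>
    smoothGreen_nonneg hw (he0 n) (by linarith [heδ n]) z
  have hμK : μ K < ⊤ := hμ.lt_top_of_isCompact K (isCompact_closedBall _ _) hδO
  have hGint : ∀ n, Integrable (smoothGreen R (e n) w) μ := by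
    intro n
    have hc := (contDiff_smoothGreen (R := R) hw (e n)).continuous
    refine (integrableOn_iff_integrable_of_support_subset (s := K) fun z hz =>
      heK n (tsupport_smoothGreen_subset hw (he0 n) (subset_tsupport _ hz))).1 ?_
    obtain ⟨C, hC⟩ := (hasCompactSupport_smoothGreen hw (he0 n)).exists_bound_of_continuous hc
    exact IntegrableOn.of_bound hμK hc.aestronglyMeasurable C (Filter.Eventually.of_forall hC)
  set I := ∫⁻ z in Metric.ball 0 R, greenENN R w z ∂μ with hI
  constructor
  · intro huw
    have hptw : ∀ z ∈ Metric.ball (0 : ℂ) R, greenENN R w z ≤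
        Filter.liminf (fun n => ENNReal.ofReal (smoothGreen R (e n) w z)) Filter.atTop := by
      intro z hz
      have hzR : ‖z‖ < R := by simpa using hz
      by_cases hzw : z = w
      · subst hzw
        have ht : Filter.Tendsto (fun n => ENNReal.ofReal (Real.log (R - ‖z‖) - Real.log (e n)))
            Filter.atTop (nhds ⊤) := by
          refine ENNReal.tendsto_ofReal_nhds_top.2 ?_
          have := (Real.tendsto_log_nhdsGT_zero).comp het
          exact Filter.tendsto_atTop_add_const_left _ _ (Filter.tendsto_neg_atBot_atTop.comp this)
        have hle : ∀ n, ENNReal.ofReal (Real.log (R - ‖z‖) - Real.log (e n)) ≤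
            ENNReal.ofReal (smoothGreen R (e n) z z) := by
          intro n
          refine ENNReal.ofReal_le_ofReal (log_sub_le_smoothGreen hw (he0 n)
            (by linarith [heδ n]) (fun ζ hζ => ?_) (by simp [(he0 n).le]))
          have := norm_sub_norm_le ζ z
          rw [norm_sub_rev] at this
          linarith
        have ht' := tendsto_of_tendsto_of_tendsto_of_le_of_le ht tendsto_const_nhds hle
          (fun _ => le_top)
        rw [ht'.liminf_eq]
        exact le_top
      · rw [greenENN, if_neg hzw]
        refine Filter.le_liminf_of_le (by isBoundedDefault) ?_
        have hpos : 0 < min (R - ‖z‖) ‖z - w‖ :=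
          lt_min (by linarith) (norm_pos_iff.2 (sub_ne_zero.2 hzw))
        filter_upwards [het'.eventually_le_const hpos] with n hn
        rw [smoothGreen_eq_greenFn hw (he0 n) (by linarith [hn.trans (min_le_left _ _)])
          (hn.trans (min_le_right _ _))]
    have hb : ∀ n, ∫⁻ z in Metric.ball 0 R, ENNReal.ofReal (smoothGreen R (e n) w z) ∂μ ≤
        ENNReal.ofReal ((∫ ζ, mollified u (e n) ζ ∂P) - (u w).toReal) := by
      intro n
      refine (setLIntegral_le_lintegral _ _).trans ?_
      rw [← ofReal_integral_eq_lintegral_ofReal (hGint n) (Filter.Eventually.of_forall (hGn n))]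
      refine ENNReal.ofReal_le_ofReal ?_
      linarith [(hcore n).2, hlow n w hw.le huw]
    -- Fatou's lemma for the smoothed Green functions, followed by the limit of the mollified
    -- formula.
    have hIle : I ≤ ENNReal.ofReal ((∫ ζ, (u ζ).toReal ∂P) - (u w).toReal) := by
      calc I ≤ ∫⁻ z in Metric.ball 0 R, Filter.liminf
              (fun n => ENNReal.ofReal (smoothGreen R (e n) w z)) Filter.atTop ∂μ :=
            setLIntegral_mono' Metric.isOpen_ball.measurableSet hptw
        _ ≤ Filter.liminf (fun n => ∫⁻ z in Metric.ball 0 R,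
              ENNReal.ofReal (smoothGreen R (e n) w z) ∂μ) Filter.atTop :=
            lintegral_liminf_le fun n =>
              (contDiff_smoothGreen (R := R) hw (e n)).continuous.measurable.ennreal_ofReal
        _ ≤ Filter.liminf (fun n =>
              ENNReal.ofReal ((∫ ζ, mollified u (e n) ζ ∂P) - (u w).toReal)) Filter.atTop :=
            Filter.liminf_le_liminf (Filter.Eventually.of_forall hb)
        _ = _ := (ENNReal.tendsto_ofReal (hlim.sub_const _)).liminf_eq
    have hge : (u w).toReal ≤ ∫ ζ, (u ζ).toReal ∂P :=
      ge_of_tendsto hlim (Filter.Eventually.of_forall fun n => by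
        have h1 : 0 ≤ ∫ z, smoothGreen R (e n) w z ∂μ := integral_nonneg (hGn n)
        linarith [(hcore n).2, hlow n w hw.le huw])
    refine ⟨hIle.trans_lt ENNReal.ofReal_lt_top, ?_⟩
    have := ENNReal.toReal_mono ENNReal.ofReal_ne_top hIle
    rw [ENNReal.toReal_ofReal (by linarith)] at this
    linarith
  · intro hIfin
    have hfinK : IsFiniteMeasure (μ.restrict K) := ⟨by simpa using hμK⟩
    have hE : Filter.Tendsto (fun n => ∫ z in K, smoothingError R (e n) w z ∂μ) Filter.atTop
        (nhds 0) := by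
      have h0 : ∫ _ in K, (0 : ℝ) ∂μ = 0 := by simp
      rw [← h0]
      refine tendsto_integral_of_dominated_convergence
        (fun _ => (R + ‖w‖) / (R - ‖w‖) * (Real.posLog (2 * R + 1) - Real.log R))
        (fun n => (measurable_smoothingError hw (e n)).aestronglyMeasurable) (integrable_const _)
        (fun n => ?_) (Filter.Eventually.of_forall fun z =>
          tendsto_smoothingError hw he0 (fun n => (heδ n).trans hδ1) het' z)
      filter_upwards [ae_restrict_mem Metric.isClosed_closedBall.measurableSet] with z hz
      rw [Real.norm_eq_abs, abs_of_nonneg (smoothingError_nonneg _ _ _ _)]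
      have hzn : ‖z‖ ≤ R + δ := by simpa [hK] using hz
      exact smoothingError_le hw (he0 n).le ((heδ n).trans hδ1) (by linarith)
    have hEint : ∀ n, IntegrableOn (smoothingError R (e n) w) K μ := fun n =>
      IntegrableOn.of_bound hμK (measurable_smoothingError hw (e n)).aestronglyMeasurable
        ((R + ‖w‖) / (R - ‖w‖) * (Real.posLog (2 * R + 1) - Real.log R)) (by
        filter_upwards [ae_restrict_mem Metric.isClosed_closedBall.measurableSet] with z hz
        rw [Real.norm_eq_abs, abs_of_nonneg (smoothingError_nonneg _ _ _ _)]
        have hzn : ‖z‖ ≤ R + δ := by simpa [hK] using hz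
        exact smoothingError_le hw (he0 n).le ((heδ n).trans hδ1) (by linarith))
    -- The smoothed Green function is at most the Green function inside the disc plus the error on
    -- `K`; at `z = w` the bound is `⊤`.
    have hup : ∀ n, ∫ z, smoothGreen R (e n) w z ∂μ ≤
        (∫ z in K, smoothingError R (e n) w z ∂μ) + I.toReal := by
      intro n
      have h1 : ∀ z, ENNReal.ofReal (smoothGreen R (e n) w z) ≤
          K.indicator (fun z => ENNReal.ofReal (smoothingError R (e n) w z)) z +
            (Metric.ball 0 R).indicator (greenENN R w) z := by
        intro z
        by_cases hzK : z ∈ K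
        · rw [Set.indicator_of_mem hzK]
          by_cases hzR : z ∈ Metric.ball (0 : ℂ) R
          · rw [Set.indicator_of_mem hzR]
            by_cases hzw : z = w
            · simp [greenENN, hzw]
            · rw [greenENN, if_neg hzw]
              refine (ENNReal.ofReal_le_ofReal (smoothGreen_le_of_norm_lt hw (he0 n)
                ((heδ n).trans hδ1) (by simpa using hzR) hzw)).trans ENNReal.ofReal_add_le
          · rw [Set.indicator_of_notMem hzR, add_zero]
            exact ENNReal.ofReal_le_ofReal (smoothGreen_le_of_le_norm hw (he0 n)
              ((heδ n).trans hδ1) (by simpa using hzR))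
        · have : smoothGreen R (e n) w z = 0 := image_eq_zero_of_notMem_tsupport fun h =>
            hzK (heK n (tsupport_smoothGreen_subset hw (he0 n) h))
          simp [this]
      have h2 : ENNReal.ofReal (∫ z, smoothGreen R (e n) w z ∂μ) ≤
          ENNReal.ofReal (∫ z in K, smoothingError R (e n) w z ∂μ) + I := by
        rw [ofReal_integral_eq_lintegral_ofReal (hGint n) (Filter.Eventually.of_forall (hGn n))]
        refine (lintegral_mono h1).trans ?_
        rw [lintegral_add_right _ ((measurable_greenENN R w).indicator
          Metric.isOpen_ball.measurableSet),
          lintegral_indicator Metric.isClosed_closedBall.measurableSet,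
          lintegral_indicator Metric.isOpen_ball.measurableSet,
          ofReal_integral_eq_lintegral_ofReal (hEint n)
            (Filter.Eventually.of_forall fun z => smoothingError_nonneg _ _ _ _)]
      have hE0 : 0 ≤ ∫ z in K, smoothingError R (e n) w z ∂μ :=
        integral_nonneg fun z => smoothingError_nonneg _ _ _ _
      rw [← ENNReal.ofReal_toReal hIfin.ne, ← ENNReal.ofReal_add hE0 ENNReal.toReal_nonneg] at h2
      exact (ENNReal.ofReal_le_ofReal_iff (add_nonneg hE0 ENNReal.toReal_nonneg)).1 h2
    -- Stated for every real `c > u(w)`, this gives both conclusions: `u(w) = -∞` would allow `c` to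
    -- be arbitrarily negative, and otherwise `c` decreases to `u(w)`.
    have hkey : ∀ c : ℝ, u w < c → ∫ ζ, (u ζ).toReal ∂P ≤ c + I.toReal := by
      intro c hc
      have ht : Filter.Tendsto (fun n => (∫ z in K, smoothingError R (e n) w z ∂μ) + I.toReal + c)
          Filter.atTop (nhds (0 + I.toReal + c)) := (hE.add_const _).add_const _
      have := le_of_tendsto_of_tendsto hlim ht (by
        filter_upwards [het.eventually (hu.eventually_mollified_le hm hO hOc hwO hc)] with n hn
        linarith [(hcore n).2, hup n])
      linarith
    have huw : u w ≠ ⊥ := by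
      intro hbot
      have := hkey ((∫ ζ, (u ζ).toReal ∂P) - I.toReal - 1) (by rw [hbot]; exact EReal.bot_lt_coe _)
      linarith
    refine ⟨huw, ?_⟩
    refine le_of_forall_pos_le_add fun η hη => ?_
    have := hkey ((u w).toReal + η) (by
      conv_lhs => rw [← hu.coe_toReal hwO huw]
      exact_mod_cast (by linarith))
    linarith

end IsSubharmonicOn

/-! ### Dispensing with measurability off the domain -/

namespace IsSubharmonicOn

variable {u u' : ℂ → EReal} {O : Set ℂ}

theorem congr (hu : IsSubharmonicOn u O) (h : Set.EqOn u' u O) : IsSubharmonicOn u' O where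
  lt_top z hz := h hz ▸ hu.lt_top z hz
  upperSemicontinuousOn z hz a ha := by
    replace ha : u z < a := h hz ▸ ha
    filter_upwards [hu.upperSemicontinuousOn z hz a ha, self_mem_nhdsWithin] with x hx hxO
    exact (h hxO).trans_lt hx
  le_circleMean c t ht hball := by
    have hmean : circleMean u' c t = circleMean u c t := by
      simp only [circleMean, h (circleMap_mem ht hball _)]
    rw [hmean, h (hball (Metric.mem_closedBall_self ht.le))]
    exact hu.le_circleMean c t ht hball
  exists_ne_bot := by
    obtain ⟨z, hz, hne⟩ := hu.exists_ne_bot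
    exact ⟨z, hz, by rwa [h hz]⟩

/-- Upper semicontinuity makes the sublevel sets within `O` open, and off `O` the function is the
constant `0`. -/
theorem measurable_indicator (hu : IsSubharmonicOn u O) (hO : IsOpen O) :
    Measurable (O.indicator u) := by
  refine measurable_of_Iio fun a => ?_
  have hopen : IsOpen {z | z ∈ O ∧ u z < a} := by
    refine isOpen_iff_mem_nhds.2 fun z hz => ?_
    have h := hu.upperSemicontinuousOn z hz.1 a hz.2
    rw [hO.nhdsWithin_eq hz.1] at h
    filter_upwards [h, hO.mem_nhds hz.1] with x hx hxO using ⟨hxO, hx⟩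
  have heq : O.indicator u ⁻¹' Set.Iio a = {z | z ∈ O ∧ u z < a} ∪ (Oᶜ ∩ {_z | 0 < a}) := by
    ext z
    by_cases hz : z ∈ O <;> simp [hz]
  rw [heq]
  exact hopen.measurableSet.union (hO.measurableSet.compl.inter (.const _))

end IsSubharmonicOn

theorem isRieszMeasure_congr {u u' : ℂ → EReal} {O : Set ℂ} (h : Set.EqOn u' u O) :
    IsRieszMeasure u' O = IsRieszMeasure u O := by
  have key : ∀ {u u' : ℂ → EReal} {μ : Measure ℂ}, Set.EqOn u' u O → IsRieszMeasure u O μ →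
      IsRieszMeasure u' O μ := fun h hμ =>
    ⟨hμ.measure_compl, hμ.lt_top_of_isCompact, fun φ hφ hc hs => by
      rw [hμ.integral_eq φ hφ hc hs]
      congr 2
      ext z
      by_cases hz : z ∈ O
      · rw [h hz]
      · rw [laplacian_eq_zero_of_notMem_tsupport fun hz' => hz (hs hz'), mul_zero, mul_zero]⟩
  ext μ
  exact ⟨key h.symm, key h⟩

-- The Riesz measure is a chosen witness, so the defining predicates are shown to be equal and the
-- choice is then literally the same.
open Classical in
theorem rieszMeasure_congr {u u' : ℂ → EReal} {O : Set ℂ} (h : Set.EqOn u' u O) :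
    rieszMeasure u' O = rieszMeasure u O := by
  exact congrArg (fun P : Measure ℂ → Prop => if h : ∃ μ, P μ then h.choose else 0)
    (isRieszMeasure_congr h)

theorem IsSubharmonicOn.isRieszMeasure_rieszMeasure {u : ℂ → EReal} {O : Set ℂ}
    (hu : IsSubharmonicOn u O) (hm : Measurable u) (hO : IsOpen O) (hOc : IsConnected O) :
    IsRieszMeasure u O (rieszMeasure u O) := by
  have h := hu.exists_isRieszMeasure hm hO hOc
  rw [rieszMeasure, dif_pos h]
  exact h.choose_spec

theorem IsDeltaSubharmonicWith.congr {U u v u' v' : ℂ → EReal} {O : Set ℂ}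
    (hU : IsDeltaSubharmonicWith U u v O) (hu : Set.EqOn u' u O) (hv : Set.EqOn v' v O) :
    IsDeltaSubharmonicWith U u' v' O where
  left := hU.left.congr hu
  right := hU.right.congr hv
  eq_sub z hz h := by
    rw [hu hz, hv hz] at *
    exact hU.eq_sub z hz h

/-! ### The Riesz charge does not depend on the representation -/

theorem IsRieszMeasure.integrable {u : ℂ → EReal} {O : Set ℂ} {μ : Measure ℂ}
    (hμ : IsRieszMeasure u O μ) {φ : ℂ → ℝ} (hφ : Continuous φ) (hc : HasCompactSupport φ)
    (hs : tsupport φ ⊆ O) : Integrable φ μ := by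
  have h : IntegrableOn φ (tsupport φ) μ :=
    hφ.continuousOn.integrableOn_of_subset_isCompact hc.isCompact
      (isClosed_tsupport φ).measurableSet subset_rfl (hμ.lt_top_of_isCompact _ hc.isCompact hs).ne
  exact (integrableOn_iff_integrable_of_support_subset (subset_tsupport φ)).1 h

section

variable {U u v u₁ v₁ : ℂ → EReal} {O : Set ℂ} {R : ℝ} {w : ℂ}

theorem IsDeltaSubharmonicWith.ae_add_eq (hU : IsDeltaSubharmonicWith U u v O)
    (hU₁ : IsDeltaSubharmonicWith U u₁ v₁ O) (hu : Measurable u) (hv : Measurable v)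
    (hu₁ : Measurable u₁) (hv₁ : Measurable v₁) (hO : IsOpen O) (hOc : IsConnected O) :
    ∀ᵐ z, z ∈ O →
      (u z).toReal + (v₁ z).toReal = (u₁ z).toReal + (v z).toReal := by
  filter_upwards [hU.left.ae_ne_bot hu hO hOc, hU.right.ae_ne_bot hv hO hOc,
    hU₁.left.ae_ne_bot hu₁ hO hOc, hU₁.right.ae_ne_bot hv₁ hO hOc] with z h1 h2 h3 h4 hz
  have h := (hU.eq_sub z hz (.inl (h1 hz))).symm.trans (hU₁.eq_sub z hz (.inl (h3 hz)))
  rw [← hU.left.coe_toReal hz (h1 hz), ← hU.right.coe_toReal hz (h2 hz),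
    ← hU₁.left.coe_toReal hz (h3 hz), ← hU₁.right.coe_toReal hz (h4 hz)] at h
  norm_cast at h
  linarith

theorem IsDeltaSubharmonicWith.rieszMeasure_add_restrict_eq (hU : IsDeltaSubharmonicWith U u v O)
    (hU₁ : IsDeltaSubharmonicWith U u₁ v₁ O) (hu : Measurable u) (hv : Measurable v)
    (hu₁ : Measurable u₁) (hv₁ : Measurable v₁) (hO : IsOpen O) (hOc : IsConnected O)
    (hball : Metric.closedBall 0 R ⊆ O) :
    (rieszMeasure u O + rieszMeasure v₁ O).restrict (Metric.ball 0 R) =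
      (rieszMeasure u₁ O + rieszMeasure v O).restrict (Metric.ball 0 R) := by
  have hμu := hU.left.isRieszMeasure_rieszMeasure hu hO hOc
  have hμv := hU.right.isRieszMeasure_rieszMeasure hv hO hOc
  have hμu₁ := hU₁.left.isRieszMeasure_rieszMeasure hu₁ hO hOc
  have hμv₁ := hU₁.right.isRieszMeasure_rieszMeasure hv₁ hO hOc
  have hK := isCompact_closedBall (0 : ℂ) R
  refine restrict_ball_eq_of_integral_eq ?_ ?_ fun φ hφ hc hs => ?_
  · exact ENNReal.add_lt_top.2
      ⟨hμu.lt_top_of_isCompact _ hK hball, hμv₁.lt_top_of_isCompact _ hK hball⟩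
  · exact ENNReal.add_lt_top.2
      ⟨hμu₁.lt_top_of_isCompact _ hK hball, hμv.lt_top_of_isCompact _ hK hball⟩
  · have hsO := hs.trans hball
    have hφc := hφ.continuous
    rw [integral_add_measure (hμu.integrable hφc hc hsO) (hμv₁.integrable hφc hc hsO),
      integral_add_measure (hμu₁.integrable hφc hc hsO) (hμv.integrable hφc hc hsO),
      hμu.integral_eq φ hφ hc hsO, hμv.integral_eq φ hφ hc hsO, hμu₁.integral_eq φ hφ hc hsO,
      hμv₁.integral_eq φ hφ hc hsO, ← mul_add, ← mul_add,
      ← integral_add (hU.left.integrable_mul_laplacian hu hO hOc hφ hc hsO)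
        (hU₁.right.integrable_mul_laplacian hv₁ hO hOc hφ hc hsO),
      ← integral_add (hU₁.left.integrable_mul_laplacian hu₁ hO hOc hφ hc hsO)
        (hU.right.integrable_mul_laplacian hv hO hOc hφ hc hsO)]
    congr 1
    refine integral_congr_ae ?_
    filter_upwards [hU.ae_add_eq hU₁ hu hv hu₁ hv₁ hO hOc] with z hz
    by_cases hzO : z ∈ O
    · rw [← add_mul, ← add_mul, hz hzO]
    · rw [laplacian_eq_zero_of_notMem_tsupport fun hz' => hzO (hsO hz')]
      ring

/-- Cancellation in a difference of measures needs the subtracted measure finite, hence the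
restriction to `s` first: a Riesz measure may have infinite mass on `O`. -/
theorem MeasureTheory.Measure.restrict_le_sub_add_restrict {α β : Measure ℂ} {s : Set ℂ}
    (hs : MeasurableSet s) (hβ : β s < ⊤) (h : β ≤ α) :
    α.restrict s ≤ (α - β).restrict s + β.restrict s := by
  have : IsFiniteMeasure (β.restrict s) := ⟨by simpa using hβ⟩
  rw [Measure.restrict_sub_eq_restrict_sub_restrict hs,
    Measure.sub_add_cancel_of_le (Measure.restrict_mono subset_rfl h)]

/-- On the disc, the negative part of the charge of any representation is at most the lower
variation plus its positive part. -/
theorem IsDeltaSubharmonicWith.rieszMeasure_restrict_le (hU : IsDeltaSubharmonicWith U u v O)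
    (hU₁ : IsDeltaSubharmonicWith U u₁ v₁ O) (hu : Measurable u) (hv : Measurable v)
    (hu₁ : Measurable u₁) (hv₁ : Measurable v₁) (hO : IsOpen O) (hOc : IsConnected O)
    (hball : Metric.closedBall 0 R ⊆ O) :
    (rieszMeasure v₁ O).restrict (Metric.ball 0 R) ≤
      (lowerVariation u v O).restrict (Metric.ball 0 R) +
        (rieszMeasure u₁ O).restrict (Metric.ball 0 R) := by
  have hfin : rieszMeasure u O (Metric.ball 0 R) < ⊤ :=
    (measure_mono Metric.ball_subset_closedBall).trans_lt
      ((hU.left.isRieszMeasure_rieszMeasure hu hO hOc).lt_top_of_isCompact _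
        (isCompact_closedBall 0 R) hball)
  have h1 := hU.rieszMeasure_add_restrict_eq hU₁ hu hv hu₁ hv₁ hO hOc hball
  rw [Measure.restrict_add, Measure.restrict_add] at h1
  have h2 : (rieszMeasure v O).restrict (Metric.ball 0 R) ≤
      (lowerVariation u v O).restrict (Metric.ball 0 R) +
        (rieszMeasure u O).restrict (Metric.ball 0 R) :=
    (Measure.restrict_mono subset_rfl le_sup_left).trans
      (Measure.restrict_le_sub_add_restrict measurableSet_ball hfin le_sup_right)
  refine Measure.le_iff.2 fun s hs => ?_
  have h3 := congrArg (fun μ => μ s) h1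
  have h4 := h2 s
  simp only [Measure.add_apply] at h3 h4 ⊢
  have h5 : (rieszMeasure u O).restrict (Metric.ball 0 R) s ≠ ⊤ :=
    ne_top_of_le_ne_top hfin.ne (by
      simpa using measure_mono (μ := (rieszMeasure u O).restrict (Metric.ball 0 R)) s.subset_univ)
  -- The Riesz measure of `u` has finite mass on the disc, so it can be added to both sides and
  -- cancelled after `Δ_u + Δ_{v₁} = Δ_{u₁} + Δ_v` is applied.
  refine (ENNReal.add_le_add_iff_left h5).1 (h3.le.trans ?_)
  calc _ ≤ _ := add_le_add_right h4 _
    _ = _ := by ring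

/-- Bounding `|R² - z̄w|` by `2R²` is the source of the constant `2R` in the kernel. -/
theorem greenENN_le_logKernel (hw : ‖w‖ < R) {z : ℂ} (hz : ‖z‖ < R) :
    greenENN R w z ≤ logKernel R w z := by
  have hR : 0 < R := (norm_nonneg w).trans_lt hw
  unfold greenENN logKernel
  split_ifs with h
  · simp [h, ENNReal.div_zero, hR]
  · have hpos : 0 < ‖w - z‖ := norm_pos_iff.2 (sub_ne_zero.2 (Ne.symm h))
    have hG := norm_sq_sub_conj_mul_pos hz hw.le
    rw [← ENNReal.ofReal_div_of_pos hpos, ENNReal.log_ofReal_of_pos (by positivity),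
      EReal.real_coe_toENNReal]
    refine ENNReal.ofReal_le_ofReal ?_
    have hle : ‖(R : ℂ) ^ 2 - (starRingEnd ℂ) z * w‖ ≤ 2 * R * R := by
      refine (norm_sub_le _ _).trans ?_
      rw [norm_mul, RCLike.norm_conj, norm_pow, Complex.norm_real, Real.norm_eq_abs, sq_abs]
      nlinarith [norm_nonneg z, norm_nonneg w]
    rw [greenFn, Real.log_div (by positivity) hpos.ne', norm_sub_rev z w]
    have := Real.log_le_log hG hle
    rw [Real.log_mul (by positivity) hR.ne'] at this
    linarith

/-! ### Positive part of the circle mean -/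

/-- The values of `U` left free by the representation lie over a null set of the circle, and `U⁺`
has no negative part. -/
theorem IsDeltaSubharmonicWith.circleMean_max_eq (hU : IsDeltaSubharmonicWith U u v O)
    (hu : Measurable u) (hv : Measurable v) (hO : IsOpen O) (hOc : IsConnected O) (hR : 0 < R)
    (hball : Metric.closedBall 0 R ⊆ O) :
    circleMean (fun z => max (U z) 0) 0 R =
      ((∫ ζ, max ((u ζ).toReal - (v ζ).toReal) 0 ∂(circleProb R) : ℝ) : EReal) := by
  have hμu := hU.left.isRieszMeasure_rieszMeasure hu hO hOc
  have hμv := hU.right.isRieszMeasure_rieszMeasure hv hO hOc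
  obtain ⟨hu0, hui⟩ := hU.left.ae_circleProb_ne_bot_and_integrable hu hO hOc hμu hR hball
  obtain ⟨hv0, hvi⟩ := hU.right.ae_circleProb_ne_bot_and_integrable hv hO hOc hμv hR hball
  have hint : Integrable (fun ζ => max ((u ζ).toReal - (v ζ).toReal) 0) (circleProb R) :=
    (hui.sub hvi).pos_part
  have hae : ∀ᵐ θ ∂(volume.restrict (Set.Ioc 0 (2 * Real.pi))),
      (max (U (circleMap 0 R θ)) 0).toENNReal = ENNReal.ofReal
        (max ((u (circleMap 0 R θ)).toReal - (v (circleMap 0 R θ)).toReal) 0) := by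
    have h := hu0.and hv0
    rw [circleProb, Measure.ae_ennreal_smul_measure_iff (by simp [Real.pi_pos])] at h
    filter_upwards [ae_of_ae_map (continuous_circleMap 0 R).measurable.aemeasurable h] with θ hθ
    have hO' := IsSubharmonicOn.circleMap_mem hR hball θ
    rw [hU.eq_sub _ hO' (.inl hθ.1), ← hU.left.coe_toReal hO' hθ.1,
      ← hU.right.coe_toReal hO' hθ.2, ← EReal.coe_sub, ← EReal.coe_zero, ← EReal.coe_strictMono.monotone.map_max,
      EReal.real_coe_toENNReal]
    simp
  have hneg : ∀ z, (-max (U z) 0).toENNReal = 0 := fun z =>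
    EReal.toENNReal_of_nonpos (by simp)
  rw [circleMean]
  simp only [hneg, lintegral_zero, mul_zero, EReal.coe_ennreal_zero, sub_zero]
  rw [lintegral_congr_ae hae, ← lintegral_circleProb
    (g := fun ζ => ENNReal.ofReal (max ((u ζ).toReal - (v ζ).toReal) 0))
    ((hu.ereal_toReal.sub hv.ereal_toReal).max measurable_const).ennreal_ofReal,
    ← ofReal_integral_eq_lintegral_ofReal hint
      (Filter.Eventually.of_forall fun ζ => le_max_right _ _), EReal.coe_ennreal_ofReal,
    max_eq_left (integral_nonneg (μ := circleProb R)
      (f := fun ζ => max ((u ζ).toReal - (v ζ).toReal) 0) fun ζ => le_max_right _ _)]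

theorem integral_poissonMeasure_le {g : ℂ → ℝ} {r : ℝ} (hwr : ‖w‖ ≤ r) (hrR : r < R)
    (hg : Integrable g (circleProb R)) :
    ∫ ζ, g ζ ∂(poissonMeasure R w) ≤ (R + r) / (R - r) * ∫ ζ, max (g ζ) 0 ∂(circleProb R) := by
  have hw := hwr.trans_lt hrR
  have hg' : Integrable (fun ζ => max (g ζ) 0) (circleProb R) := hg.pos_part
  have hR : 0 < R := (norm_nonneg w).trans_lt hw
  have hc : (R + ‖w‖) / (R - ‖w‖) ≤ (R + r) / (R - r) :=
    div_le_div₀ (by linarith [norm_nonneg w]) (by linarith) (by linarith) (by linarith)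
  calc ∫ ζ, g ζ ∂(poissonMeasure R w)
      ≤ ∫ ζ, max (g ζ) 0 ∂(poissonMeasure R w) :=
        integral_mono (integrable_poissonMeasure hw hg) (integrable_poissonMeasure hw hg')
          fun ζ => le_max_left _ _
    _ ≤ ∫ ζ, max (g ζ) 0 ∂(ENNReal.ofReal ((R + ‖w‖) / (R - ‖w‖)) • circleProb R) :=
        integral_mono_measure (poissonMeasure_le hw)
          (Filter.Eventually.of_forall fun ζ => le_max_right _ _)
          (hg'.smul_measure ENNReal.ofReal_ne_top)
    _ = (R + ‖w‖) / (R - ‖w‖) * ∫ ζ, max (g ζ) 0 ∂(circleProb R) := by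
        rw [integral_smul_measure, ENNReal.toReal_ofReal
          (div_nonneg (by linarith [norm_nonneg w]) (by linarith)), smul_eq_mul]
    _ ≤ _ := mul_le_mul_of_nonneg_right hc (integral_nonneg fun ζ => le_max_right _ _)

/-! ### The main inequality -/

theorem IsDeltaSubharmonicWith.le_circleMean_add_lintegral (hU : IsDeltaSubharmonicWith U u v O)
    (hU₁ : IsDeltaSubharmonicWith U u₁ v₁ O) (hu : Measurable u) (hv : Measurable v)
    (hu₁ : Measurable u₁) (hv₁ : Measurable v₁) (hO : IsOpen O) (hOc : IsConnected O)
    (hball : Metric.closedBall 0 R ⊆ O) {r : ℝ} (hwr : ‖w‖ ≤ r) (hrR : r < R)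
    (hdef : u₁ w ≠ ⊥ ∨ v₁ w ≠ ⊥) :
    U w ≤ (((R + r) / (R - r) : ℝ) : EReal) * circleMean (fun z => max (U z) 0) 0 R +
      ((∫⁻ z in Metric.ball (0 : ℂ) R, logKernel R w z ∂(lowerVariation u v O) : ℝ≥0∞) : EReal) := by
  have hw := hwr.trans_lt hrR
  have hR : 0 < R := (norm_nonneg w).trans_lt hw
  have hwO : w ∈ O := hball (by simp [hw.le])
  have hμu := hU₁.left.isRieszMeasure_rieszMeasure hu₁ hO hOc
  have hμv := hU₁.right.isRieszMeasure_rieszMeasure hv₁ hO hOc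
  obtain ⟨-, hui⟩ := hU₁.left.ae_circleProb_ne_bot_and_integrable hu₁ hO hOc hμu hR hball
  obtain ⟨-, hvi⟩ := hU₁.right.ae_circleProb_ne_bot_and_integrable hv₁ hO hOc hμv hR hball
  have hJu := (hU₁.left.poissonJensen hu₁ hO hOc hμu hw hball).1
  have hJv := (hU₁.right.poissonJensen hv₁ hO hOc hμv hw hball).2
  have hle := lintegral_mono' (hU.rieszMeasure_restrict_le hU₁ hu hv hu₁ hv₁ hO hOc hball)
    (le_refl (greenENN R w))
  rw [lintegral_add_measure] at hle
  have hker : ∫⁻ z in Metric.ball 0 R, greenENN R w z ∂(lowerVariation u v O) ≤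
      ∫⁻ z in Metric.ball 0 R, logKernel R w z ∂(lowerVariation u v O) := by
    refine lintegral_mono_ae ?_
    filter_upwards [ae_restrict_mem measurableSet_ball] with z hz
    exact greenENN_le_logKernel hw (by simpa using hz)
  rw [hU₁.circleMean_max_eq hu₁ hv₁ hO hOc hR hball, ← EReal.coe_mul]
  have hP := integral_poissonMeasure_le hwr hrR (hui.sub hvi)
  simp only [Pi.sub_apply] at hP
  rw [integral_sub (integrable_poissonMeasure hw hui) (integrable_poissonMeasure hw hvi)] at hP
  set X := (R + r) / (R - r) * ∫ ζ, max ((u₁ ζ).toReal - (v₁ ζ).toReal) 0 ∂(circleProb R)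
  set N := ∫⁻ z in Metric.ball 0 R, logKernel R w z ∂(lowerVariation u v O)
  set A := ∫⁻ z in Metric.ball 0 R, greenENN R w z ∂(rieszMeasure u₁ O)
  set B := ∫⁻ z in Metric.ball 0 R, greenENN R w z ∂(rieszMeasure v₁ O)
  have hBN : B ≤ N + A := hle.trans (add_le_add_left hker A)
  rw [hU₁.eq_sub w hwO hdef]
  by_cases huw : u₁ w = ⊥
  · simp [huw]
  obtain ⟨hA, hJu⟩ := hJu huw
  by_cases hN : N = ⊤
  · simp [hN]
  -- Finiteness of the Green potential of `Δ_{v₁}` rules out `v₁(w) = -∞`, so `U(w)` is not `+∞` and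
  -- real arithmetic applies.
  obtain ⟨hvw, hJv⟩ := hJv (hBN.trans_lt (ENNReal.add_lt_top.2 ⟨lt_top_iff_ne_top.2 hN, hA⟩))
  have hBN' : B.toReal ≤ N.toReal + A.toReal := by
    rw [← ENNReal.toReal_add hN hA.ne]
    exact ENNReal.toReal_mono (ENNReal.add_ne_top.2 ⟨hN, hA.ne⟩) hBN
  rw [← hU₁.left.coe_toReal hwO huw, ← hU₁.right.coe_toReal hwO hvw,
    ← EReal.coe_ennreal_toReal hN]
  norm_cast
  linarith

end

theorem mainTheorem2 (r R : ℝ) (hr : 0 < r) (hrR : r < R)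
    (O : Set ℂ) (hO : IsOpen O) (hOconn : IsConnected O) (hRO : Metric.closedBall (0 : ℂ) R ⊆ O)
    (U u v : ℂ → EReal) (hU : IsDeltaSubharmonicWith U u v O) :
    ∀ w ∈ Metric.closedBall (0 : ℂ) r, IsDefinedAt U O w →
      U w ≤ (((R + r) / (R - r) : ℝ) : EReal) * circleMean (fun z => max (U z) 0) 0 R +
        ((∫⁻ z in Metric.ball (0 : ℂ) R, logKernel R w z ∂(lowerVariation u v O) : ℝ≥0∞) : EReal) := by
  rintro w hw ⟨u₁, v₁, hU₁, hdef⟩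
  have hwr : ‖w‖ ≤ r := by simpa using hw
  have hwO : w ∈ O := hRO (by simpa using hwr.trans hrR.le)
  have hind : ∀ f : ℂ → EReal, Set.EqOn (O.indicator f) f O := fun f =>
    Set.eqOn_indicator
  -- Nothing is assumed of the functions off `O`; extending them by zero makes them Borel without
  -- changing the charge.
  have hvar : lowerVariation (O.indicator u) (O.indicator v) O = lowerVariation u v O := by
    simp only [lowerVariation, rieszMeasure_congr (hind _)]
  rw [← hvar]
  refine (hU.congr (hind u) (hind v)).le_circleMean_add_lintegral
    (hU₁.congr (hind u₁) (hind v₁)) (hU.left.measurable_indicator hO)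
    (hU.right.measurable_indicator hO) (hU₁.left.measurable_indicator hO)
    (hU₁.right.measurable_indicator hO) hO hOconn hRO hwr hrR ?_
  rwa [hind u₁ hwO, hind v₁ hwO]
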